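/- Setting. Fix $n$ processes $P_1,\dots,P_n$, sets of methods, arguments and return values. A concurrent object $\mathcal O$ consists of a shared memory and, for each process $P_i$, method $m$ and argument $a$, a (possibly nondeterministic) program working on this memory; an unfinished method execution always has an executable next command or is about to return a value, and calls and returns themselves do not touch the shared memory. Its semantics $\llbracket\mathcal O,n\rrbracket$ is the labelled transition system (LTS) of $n$ processes each of which repeatedly calls arbitrary methods with arbitrary arguments; its labels are the call actions $call(P_i,m,a)$, the return actions $return(P_i,m,b)$ and internal actions of processes. The history of a trace is its projection to call and return actions. A sequential specification $Spec$ is the set of finite traces of an LTS $T$ whose labels are operations $m(a)\Rightarrow b$. It is deterministic (resp. non-blocking) if from each state of $T$ there is, for all $m$ and $a$, at most (resp. at least) one transition with a label of the form $m(a)\Rightarrow\cdot$. A linearization of a history $h$ is a sequential history $s$, whose operations form a sequence in $Spec$, such that for some extension $h'$ of $h$ by return actions $s$ has the same process subhistories as the part of $h'$ without unanswered calls, and such that whenever an operation returns in $h$ before an operation occurring in $s$ is called in $h$, the two occur in this order in $s$. $\mathcal O$ is linearizable w.r.t. $Spec$ if the history of each finite trace of $\llbracket\mathcal O,n\rrbracket$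 has a linearization, and strongly linearizable if linearizations $f(e)$ of the histories of the finite traces $e$ can be chosen so that $f(e_1)$ is a prefix of $f(e_2)$ whenever $e_1$ is a prefix of $e_2$. Call an infinite trace scheduled if it contains no unanswered call or the process of at least one of its unanswered calls acts infinitely often. $\mathcal O$ is wait-free (WF) if in every scheduled infinite trace every call is answered; lock-free (LF) if in every scheduled infinite trace, whenever a call is pending, some process returns later; obstruction-free (OF) if the latter holds in every scheduled infinite trace in which from some point on only one process acts. For LTSs $A_1,A_2$ write $A_1\preceq_{(c,r)}A_2$ if there is a forward simulation, i.e. a relation $R$ that relates the initial states and such that, if $R(c_1,c_2)$ and $c_1\xrightarrow{\alpha}c_1'$, then some finite path leads from $c_2$ to a state $c_2'$ with $R(c_1',c_2')$ and has the same call and return actions as $\alpha$. For $Prog\in\{WF,LF,OF\}$, a $Prog$-$\preceq_{(c,r)}$-class for $Spec$ is a set $S$ of LTSs such that (1) each element of $S$ is $\llbracket\mathcal O',n\rrbracket$ for some object $\mathcal O'$ that is linearizable w.r.t. $Spec$ and satisfies $Prog$; (2) any two elements of $S$ simulate each other; (3) if $\mathcal O'$ is linearizable w.r.t. $Spec$ and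 satisfies $Prog$, and $\llbracket\mathcal O',n\rrbracket$ and some element of $S$ simulate each other, then $\llbracket\mathcal O',n\rrbracket\in S$. $\mathcal A_{Spec}$ denotes the classical wait-free universal construction of Herlihy and Shavit: each operation announces a node with its invocation; the processes thread the announced nodes into a linked list, the successor of each node being decided by a consensus object in that node and processes helping each other in round-robin fashion according to the sequence numbers of the nodes; an operation whose node has been threaded obtains its result by replaying the list up to its node on a private copy of the sequential object $T$. Theorem. Let $Spec$ be a deterministic and non-blocking sequential specification, let $Prog\in\{WF,LF,OF\}$, and let $\mathcal O$ be a concurrent object that is strongly linearizable w.r.t. $Spec$ and satisfies $Prog$ for $n$ processes. Then $\llbracket\mathcal O,n\rrbracket$ lies in exactly one $Prog$-$\preceq_{(c,r)}$-class $S_{(\mathcal O,Prog)}$ for $Spec$, $\llbracket\mathcal A_{Spec},n\rrbracket$ lies in exactly one such class $S_{(\mathcal A_{Spec},Prog)}$, and $$S_{(\mathcal O,Prog)}=S_{(\mathcal A_{Spec},Prog)}.$$ Consequently, if $\mathcal O'$ is also strongly linearizable w.r.t. $Spec$ and satisfies $Prog$ for $n$ processes, then $\llbracket\mathcal O,n\rrbracket\preceq_{(c,r)}\llbracket\mathcal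 O',n\rrbracket$ and $\llbracket\mathcal O',n\rrbracket\preceq_{(c,r)}\llbracket\mathcal O,n\rrbracket$. -/

import Mathlib

universe u

/-! ### Actions, histories, sequential specifications -/

/-- An operation `m(a) ⇒ b`. -/
structure Op (M A B : Type u) where
  method : M
  arg : A
  res : B

/-- The visible actions of `n` processes: `call(P_p, m, a)` and `return(P_p, m, b)`. -/
inductive ObjAction (n : ℕ) (M A B : Type u) : Type u
  | call (p : Fin n) (m : M) (a : A)
  | ret (p : Fin n) (m : M) (b : B)

namespace ObjAction

variable {n : ℕ} {M A B : Type u}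

/-- The process that performs an action. -/
def proc : ObjAction n M A B → Fin n
  | call p _ _ => p
  | ret p _ _ => p

def isCall : ObjAction n M A B → Bool
  | call _ _ _ => true
  | ret _ _ _ => false

def isRet : ObjAction n M A B → Bool
  | call _ _ _ => false
  | ret _ _ _ => true

end ObjAction

/-- An LTS whose transition labels are operations, as used to present a sequential
specification. -/
structure SeqLTS (M A B : Type u) where
  State : Type u
  init : State
  step : State → Op M A B → State → Prop

namespace SeqLTS

variable {M A B : Type u}

/-- `T.Run q l q'`: the operation sequence `l` leads from `q` to `q'`. -/
inductive Run (T : SeqLTS M A B) : T.State → List (Op M A B) → T.State → Prop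
  | nil (q : T.State) : Run T q [] q
  | cons {q q' q'' : T.State} {o : Op M A B} {l : List (Op M A B)} :
      T.step q o q' → Run T q' l q'' → Run T q (o :: l) q''

/-- The sequential specification presented by `T`: its set of finite traces. -/
def traces (T : SeqLTS M A B) : Set (List (Op M A B)) :=
  {l | ∃ q, T.Run T.init l q}

/-- From each state, for each `m` and `a`, at most one transition labelled `m(a) ⇒ _`. -/
def Deterministic (T : SeqLTS M A B) : Prop :=
  ∀ (q : T.State) (m : M) (a : A) (b₁ b₂ : B) (q₁ q₂ : T.State),
    T.step q ⟨m, a, b₁⟩ q₁ → T.step q ⟨m, a, b₂⟩ q₂ → b₁ = b₂ ∧ q₁ = q₂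

/-- From each state, for each `m` and `a`, at least one transition labelled `m(a) ⇒ _`. -/
def NonBlocking (T : SeqLTS M A B) : Prop :=
  ∀ (q : T.State) (m : M) (a : A), ∃ (b : B) (q' : T.State), T.step q ⟨m, a, b⟩ q'

end SeqLTS

/-! ### Linearizations -/

section Linearization

variable {n : ℕ} {M A B : Type u}

/-- The sequential history in which the processes and operations listed in `l` are executed
one after the other. -/
def seqHistory (l : List (Fin n × Op M A B)) : List (ObjAction n M A B) :=
  l.flatMap fun x => [ObjAction.call x.1 x.2.method x.2.arg, ObjAction.ret x.1 x.2.method x.2.res]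

/-- The sequential histories of `n` processes that correspond to `Spec`. -/
def toHistory (Spec : Set (List (Op M A B))) (n : ℕ) : Set (List (ObjAction n M A B)) :=
  {s | ∃ l : List (Fin n × Op M A B), l.map Prod.snd ∈ Spec ∧ s = seqHistory l}

/-- The process subhistory `h|p`. -/
def subhistory (h : List (ObjAction n M A B)) (p : Fin n) : List (ObjAction n M A B) :=
  h.filter fun x => x.proc = p

/-- Two histories are equivalent if all their process subhistories agree. -/
def HistEquiv (h h' : List (ObjAction n M A B)) : Prop :=
  ∀ p, subhistory h p = subhistory h' p

open Classical in
/-- `complete h` deletes from `h` the calls that have no matching return. (In the histories in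
question the actions of each process alternate between calls and returns, so that a pending
call is the last action of its process.) -/
noncomputable def complete : List (ObjAction n M A B) → List (ObjAction n M A B)
  | [] => []
  | ObjAction.call p m a :: h =>
      if ∃ b, ObjAction.ret p m b ∈ h then ObjAction.call p m a :: complete h else complete h
  | ObjAction.ret p m b :: h => ObjAction.ret p m b :: complete h

/-- The number of calls of process `p` in `h`. -/
def numCalls (h : List (ObjAction n M A B)) (p : Fin n) : ℕ :=
  h.countP fun x => x.isCall && decide (x.proc = p)

/-- The number of returns of process `p` in `h`. -/
def numRets (h : List (ObjAction n M A B)) (p : Fin n) : ℕ :=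
  h.countP fun x => x.isRet && decide (x.proc = p)

/-- The happens-before relation of `h`. The pair `(p, k)` stands for the operation number `k`
of process `p`, counted from `0`. `HB h (p, k) (q, l)` says that there is a point in `h`
before which the operation `(p, k)` has returned and after which `(q, l)` is called. -/
def HB (h : List (ObjAction n M A B)) (o₁ o₂ : Fin n × ℕ) : Prop :=
  ∃ u v, h = u ++ v ∧ o₁.2 < numRets u o₁.1 ∧
    numCalls u o₂.1 ≤ o₂.2 ∧ o₂.2 < numCalls h o₂.1

/-- `s` is a linearization of `h` with respect to `Spec`. The order condition concerns the
operations that occur in `s`: all completed operations of `h`, and those of its pending ones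
that are completed in the extension of `h`. -/
def IsLinearization (Spec : Set (List (Op M A B))) (h s : List (ObjAction n M A B)) : Prop :=
  s ∈ toHistory Spec n ∧
  (∃ r : List (ObjAction n M A B), (∀ x ∈ r, x.isRet = true) ∧ HistEquiv (complete (h ++ r)) s) ∧
  ∀ o₁ o₂ : Fin n × ℕ, o₂.2 < numCalls s o₂.1 → HB h o₁ o₂ → HB s o₁ o₂

end Linearization

/-! ### Labelled transition systems of `n` processes and forward simulation -/

/-- Transition labels: visible actions, and internal actions `c` of a process `p`. -/
inductive Label (n : ℕ) (M A B I : Type u) : Type u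
  | vis (x : ObjAction n M A B)
  | internal (p : Fin n) (c : I)

namespace Label

variable {n : ℕ} {M A B I : Type u}

def proc : Label n M A B I → Fin n
  | vis x => x.proc
  | internal p _ => p

/-- The visible part of a label. -/
def visible : Label n M A B I → Option (ObjAction n M A B)
  | vis x => some x
  | internal _ _ => none

/-- The label is a call action of process `p`. -/
def IsCallOf (p : Fin n) (l : Label n M A B I) : Prop := ∃ m a, l = vis (ObjAction.call p m a)

/-- The label is a return action of process `p`. -/
def IsRetOf (p : Fin n) (l : Label n M A B I) : Prop := ∃ m b, l = vis (ObjAction.ret p m b)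

end Label

/-- The projection of a sequence of labels to call and return actions. -/
def history {n : ℕ} {M A B I : Type u} (e : List (Label n M A B I)) : List (ObjAction n M A B) :=
  e.filterMap Label.visible

/-- An LTS over the call, return and internal actions of `n` processes. -/
structure LTS (n : ℕ) (M A B : Type u) where
  State : Type u
  Internal : Type u
  init : State
  trans : State → Label n M A B Internal → State → Prop

namespace LTS

variable {n : ℕ} {M A B : Type u}

/-- `L.Path c e c'`: a finite path from `c` to `c'` with label sequence `e`. -/
inductive Path (L : LTS n M A B) : L.State → List (Label n M A B L.Internal) → L.State → Prop
  | nil (c : L.State) : Path L c [] c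
  | cons {c c' c'' : L.State} {x : Label n M A B L.Internal}
      {e : List (Label n M A B L.Internal)} :
      L.trans c x c' → Path L c' e c'' → Path L c (x :: e) c''

/-- The set of finite traces. -/
def traces (L : LTS n M A B) : Set (List (Label n M A B L.Internal)) :=
  {e | ∃ c, L.Path L.init e c}

/-- The set of infinite traces. -/
def infTraces (L : LTS n M A B) : Set (ℕ → Label n M A B L.Internal) :=
  {w | ∃ c : ℕ → L.State, c 0 = L.init ∧ ∀ k, L.trans (c k) (w k) (c (k + 1))}

/-- `L₁ ⪯ L₂`: there is a forward simulation relation between `L₁` and `L₂` for which exactly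
the call and return actions are visible. -/
def Sim (L₁ L₂ : LTS n M A B) : Prop :=
  ∃ R : L₁.State → L₂.State → Prop, R L₁.init L₂.init ∧
    ∀ c₁ c₂ x c₁', R c₁ c₂ → L₁.trans c₁ x c₁' →
      ∃ e c₂', L₂.Path c₂ e c₂' ∧ history [x] = history e ∧ R c₁' c₂'

end LTS

/-! ### Liveness properties of infinite traces -/

section Liveness

variable {n : ℕ} {M A B I : Type u}

/-- At index `k` of `w` process `p` performs a call that is never answered. -/
def ForeverPending (w : ℕ → Label n M A B I) (p : Fin n) (k : ℕ) : Prop :=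
  (w k).IsCallOf p ∧ ∀ j, k < j → ¬ (w j).IsRetOf p

/-- If there are calls that are never answered, then the process of at least one of them is
scheduled infinitely often. -/
def Sched (w : ℕ → Label n M A B I) : Prop :=
  (∃ p k, ForeverPending w p k) →
    ∃ p k, ForeverPending w p k ∧ ∀ N, ∃ j, N ≤ j ∧ (w j).proc = p

/-- From some point on, only one process is scheduled. -/
def Iso (w : ℕ → Label n M A B I) : Prop :=
  ∃ p N, ∀ j, N ≤ j → (w j).proc = p

/-- Each call is eventually answered. -/
def ProgT (w : ℕ → Label n M A B I) : Prop :=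
  ∀ p k, (w k).IsCallOf p → ∃ j, k < j ∧ (w j).IsRetOf p

/-- Whenever some call is pending, some process eventually returns. -/
def ProgS (w : ℕ → Label n M A B I) : Prop :=
  ∀ N, (∃ p k, k < N ∧ (w k).IsCallOf p ∧ ∀ j, k < j → j < N → ¬ (w j).IsRetOf p) →
    ∃ q j, N ≤ j ∧ (w j).IsRetOf q

/-- The three progress conditions: wait-freedom, lock-freedom, obstruction-freedom. -/
inductive Progress
  | WF
  | LF
  | OF

/-- An infinite trace satisfies a progress condition. -/
def Progress.Holds (w : ℕ → Label n M A B I) : Progress → Prop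
  | .WF => Sched w → ProgT w
  | .LF => Sched w → ProgS w
  | .OF => Sched w ∧ Iso w → ProgS w

end Liveness

/-! ### Concurrent objects -/

/-- A concurrent object for `n` processes: a shared memory `Mem`, and for each process and
each invocation a program over it. `Loc` is the type of local states (control point and
registers) of a method execution, `Cmd` the type of the internal actions.
A local state `ℓ` with `ret ℓ = some b` is about to return `b`; in any other local state the
next command can always be executed, possibly in several ways. -/
structure ConcurrentObject (n : ℕ) (M A B : Type u) where
  Mem : Type u
  Loc : Type u
  Cmd : Type u
  init : Mem
  start : Fin n → M → A → Loc
  ret : Loc → Option B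
  step : Fin n → Loc → Mem → Cmd → Loc → Mem → Prop
  enabled : ∀ (p : Fin n) (ℓ : Loc) (μ : Mem), ret ℓ = none → ∃ c ℓ' μ', step p ℓ μ c ℓ' μ'

namespace ConcurrentObject

variable {n : ℕ} {M A B : Type u}

/-- Configurations: the shared memory, and for each process either `none` (it is idle) or the
method that it is executing with its local state. -/
structure Config (O : ConcurrentObject n M A B) where
  mem : O.Mem
  procs : Fin n → Option (M × O.Loc)

/-- The transitions of `n` processes, each of which runs the most general client. -/
inductive Trans (O : ConcurrentObject n M A B) :
    O.Config → Label n M A B O.Cmd → O.Config → Prop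
  | call (C : O.Config) (p : Fin n) (m : M) (a : A) : C.procs p = none →
      Trans O C (Label.vis (ObjAction.call p m a))
        ⟨C.mem, Function.update C.procs p (some (m, O.start p m a))⟩
  | internal (C : O.Config) (p : Fin n) (m : M) (ℓ ℓ' : O.Loc) (c : O.Cmd) (μ' : O.Mem) :
      C.procs p = some (m, ℓ) → O.ret ℓ = none → O.step p ℓ C.mem c ℓ' μ' →
      Trans O C (Label.internal p c) ⟨μ', Function.update C.procs p (some (m, ℓ'))⟩
  | ret (C : O.Config) (p : Fin n) (m : M) (ℓ : O.Loc) (b : B) :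
      C.procs p = some (m, ℓ) → O.ret ℓ = some b →
      Trans O C (Label.vis (ObjAction.ret p m b)) ⟨C.mem, Function.update C.procs p none⟩

/-- The operational semantics `⟦O, n⟧`. -/
def sem (O : ConcurrentObject n M A B) : LTS n M A B where
  State := O.Config
  Internal := O.Cmd
  init := ⟨O.init, fun _ => none⟩
  trans := O.Trans

/-- Every finite trace has a linearizable history. -/
def Linearizable (O : ConcurrentObject n M A B) (Spec : Set (List (Op M A B))) : Prop :=
  ∀ e ∈ O.sem.traces, ∃ s, IsLinearization Spec (history e) s

/-- Every infinite trace satisfies the progress condition. -/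
def Satisfies (O : ConcurrentObject n M A B) (P : Progress) : Prop :=
  ∀ w ∈ O.sem.infTraces, P.Holds w

end ConcurrentObject

/-- The prefix-closure of a set of sequences. -/
def prefixClosure {α : Type u} (E : Set (List α)) : Set (List α) :=
  {e | ∃ e' ∈ E, e <+: e'}

/-- Strong linearizability of a set of traces: there is a prefix-preserving choice of
linearizations for the prefixes of these traces. -/
def StronglyLinearizableSet {n : ℕ} {M A B I : Type u} (E : Set (List (Label n M A B I)))
    (Spec : Set (List (Op M A B))) : Prop :=
  ∃ f : List (Label n M A B I) → List (ObjAction n M A B),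
    (∀ e ∈ prefixClosure E, IsLinearization Spec (history e) (f e)) ∧
    ∀ e₁ ∈ prefixClosure E, ∀ e₂ ∈ prefixClosure E, e₁ <+: e₂ → f e₁ <+: f e₂

/-- Strong linearizability of an object. -/
def ConcurrentObject.StronglyLinearizable {n : ℕ} {M A B : Type u}
    (O : ConcurrentObject n M A B) (Spec : Set (List (Op M A B))) : Prop :=
  StronglyLinearizableSet O.sem.traces Spec

/-- `S` is a `P`-`⪯`-class for `Spec` (and `n` processes). -/
structure IsProgressClass {n : ℕ} {M A B : Type u} (P : Progress)
    (Spec : Set (List (Op M A B))) (S : Set (LTS n M A B)) : Prop where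
  isObject : ∀ L ∈ S, ∃ O : ConcurrentObject n M A B,
    L = O.sem ∧ O.Linearizable Spec ∧ O.Satisfies P
  sim : ∀ L₁ ∈ S, ∀ L₂ ∈ S, L₁.Sim L₂ ∧ L₂.Sim L₁
  maximal : ∀ O : ConcurrentObject n M A B, O.Linearizable Spec → O.Satisfies P →
    ∀ L ∈ S, O.sem.Sim L → L.Sim O.sem → O.sem ∈ S

/-! ### The classical wait-free universal construction

Each operation announces a node and helps to thread nodes into a linked list, where the
successor of a node is chosen by a consensus object stored in the node. When its node has been
threaded, an operation computes its result by replaying the list on a private copy of the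
sequential object. The program of process `i`, with invocation `invoc`, is

  announce[i] := new Node(invoc)
  head[i] := Node.max(head)
  while announce[i].seq = 0 do
    before := head[i]
    help := announce[(before.seq + 1) % n]
    if help.seq = 0 then prefer := help else prefer := announce[i]
    after := before.decideNext.decide(prefer)
    before.next := after
    after.seq := before.seq + 1
    head[i] := after
  current := tail.next
  while current ≠ announce[i] do
    apply current.invoc to the private sequential object
    current := current.next
  head[i] := announce[i]
  return the result of applying current.invoc to the private sequential object

Initially the list consists of the sentinel `tail`, with `tail.seq = 1`, and all entries of
`head` and `announce` point to it. -/

namespace Universal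

/-- A node. Nodes are referred to by their addresses, which are natural numbers;
`invoc = none` for the sentinel, `decideNext` is the state of the consensus object (the value
decided, if any), `seq = 0` as long as the node is not known to be threaded. -/
structure Node (M A : Type u) where
  invoc : Option (M × A)
  decideNext : Option ℕ
  seq : ℕ
  next : Option ℕ

/-- The shared memory; `fresh` is the next unused address. -/
structure Mem (n : ℕ) (M A : Type u) where
  heap : ℕ → Node M A
  fresh : ℕ
  announce : Fin n → ℕ
  head : Fin n → ℕ

/-- The address of the sentinel. -/
def tail : ℕ := 0

/-- Initially only the sentinel is allocated. -/
def initMem (n : ℕ) (M A : Type u) : Mem n M A where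
  heap := fun x => ⟨none, none, if x = tail then 1 else 0, none⟩
  fresh := tail + 1
  announce := fun _ => tail
  head := fun _ => tail

/-- Local states of an operation; `me` is the address of its own node, which is also the
value of `announce[i]`. Each one is named after the command to be executed next. -/
inductive Loc (n : ℕ) (M A B Q : Type u) : Type u
  /-- `announce[i] := new Node(m, a)` -/
  | announce (m : M) (a : A)
  /-- computing `Node.max(head)`: read `head[k]`; the maximum so far is the node `best`, with
  sequence number `bestSeq` -/
  | scanHead (me : ℕ) (k : Fin n) (best bestSeq : ℕ)
  /-- computing `Node.max(head)`: read the sequence number of `cand`, found in `head[k]` -/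
  | scanSeq (me : ℕ) (k : Fin n) (cand best bestSeq : ℕ)
  /-- `head[i] := best` -/
  | writeMax (me best : ℕ)
  /-- test `announce[i].seq = 0` -/
  | test (me : ℕ)
  /-- `before := head[i]` -/
  | readHead (me : ℕ)
  /-- read `before.seq` -/
  | readSeq (me before : ℕ)
  /-- `help := announce[(s + 1) % n]`, where `s` is the value read from `before.seq` -/
  | readHelp (me before s : ℕ)
  /-- test `help.seq = 0` and set `prefer` -/
  | testHelp (me before s help : ℕ)
  /-- `after := before.decideNext.decide(prefer)` -/
  | decide (me before s prefer : ℕ)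
  /-- `before.next := after` -/
  | writeNext (me before s after : ℕ)
  /-- `after.seq := s + 1` -/
  | writeSeq (me s after : ℕ)
  /-- `head[i] := after` -/
  | writeHead (me after : ℕ)
  /-- `current := tail.next` -/
  | replayFirst (me : ℕ)
  /-- the replay loop; the private sequential object is in state `q` -/
  | replay (me : ℕ) (q : Q) (current : Option ℕ)
  /-- compute the result of the own invocation -/
  | respond (me : ℕ) (q : Q)
  /-- `return b` -/
  | done (b : B)

variable {n : ℕ} {M A B : Type u}

/-- Replace the node at address `x`. -/
def Mem.setNode (μ : Mem n M A) (x : ℕ) (v : Node M A) : Mem n M A :=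
  { μ with heap := Function.update μ.heap x v }

/-- Write `head[p]`. -/
def Mem.setHead (μ : Mem n M A) (p : Fin n) (x : ℕ) : Mem n M A :=
  { μ with head := Function.update μ.head p x }

/-- Allocate a new node and write its address to `announce[p]`. -/
def Mem.announceNew (μ : Mem n M A) (p : Fin n) (m : M) (a : A) : Mem n M A :=
  { μ with
    heap := Function.update μ.heap μ.fresh ⟨some (m, a), none, 0, none⟩
    fresh := μ.fresh + 1
    announce := Function.update μ.announce p μ.fresh }

/-- The index `k % n`. -/
def helpIndex (p : Fin n) (k : ℕ) : Fin n := ⟨k % n, Nat.mod_lt k p.pos⟩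

/-- The local state after the entry `head[k]` has been examined. -/
def scanNext {Q : Type u} (me : ℕ) (k : Fin n) (best bestSeq : ℕ) : Loc n M A B Q :=
  if h : k.val + 1 < n then .scanHead me ⟨k.val + 1, h⟩ best bestSeq else .writeMax me best

/-- The steps of process `p`. Each step accesses at most one mutable shared location (the
field `invoc` of a node never changes after its creation). The last three rules only serve to
give the program a step where it would dereference a null pointer, which never happens. -/
inductive Step (T : SeqLTS M A B) (p : Fin n) :
    Loc n M A B T.State → Mem n M A → Loc n M A B T.State → Mem n M A → Prop
  | announce (μ : Mem n M A) (m : M) (a : A) :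
      Step T p (.announce m a) μ
        (.scanHead μ.fresh ⟨0, p.pos⟩ tail 1) (μ.announceNew p m a)
  | scanHead (μ : Mem n M A) (me : ℕ) (k : Fin n) (best bestSeq : ℕ) :
      Step T p (.scanHead me k best bestSeq) μ (.scanSeq me k (μ.head k) best bestSeq) μ
  | scanSeq_better (μ : Mem n M A) (me : ℕ) (k : Fin n) (cand best bestSeq : ℕ) :
      bestSeq < (μ.heap cand).seq →
      Step T p (.scanSeq me k cand best bestSeq) μ (scanNext me k cand (μ.heap cand).seq) μ
  | scanSeq_worse (μ : Mem n M A) (me : ℕ) (k : Fin n) (cand best bestSeq : ℕ) :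
      (μ.heap cand).seq ≤ bestSeq →
      Step T p (.scanSeq me k cand best bestSeq) μ (scanNext me k best bestSeq) μ
  | writeMax (μ : Mem n M A) (me best : ℕ) :
      Step T p (.writeMax me best) μ (.test me) (μ.setHead p best)
  | test_enter (μ : Mem n M A) (me : ℕ) : (μ.heap me).seq = 0 →
      Step T p (.test me) μ (.readHead me) μ
  | test_exit (μ : Mem n M A) (me : ℕ) : (μ.heap me).seq ≠ 0 →
      Step T p (.test me) μ (.replayFirst me) μ
  | readHead (μ : Mem n M A) (me : ℕ) :
      Step T p (.readHead me) μ (.readSeq me (μ.head p)) μ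
  | readSeq (μ : Mem n M A) (me before : ℕ) :
      Step T p (.readSeq me before) μ (.readHelp me before (μ.heap before).seq) μ
  | readHelp (μ : Mem n M A) (me before s : ℕ) :
      Step T p (.readHelp me before s) μ
        (.testHelp me before s (μ.announce (helpIndex p (s + 1)))) μ
  | testHelp_help (μ : Mem n M A) (me before s help : ℕ) : (μ.heap help).seq = 0 →
      Step T p (.testHelp me before s help) μ (.decide me before s help) μ
  | testHelp_self (μ : Mem n M A) (me before s help : ℕ) : (μ.heap help).seq ≠ 0 →
      Step T p (.testHelp me before s help) μ (.decide me before s me) μ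
  | decide_first (μ : Mem n M A) (me before s prefer : ℕ) :
      (μ.heap before).decideNext = none →
      Step T p (.decide me before s prefer) μ (.writeNext me before s prefer)
        (μ.setNode before { μ.heap before with decideNext := some prefer })
  | decide_later (μ : Mem n M A) (me before s prefer after : ℕ) :
      (μ.heap before).decideNext = some after →
      Step T p (.decide me before s prefer) μ (.writeNext me before s after) μ
  | writeNext (μ : Mem n M A) (me before s after : ℕ) :
      Step T p (.writeNext me before s after) μ (.writeSeq me s after)
        (μ.setNode before { μ.heap before with next := some after })
  | writeSeq (μ : Mem n M A) (me s after : ℕ) :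
      Step T p (.writeSeq me s after) μ (.writeHead me after)
        (μ.setNode after { μ.heap after with seq := s + 1 })
  | writeHead (μ : Mem n M A) (me after : ℕ) :
      Step T p (.writeHead me after) μ (.test me) (μ.setHead p after)
  | replayFirst (μ : Mem n M A) (me : ℕ) :
      Step T p (.replayFirst me) μ (.replay me T.init (μ.heap tail).next) μ
  | replay_apply (μ : Mem n M A) (me current : ℕ) (q q' : T.State) (m : M) (a : A) (b : B) :
      current ≠ me → (μ.heap current).invoc = some (m, a) → T.step q ⟨m, a, b⟩ q' →
      Step T p (.replay me q (some current)) μ (.replay me q' (μ.heap current).next) μ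
  | replay_exit (μ : Mem n M A) (me : ℕ) (q : T.State) :
      Step T p (.replay me q (some me)) μ (.respond me q) (μ.setHead p me)
  | respond (μ : Mem n M A) (me : ℕ) (q q' : T.State) (m : M) (a : A) (b : B) :
      (μ.heap me).invoc = some (m, a) → T.step q ⟨m, a, b⟩ q' →
      Step T p (.respond me q) μ (.done b) μ
  | fault_null (μ : Mem n M A) (me : ℕ) (q : T.State) :
      Step T p (.replay me q none) μ (.replay me q none) μ
  | fault_replay (μ : Mem n M A) (me current : ℕ) (q : T.State) :
      current ≠ me → (μ.heap current).invoc = none →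
      Step T p (.replay me q (some current)) μ (.replay me q (some current)) μ
  | fault_respond (μ : Mem n M A) (me : ℕ) (q : T.State) : (μ.heap me).invoc = none →
      Step T p (.respond me q) μ (.respond me q) μ

/-- The value that a local state is about to return. -/
def retVal {Q : Type u} : Loc n M A B Q → Option B
  | .done b => some b
  | _ => none

theorem step_enabled (T : SeqLTS M A B) (hT : T.NonBlocking) (p : Fin n)
    (ℓ : Loc n M A B T.State) (μ : Mem n M A) (h : retVal ℓ = none) :
    ∃ ℓ' μ', Step T p ℓ μ ℓ' μ' := by
  cases ℓ with
  | announce m a => exact ⟨_, _, .announce μ m a⟩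
  | scanHead me k best s => exact ⟨_, _, .scanHead μ me k best s⟩
  | scanSeq me k cand best s =>
    rcases lt_or_ge s (μ.heap cand).seq with h1 | h1
    · exact ⟨_, _, .scanSeq_better μ me k cand best s h1⟩
    · exact ⟨_, _, .scanSeq_worse μ me k cand best s h1⟩
  | writeMax me best => exact ⟨_, _, .writeMax μ me best⟩
  | test me =>
    by_cases h1 : (μ.heap me).seq = 0
    · exact ⟨_, _, .test_enter μ me h1⟩
    · exact ⟨_, _, .test_exit μ me h1⟩
  | readHead me => exact ⟨_, _, .readHead μ me⟩
  | readSeq me before => exact ⟨_, _, .readSeq μ me before⟩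
  | readHelp me before s => exact ⟨_, _, .readHelp μ me before s⟩
  | testHelp me before s help =>
    by_cases h1 : (μ.heap help).seq = 0
    · exact ⟨_, _, .testHelp_help μ me before s help h1⟩
    · exact ⟨_, _, .testHelp_self μ me before s help h1⟩
  | decide me before s prefer =>
    cases h1 : (μ.heap before).decideNext with
    | none => exact ⟨_, _, .decide_first μ me before s prefer h1⟩
    | some y => exact ⟨_, _, .decide_later μ me before s prefer y h1⟩
  | writeNext me before s y => exact ⟨_, _, .writeNext μ me before s y⟩
  | writeSeq me s y => exact ⟨_, _, .writeSeq μ me s y⟩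
  | writeHead me y => exact ⟨_, _, .writeHead μ me y⟩
  | replayFirst me => exact ⟨_, _, .replayFirst μ me⟩
  | replay me q cur =>
    cases cur with
    | none => exact ⟨_, _, .fault_null μ me q⟩
    | some x =>
      by_cases h1 : x = me
      · subst h1
        exact ⟨_, _, .replay_exit μ x q⟩
      · cases h2 : (μ.heap x).invoc with
        | none => exact ⟨_, _, .fault_replay μ me x q h1 h2⟩
        | some y =>
          obtain ⟨m, a⟩ := y
          obtain ⟨b, q', h3⟩ := hT q m a
          exact ⟨_, _, .replay_apply μ me x q q' m a b h1 h2 h3⟩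
  | respond me q =>
    cases h2 : (μ.heap me).invoc with
    | none => exact ⟨_, _, .fault_respond μ me q h2⟩
    | some y =>
      obtain ⟨m, a⟩ := y
      obtain ⟨b, q', h3⟩ := hT q m a
      exact ⟨_, _, .respond μ me q q' m a b h2 h3⟩
  | done b => simp [retVal] at h

end Universal

/-- The wait-free universal construction for `n` processes, for the sequential specification
that is presented by the non-blocking LTS `T`. -/
def universalObject (n : ℕ) {M A B : Type u} (T : SeqLTS M A B) (hT : T.NonBlocking) :
    ConcurrentObject n M A B where
  Mem := Universal.Mem n M A
  Loc := Universal.Loc n M A B T.State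
  Cmd := PUnit
  init := Universal.initMem n M A
  start := fun _ m a => .announce m a
  ret := Universal.retVal
  step := fun p ℓ μ _ ℓ' μ' => Universal.Step T p ℓ μ ℓ' μ'
  enabled := fun p ℓ μ h => by
    obtain ⟨ℓ', μ', h'⟩ := Universal.step_enabled T hT p ℓ μ h
    exact ⟨PUnit.unit, ℓ', μ', h'⟩

/-! ### Paths and simulations -/

/-! All comparisons pass through one LTS, the atomic object `SeqLTS.atomic`, where an operation
consists of a call, a single internal step that performs a transition of `T`, and a return. Three
facts about it carry the theorem.

Strongly linearizable objects are simulated by the atomic object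
(`StronglyLinearizable.sim_atomic`). Since the choice of linearizations preserves prefixes, a step
of the object can only append operations to the linearization. Each appended operation is pending at
that moment, so the atomic object can let it take effect there. Determinism makes the state of `T` a
function of the operations chosen so far.

Linearizable obstruction-free objects simulate the atomic object (`atomic_sim`); strong
linearizability plays no role here. The object answers a call by a call and leaves the operation
untouched until the atomic object executes its effect; then the operation runs alone until it is
about to return. Calls and returns do not touch the memory, so the memory is always one that a
purely sequential execution produces. In that sequential execution obstruction-freedom gives
termination, and linearizability with determinism gives the right result. Wait-freedom and
lock-freedom imply obstruction-freedom.

The universal construction is simulated by the atomic object (`universalObject_sim_atomic`) and is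
wait-free (`universalObject_waitFree`). An operation takes effect when its node is decided as the
successor of the last node, possibly by a step of another process; replaying the list reproduces the
result fixed then. For termination, take a node of process `p` and a large `K` with `(K + 1) % n =
p`. Whoever selects a successor for the node with number `K` inspects `announce[p]`, so the node is
threaded at index `K` at the latest, and both the loop and the replay are bounded.

Simulation by the atomic object also yields linearizability of the construction, so the second fact
applies to it. Hence it and all strongly linearizable objects with the progress property are
equivalent to the atomic object. -/

theorem history_append {n : ℕ} {M A B I : Type u} (e₁ e₂ : List (Label n M A B I)) :
    history (e₁ ++ e₂) = history e₁ ++ history e₂ := by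
  simp [history]

@[simp] theorem history_nil {n : ℕ} {M A B I : Type u} :
    history ([] : List (Label n M A B I)) = [] := rfl

@[simp] theorem history_vis_cons {n : ℕ} {M A B I : Type u} (x : ObjAction n M A B)
    (e : List (Label n M A B I)) : history (Label.vis x :: e) = x :: history e := by
  simp [history, Label.visible]

@[simp] theorem history_internal_cons {n : ℕ} {M A B I : Type u} (p : Fin n) (c : I)
    (e : List (Label n M A B I)) : history (Label.internal p c :: e) = history e := rfl

theorem history_cons {n : ℕ} {M A B I : Type u} (x : Label n M A B I)
    (e : List (Label n M A B I)) : history (x :: e) = history [x] ++ history e :=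
  history_append [x] e

namespace LTS

variable {n : ℕ} {M A B : Type u}

theorem Path.append {L : LTS n M A B} {c c' c'' : L.State}
    {e e' : List (Label n M A B L.Internal)} (h : L.Path c e c') (h' : L.Path c' e' c'') :
    L.Path c (e ++ e') c'' := by
  induction h with
  | nil => exact h'
  | cons hx _ ih => exact .cons hx (ih h')

theorem Path.single {L : LTS n M A B} {c c' : L.State} {x : Label n M A B L.Internal}
    (h : L.trans c x c') : L.Path c [x] c' :=
  .cons h (.nil _)

/-- Induction on a path from its end. -/
theorem Path.snoc_induction {L : LTS n M A B} {c : L.State}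
    {motive : List (Label n M A B L.Internal) → L.State → Prop}
    (nil : motive [] c)
    (snoc : ∀ e c' x c'', L.Path c e c' → motive e c' → L.trans c' x c'' →
      motive (e ++ [x]) c'')
    {e : List (Label n M A B L.Internal)} {c' : L.State} (h : L.Path c e c') : motive e c' := by
  have key : ∀ {d : L.State} {e' : List (Label n M A B L.Internal)} {d' : L.State},
      L.Path d e' d' → ∀ e₀, L.Path c e₀ d → motive e₀ d → motive (e₀ ++ e') d' := by
    intro d e' d' h'
    induction h' with
    | nil => intro e₀ _ h0; simpa using h0
    | cons hx _ ih =>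
      intro e₀ hp h0
      simpa using ih _ (hp.append (.single hx)) (snoc _ _ _ _ hp h0 hx)
  simpa using key h [] (.nil c) nil

theorem path_of_step_sim {L₁ L₂ : LTS n M A B} {R : L₁.State → L₂.State → Prop}
    (hR : ∀ c₁ c₂ x c₁', R c₁ c₂ → L₁.trans c₁ x c₁' →
      ∃ e c₂', L₂.Path c₂ e c₂' ∧ history [x] = history e ∧ R c₁' c₂')
    {c₁ c₁' : L₁.State} {e : List (Label n M A B L₁.Internal)} (h : L₁.Path c₁ e c₁') :
    ∀ c₂, R c₁ c₂ → ∃ e' c₂', L₂.Path c₂ e' c₂' ∧ history e = history e' ∧ R c₁' c₂' := by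
  induction h with
  | nil c => exact fun c₂ h => ⟨[], c₂, .nil _, rfl, h⟩
  | @cons c c' c'' x e hx _ ih =>
    intro c₂ h
    obtain ⟨e₁, d, hd, he₁, hRd⟩ := hR _ _ _ _ h hx
    obtain ⟨e₂, d', hd', he₂, hRd'⟩ := ih d hRd
    exact ⟨e₁ ++ e₂, d', hd.append hd', by rw [history_cons, history_append, he₁, he₂], hRd'⟩

theorem Sim.trans {L₁ L₂ L₃ : LTS n M A B} (h₁ : L₁.Sim L₂) (h₂ : L₂.Sim L₃) : L₁.Sim L₃ := by
  obtain ⟨R, hR0, hR⟩ := h₁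
  obtain ⟨S, hS0, hS⟩ := h₂
  refine ⟨fun a c => ∃ b, R a b ∧ S b c, ⟨_, hR0, hS0⟩, ?_⟩
  rintro c₁ c₃ x c₁' ⟨c₂, h12, h23⟩ hx
  obtain ⟨e, c₂', hp, he, h12'⟩ := hR _ _ _ _ h12 hx
  obtain ⟨e', c₃', hp', he', h23'⟩ := path_of_step_sim hS hp c₃ h23
  exact ⟨e', c₃', hp', he.trans he', c₂', h12', h23'⟩

/-- Simulation implies inclusion of histories. Through this, linearizability passes from the atomic
object to every object that it simulates. -/
theorem Sim.exists_trace {L₁ L₂ : LTS n M A B} (h : L₁.Sim L₂)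
    {e : List (Label n M A B L₁.Internal)} (he : e ∈ L₁.traces) :
    ∃ e' ∈ L₂.traces, history e = history e' := by
  obtain ⟨R, hR0, hR⟩ := h
  obtain ⟨c, hc⟩ := he
  obtain ⟨e', c', hp, hh, -⟩ := path_of_step_sim hR hc _ hR0
  exact ⟨e', ⟨c', hp⟩, hh⟩

/-- A finite path followed by an infinite one. -/
theorem exists_infTrace_of_path {L : LTS n M A B} {c c' : L.State}
    {e : List (Label n M A B L.Internal)} (h : L.Path c e c') :
    ∀ (cs : ℕ → L.State) (w : ℕ → Label n M A B L.Internal), cs 0 = c' →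
      (∀ k, L.trans (cs k) (w k) (cs (k + 1))) →
      ∃ (cs' : ℕ → L.State) (w' : ℕ → Label n M A B L.Internal), cs' 0 = c ∧
        (∀ k, L.trans (cs' k) (w' k) (cs' (k + 1))) ∧ ∀ k, w' (e.length + k) = w k := by
  induction h with
  | nil => exact fun cs w h0 h => ⟨cs, w, h0, h, fun k => by simp⟩
  | @cons c c' c'' x e hx _ ih =>
    intro cs w h0 h
    obtain ⟨cs', w', h0', h', hw⟩ := ih cs w h0 h
    refine ⟨fun k => Nat.casesOn k c cs', fun k => Nat.casesOn k x w', rfl, ?_, ?_⟩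
    · rintro (_ | k)
      · simpa [h0'] using hx
      · exact h' k
    · intro k
      have : (x :: e).length + k = (e.length + k) + 1 := by simp; omega
      rw [this]
      exact hw k

end LTS

/-! ### Sequential histories -/

section Histories

variable {n : ℕ} {M A B : Type u}

/-- The operations of process `p` in a list of operations. -/
def opsOf (l : List (Fin n × Op M A B)) (p : Fin n) : List (Fin n × Op M A B) :=
  l.filter fun x => x.1 = p

@[simp] theorem opsOf_nil (p : Fin n) : opsOf ([] : List (Fin n × Op M A B)) p = [] := rfl

@[simp] theorem opsOf_append (l₁ l₂ : List (Fin n × Op M A B)) (p : Fin n) :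
    opsOf (l₁ ++ l₂) p = opsOf l₁ p ++ opsOf l₂ p := by
  simp [opsOf]

theorem opsOf_cons_self (p : Fin n) (o : Op M A B) (l : List (Fin n × Op M A B)) :
    opsOf ((p, o) :: l) p = (p, o) :: opsOf l p := by
  simp [opsOf]

theorem opsOf_cons_ne {p q : Fin n} (hpq : p ≠ q) (o : Op M A B) (l : List (Fin n × Op M A B)) :
    opsOf ((p, o) :: l) q = opsOf l q := by
  simp [opsOf, hpq]

theorem eq_nil_of_opsOf {l : List (Fin n × Op M A B)} (h : ∀ p, opsOf l p = []) : l = [] := by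
  cases l with
  | nil => rfl
  | cons x l =>
    have := h x.1
    rw [show x = (x.1, x.2) from rfl, opsOf_cons_self] at this
    simp at this

@[simp] theorem seqHistory_nil : seqHistory ([] : List (Fin n × Op M A B)) = [] := rfl

@[simp] theorem seqHistory_cons (x : Fin n × Op M A B) (l : List (Fin n × Op M A B)) :
    seqHistory (x :: l) = ObjAction.call x.1 x.2.method x.2.arg ::
      ObjAction.ret x.1 x.2.method x.2.res :: seqHistory l := rfl

@[simp] theorem seqHistory_append (l₁ l₂ : List (Fin n × Op M A B)) :
    seqHistory (l₁ ++ l₂) = seqHistory l₁ ++ seqHistory l₂ := by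
  simp [seqHistory]

@[simp] theorem length_seqHistory (l : List (Fin n × Op M A B)) :
    (seqHistory l).length = 2 * l.length := by
  induction l with
  | nil => rfl
  | cons x l ih => simp [ih]; omega

theorem seqHistory_injective :
    Function.Injective (seqHistory : List (Fin n × Op M A B) → List (ObjAction n M A B)) := by
  intro l
  induction l with
  | nil =>
    intro l' h
    cases l' with
    | nil => rfl
    | cons y l' => simp at h
  | cons x l ih =>
    intro l' h
    cases l' with
    | nil => simp at h
    | cons y l' =>
      obtain ⟨p, m, a, b⟩ := x
      obtain ⟨p', m', a', b'⟩ := y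
      simp only [seqHistory_cons, List.cons.injEq, ObjAction.call.injEq,
        ObjAction.ret.injEq] at h
      obtain ⟨⟨rfl, rfl, rfl⟩, ⟨-, -, rfl⟩, h⟩ := h
      rw [ih h]

/-- Translates prefix preservation of a choice of linearizations into extension of operation lists.
-/
theorem seqHistory_prefix {l₁ l₂ : List (Fin n × Op M A B)}
    (h : seqHistory l₁ <+: seqHistory l₂) : ∃ l, l₂ = l₁ ++ l := by
  induction l₁ generalizing l₂ with
  | nil => exact ⟨l₂, rfl⟩
  | cons x l₁ ih =>
    cases l₂ with
    | nil => simp at h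
    | cons y l₂ =>
      obtain ⟨p, m, a, b⟩ := x
      obtain ⟨p', m', a', b'⟩ := y
      simp only [seqHistory_cons, List.cons_prefix_cons, ObjAction.call.injEq,
        ObjAction.ret.injEq] at h
      obtain ⟨⟨rfl, rfl, rfl⟩, ⟨-, -, rfl⟩, h⟩ := h
      obtain ⟨l, rfl⟩ := ih h
      exact ⟨l, rfl⟩

theorem seqHistory_append_eq {l l₁ : List (Fin n × Op M A B)} {t : List (ObjAction n M A B)}
    (h : seqHistory l ++ t = seqHistory l₁) : ∃ l₂, l₁ = l ++ l₂ ∧ t = seqHistory l₂ := by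
  obtain ⟨l₂, rfl⟩ := seqHistory_prefix ⟨t, h⟩
  exact ⟨l₂, rfl, by simpa using h⟩

@[simp] theorem subhistory_nil (p : Fin n) :
    subhistory ([] : List (ObjAction n M A B)) p = [] := rfl

@[simp] theorem subhistory_append (h₁ h₂ : List (ObjAction n M A B)) (p : Fin n) :
    subhistory (h₁ ++ h₂) p = subhistory h₁ p ++ subhistory h₂ p := by
  simp [subhistory]

theorem subhistory_singleton_self (x : ObjAction n M A B) :
    subhistory [x] x.proc = [x] := by
  simp [subhistory]

theorem subhistory_singleton_ne {x : ObjAction n M A B} {p : Fin n} (h : x.proc ≠ p) :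
    subhistory [x] p = [] := by
  simp [subhistory, h]

theorem subhistory_seqHistory (l : List (Fin n × Op M A B)) (p : Fin n) :
    subhistory (seqHistory l) p = seqHistory (opsOf l p) := by
  induction l with
  | nil => rfl
  | cons x l ih =>
    obtain ⟨q, o⟩ := x
    by_cases hq : q = p
    · subst hq
      rw [opsOf_cons_self, seqHistory_cons, seqHistory_cons, ← ih]
      simp [subhistory, ObjAction.proc]
    · rw [opsOf_cons_ne hq, seqHistory_cons, ← ih]
      simp [subhistory, ObjAction.proc, hq]

theorem numCalls_eq (h : List (ObjAction n M A B)) (p : Fin n) :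
    numCalls h p = (subhistory h p).countP ObjAction.isCall := by
  simp [numCalls, subhistory, List.countP_filter]

theorem numRets_eq (h : List (ObjAction n M A B)) (p : Fin n) :
    numRets h p = (subhistory h p).countP ObjAction.isRet := by
  simp [numRets, subhistory, List.countP_filter]

theorem countP_isCall_seqHistory (l : List (Fin n × Op M A B)) :
    (seqHistory l).countP ObjAction.isCall = l.length := by
  induction l with
  | nil => rfl
  | cons x l ih =>
    rw [seqHistory_cons, List.countP_cons, List.countP_cons, ih]
    rfl

theorem countP_isRet_seqHistory (l : List (Fin n × Op M A B)) :
    (seqHistory l).countP ObjAction.isRet = l.length := by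
  induction l with
  | nil => rfl
  | cons x l ih =>
    rw [seqHistory_cons, List.countP_cons, List.countP_cons, ih]
    rfl

@[simp] theorem numCalls_seqHistory (l : List (Fin n × Op M A B)) (p : Fin n) :
    numCalls (seqHistory l) p = (opsOf l p).length := by
  rw [numCalls_eq, subhistory_seqHistory, countP_isCall_seqHistory]

@[simp] theorem numRets_seqHistory (l : List (Fin n × Op M A B)) (p : Fin n) :
    numRets (seqHistory l) p = (opsOf l p).length := by
  rw [numRets_eq, subhistory_seqHistory, countP_isRet_seqHistory]

theorem numCalls_append (h₁ h₂ : List (ObjAction n M A B)) (p : Fin n) :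
    numCalls (h₁ ++ h₂) p = numCalls h₁ p + numCalls h₂ p := by
  simp [numCalls]

theorem numRets_append (h₁ h₂ : List (ObjAction n M A B)) (p : Fin n) :
    numRets (h₁ ++ h₂) p = numRets h₁ p + numRets h₂ p := by
  simp [numRets]

theorem numCalls_mono {h₁ h₂ : List (ObjAction n M A B)} (h : h₁ <+: h₂) (p : Fin n) :
    numCalls h₁ p ≤ numCalls h₂ p := by
  obtain ⟨t, rfl⟩ := h
  rw [numCalls_append]
  omega

theorem numRets_mono {h₁ h₂ : List (ObjAction n M A B)} (h : h₁ <+: h₂) (p : Fin n) :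
    numRets h₁ p ≤ numRets h₂ p := by
  obtain ⟨t, rfl⟩ := h
  rw [numRets_append]
  omega

/-! ### Completions -/

theorem mem_subhistory {h : List (ObjAction n M A B)} {p : Fin n} {x : ObjAction n M A B} :
    x ∈ subhistory h p ↔ x ∈ h ∧ x.proc = p := by
  simp [subhistory]

theorem subhistory_cons_of_eq {x : ObjAction n M A B} {p : Fin n} (hx : x.proc = p)
    (h : List (ObjAction n M A B)) : subhistory (x :: h) p = x :: subhistory h p := by
  simp [subhistory, hx]

theorem subhistory_cons_of_ne {x : ObjAction n M A B} {p : Fin n} (hx : x.proc ≠ p)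
    (h : List (ObjAction n M A B)) : subhistory (x :: h) p = subhistory h p := by
  simp [subhistory, hx]

/-- Whether a call is kept depends only on later returns of the same process, so completions can be
studied one process at a time. -/
theorem subhistory_complete (h : List (ObjAction n M A B)) (p : Fin n) :
    subhistory (complete h) p = complete (subhistory h p) := by
  induction h with
  | nil => rfl
  | cons x h ih =>
    by_cases hx : x.proc = p
    · rw [subhistory_cons_of_eq hx]
      cases x with
      | ret q m b =>
        simp only [complete]
        rw [subhistory_cons_of_eq hx, ih]
      | call q m a =>
        have hq : q = p := hx
        subst hq
        have : (∃ b, ObjAction.ret q m b ∈ subhistory h q) ↔ ∃ b, ObjAction.ret q m b ∈ h := by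
          simp only [mem_subhistory]
          exact ⟨fun ⟨b, hb⟩ => ⟨b, hb.1⟩, fun ⟨b, hb⟩ => ⟨b, hb, rfl⟩⟩
        simp only [complete]
        by_cases hb : ∃ b, ObjAction.ret q m b ∈ h
        · rw [if_pos hb, if_pos (this.2 hb), subhistory_cons_of_eq hx, ih]
        · rw [if_neg hb, if_neg fun h' => hb (this.1 h'), ih]
    · rw [subhistory_cons_of_ne hx, ← ih]
      cases x with
      | ret q m b =>
        simp only [complete]
        rw [subhistory_cons_of_ne hx]
      | call q m a =>
        simp only [complete]
        split_ifs
        · rw [subhistory_cons_of_ne hx]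
        · rfl

theorem complete_seqHistory_append (l : List (Fin n × Op M A B))
    (t : List (ObjAction n M A B)) :
    complete (seqHistory l ++ t) = seqHistory l ++ complete t := by
  induction l with
  | nil => rfl
  | cons x l ih =>
    simp only [seqHistory_cons, List.cons_append, complete, ih]
    rw [if_pos ⟨x.2.res, by simp⟩]

theorem complete_of_forall_isRet {r : List (ObjAction n M A B)}
    (h : ∀ x ∈ r, x.isRet = true) : complete r = r := by
  induction r with
  | nil => rfl
  | cons x r ih =>
    cases x with
    | call => simpa [ObjAction.isRet] using h _ (List.mem_cons_self ..)
    | ret => simp [complete, ih fun y hy => h y (List.mem_cons_of_mem _ hy)]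

theorem forall_isRet_subhistory {r : List (ObjAction n M A B)} (h : ∀ x ∈ r, x.isRet = true)
    (p : Fin n) : ∀ x ∈ subhistory r p, x.isRet = true :=
  fun x hx => h x (List.mem_of_mem_filter hx)

/-- A nonempty sequential history starts with a call. Hence returns added to a history cannot
contribute operations of their own. -/
theorem eq_nil_of_isRet_of_eq_seqHistory {r : List (ObjAction n M A B)}
    (h : ∀ x ∈ r, x.isRet = true) {l : List (Fin n × Op M A B)} (hl : r = seqHistory l) :
    l = [] := by
  cases l with
  | nil => rfl
  | cons x l =>
    subst hl
    simpa [ObjAction.isRet] using h (ObjAction.call x.1 x.2.method x.2.arg) (by simp)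

end Histories

/-! ### The atomic object -/

/-- The status of a process of the atomic object: idle, executing a method that has not yet
taken effect, or about to return. -/
inductive OpStatus (M A B : Type u) : Type u
  | idle
  | called (m : M) (a : A)
  | done (m : M) (b : B)

/-- The operation lists `l` and histories `h` of process `p` that agree with its status, when
`l` contains the operations that have taken effect. -/
def OpStatus.Agrees {n : ℕ} {M A B : Type u} (p : Fin n) (h : List (ObjAction n M A B))
    (l : List (Fin n × Op M A B)) : OpStatus M A B → Prop
  | idle => h = seqHistory l
  | called m a => h = seqHistory l ++ [ObjAction.call p m a]
  | done m b => ∃ a l', l = l' ++ [(p, ⟨m, a, b⟩)] ∧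
      h = seqHistory l' ++ [ObjAction.call p m a]

/-- The operations in `l` have taken effect in the history `h`, and `st` gives the status of the
processes. -/
def Agree {n : ℕ} {M A B : Type u} (h : List (ObjAction n M A B))
    (l : List (Fin n × Op M A B)) (st : Fin n → OpStatus M A B) : Prop :=
  ∀ p, (st p).Agrees p (subhistory h p) (opsOf l p)

namespace SeqLTS

variable {M A B : Type u} {T : SeqLTS M A B}

/-- Configurations of the atomic object. -/
structure AtomicConfig (T : SeqLTS M A B) (n : ℕ) where
  state : T.State
  status : Fin n → OpStatus M A B

/-- The transitions of the atomic object, in which each operation takes effect in one internal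
step. -/
inductive AtomicTrans (T : SeqLTS M A B) (n : ℕ) :
    T.AtomicConfig n → Label n M A B PUnit.{u + 1} → T.AtomicConfig n → Prop
  | call (q : T.State) (st : Fin n → OpStatus M A B) (p : Fin n) (m : M) (a : A) :
      st p = .idle → AtomicTrans T n ⟨q, st⟩ (Label.vis (ObjAction.call p m a))
        ⟨q, Function.update st p (.called m a)⟩
  | effect (q q' : T.State) (st : Fin n → OpStatus M A B) (p : Fin n) (m : M) (a : A) (b : B) :
      st p = .called m a → T.step q ⟨m, a, b⟩ q' →
      AtomicTrans T n ⟨q, st⟩ (Label.internal p PUnit.unit)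
        ⟨q', Function.update st p (.done m b)⟩
  | ret (q : T.State) (st : Fin n → OpStatus M A B) (p : Fin n) (m : M) (b : B) :
      st p = .done m b → AtomicTrans T n ⟨q, st⟩ (Label.vis (ObjAction.ret p m b))
        ⟨q, Function.update st p .idle⟩

/-- The LTS of `n` processes that use an atomic object with specification `T`. -/
abbrev atomic (T : SeqLTS M A B) (n : ℕ) : LTS n M A B where
  State := T.AtomicConfig n
  Internal := PUnit.{u + 1}
  init := ⟨T.init, fun _ => .idle⟩
  trans := AtomicTrans T n

theorem Run.append {q q' q'' : T.State} {l l' : List (Op M A B)} (h : T.Run q l q')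
    (h' : T.Run q' l' q'') : T.Run q (l ++ l') q'' := by
  induction h with
  | nil => exact h'
  | cons hs _ ih => exact .cons hs (ih h')

theorem run_append {q q'' : T.State} {l l' : List (Op M A B)} (h : T.Run q (l ++ l') q'') :
    ∃ q', T.Run q l q' ∧ T.Run q' l' q'' := by
  induction l generalizing q with
  | nil => exact ⟨q, .nil q, h⟩
  | cons o l ih =>
    cases h with
    | cons hs h =>
      obtain ⟨q', h1, h2⟩ := ih h
      exact ⟨q', .cons hs h1, h2⟩

theorem run_singleton {q q' : T.State} {o : Op M A B} : T.Run q [o] q' ↔ T.step q o q' := by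
  constructor
  · intro h
    cases h with
    | cons hs h => cases h; exact hs
  · exact fun h => .cons h (.nil _)

/-- This is where determinism enters the simulations: the state is recovered from the operation list
alone. -/
theorem Run.unique (hT : T.Deterministic) {q q₁ q₂ : T.State} {l : List (Op M A B)}
    (h₁ : T.Run q l q₁) (h₂ : T.Run q l q₂) : q₁ = q₂ := by
  induction h₁ with
  | nil => cases h₂; rfl
  | @cons q q' q'' o l hs _ ih =>
    cases h₂ with
    | cons hs' h₂ =>
      obtain ⟨-, rfl⟩ := hT _ o.method o.arg o.res o.res _ _ hs hs'
      exact ih h₂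

end SeqLTS

@[simp] theorem ObjAction.proc_call {n : ℕ} {M A B : Type u} (p : Fin n) (m : M) (a : A) :
    (call p m a : ObjAction n M A B).proc = p := rfl

@[simp] theorem ObjAction.proc_ret {n : ℕ} {M A B : Type u} (p : Fin n) (m : M) (b : B) :
    (ret p m b : ObjAction n M A B).proc = p := rfl

/-! ### Agreement of histories, operation lists and statuses -/

section Agree

variable {n : ℕ} {M A B : Type u} {h : List (ObjAction n M A B)}
  {l : List (Fin n × Op M A B)} {st : Fin n → OpStatus M A B}

theorem Agree.nil : Agree ([] : List (ObjAction n M A B)) [] fun _ => .idle := fun _ => rfl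

/-- To change the status of process `p` it suffices to consider process `p`. -/
theorem Agree.update {h' : List (ObjAction n M A B)} {l' : List (Fin n × Op M A B)}
    (H : Agree h l st) (p : Fin n) (v : OpStatus M A B)
    (hp : v.Agrees p (subhistory h' p) (opsOf l' p))
    (hh : ∀ q, q ≠ p → subhistory h' q = subhistory h q)
    (hl : ∀ q, q ≠ p → opsOf l' q = opsOf l q) : Agree h' l' (Function.update st p v) := by
  intro q
  by_cases hq : q = p
  · subst hq
    simpa using hp
  · rw [Function.update_of_ne hq, hh q hq, hl q hq]
    exact H q

theorem subhistory_concat_ne {p q : Fin n} {x : ObjAction n M A B} (hx : x.proc = p)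
    (hq : q ≠ p) : subhistory (h ++ [x]) q = subhistory h q := by
  rw [subhistory_append, subhistory_singleton_ne (by rw [hx]; exact hq.symm), List.append_nil]

theorem subhistory_concat_self {p : Fin n} {x : ObjAction n M A B} (hx : x.proc = p) :
    subhistory (h ++ [x]) p = subhistory h p ++ [x] := by
  subst hx
  rw [subhistory_append, subhistory_singleton_self]

theorem Agree.call (H : Agree h l st) {p : Fin n} (hp : st p = .idle) (m : M) (a : A) :
    Agree (h ++ [ObjAction.call p m a]) l (Function.update st p (.called m a)) := by
  refine H.update p _ ?_ (fun q hq => subhistory_concat_ne rfl hq) fun _ _ => rfl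
  have := H p
  rw [hp] at this
  rw [subhistory_concat_self (ObjAction.proc_call p m a)]
  exact congrArg (· ++ _) this

theorem Agree.effect (H : Agree h l st) {p : Fin n} {m : M} {a : A}
    (hp : st p = .called m a) (b : B) :
    Agree h (l ++ [(p, ⟨m, a, b⟩)]) (Function.update st p (.done m b)) := by
  refine H.update p _ ?_ (fun q hq => rfl) fun q hq => ?_
  · have := H p
    rw [hp] at this
    exact ⟨a, opsOf l p, by simp [opsOf], this⟩
  · rw [opsOf_append, opsOf_cons_ne hq.symm]
    simp

theorem Agree.ret (H : Agree h l st) {p : Fin n} {m : M} {b : B} (hp : st p = .done m b) :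
    Agree (h ++ [ObjAction.ret p m b]) l (Function.update st p .idle) := by
  refine H.update p _ ?_ (fun q hq => subhistory_concat_ne rfl hq) fun _ _ => rfl
  have := H p
  rw [hp] at this
  obtain ⟨a, l', h1, h2⟩ := this
  rw [subhistory_concat_self (ObjAction.proc_ret p m b), h2, h1]
  simp [OpStatus.Agrees]

/-- Together with `Agree.numRets_le_length`: an effect lies between call and return. These two
bounds are all that the order condition needs. -/
theorem Agree.length_le_numCalls (H : Agree h l st) (p : Fin n) :
    (opsOf l p).length ≤ numCalls h p := by
  have := H p
  rw [numCalls_eq]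
  cases hs : st p with
  | idle =>
    rw [hs] at this
    rw [show subhistory h p = _ from this, countP_isCall_seqHistory]
  | called m a =>
    rw [hs] at this
    rw [show subhistory h p = _ from this, List.countP_append, countP_isCall_seqHistory]
    omega
  | done m b =>
    rw [hs] at this
    obtain ⟨a, l', h1, h2⟩ := this
    rw [h1, h2, List.countP_append, countP_isCall_seqHistory]
    simp [ObjAction.isCall]

theorem Agree.numRets_le_length (H : Agree h l st) (p : Fin n) :
    numRets h p ≤ (opsOf l p).length := by
  have := H p
  rw [numRets_eq]
  cases hs : st p with
  | idle =>
    rw [hs] at this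
    rw [show subhistory h p = _ from this, countP_isRet_seqHistory]
  | called m a =>
    rw [hs] at this
    rw [show subhistory h p = _ from this, List.countP_append, countP_isRet_seqHistory]
    simp [ObjAction.isRet]
  | done m b =>
    rw [hs] at this
    obtain ⟨a, l', h1, h2⟩ := this
    rw [h1, h2, List.countP_append, countP_isRet_seqHistory]
    simp [ObjAction.isRet]

/-- The pending operations that have taken effect can be completed. -/
theorem Agree.exists_completion (H : Agree h l st) :
    ∃ r : List (ObjAction n M A B), (∀ x ∈ r, x.isRet = true) ∧
      HistEquiv (complete (h ++ r)) (seqHistory l) := by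
  -- The returns are collected process by process, and only processes with status `done` contribute
  -- one. As completion is local, a new return does not affect the processes treated before.
  have key : ∀ ps : List (Fin n), ps.Nodup →
      ∃ r : List (ObjAction n M A B), (∀ x ∈ r, x.isRet = true) ∧
        (∀ p ∉ ps, subhistory r p = []) ∧
        ∀ p ∈ ps, subhistory (complete (h ++ r)) p = seqHistory (opsOf l p) := by
    intro ps
    induction ps with
    | nil => exact fun _ => ⟨[], by simp, by simp, by simp⟩
    | cons p ps ih =>
      intro hnd
      obtain ⟨hp, hnd⟩ := List.nodup_cons.1 hnd
      obtain ⟨r, h1, h2, h3⟩ := ih hnd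
      have hr := h2 p hp
      simp only [subhistory_complete, subhistory_append] at h3 ⊢
      have Hp := H p
      cases hs : st p with
      | idle =>
        rw [hs] at Hp
        refine ⟨r, h1, fun q hq => h2 q fun h => hq (by simp [h]), fun q hq => ?_⟩
        rcases List.mem_cons.1 hq with rfl | hq
        · rw [show subhistory h q = _ from Hp, hr, complete_seqHistory_append]
          simp [complete]
        · exact h3 q hq
      | called m a =>
        rw [hs] at Hp
        refine ⟨r, h1, fun q hq => h2 q fun h => hq (by simp [h]), fun q hq => ?_⟩
        rcases List.mem_cons.1 hq with rfl | hq
        · rw [show subhistory h q = _ from Hp, hr, List.append_nil, complete_seqHistory_append]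
          simp [complete]
        · exact h3 q hq
      | done m b =>
        rw [hs] at Hp
        obtain ⟨a, l', hl', hh⟩ := Hp
        refine ⟨r ++ [ObjAction.ret p m b], ?_, fun q hq => ?_, fun q hq => ?_⟩
        · intro x hx
          rcases List.mem_append.1 hx with hx | hx
          · exact h1 x hx
          · rw [List.mem_singleton.1 hx]
            rfl
        · rw [subhistory_concat_ne (ObjAction.proc_ret p m b) fun h => hq (by simp [h]),
            h2 q fun h => hq (by simp [h])]
        · rcases List.mem_cons.1 hq with rfl | hq
          · rw [← subhistory_append, ← List.append_assoc,
              subhistory_concat_self (ObjAction.proc_ret q m b),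
              subhistory_append, hr, hh, hl', List.append_nil, List.append_assoc,
              complete_seqHistory_append]
            simp [complete]
          · rw [← subhistory_append, ← List.append_assoc,
              subhistory_concat_ne (ObjAction.proc_ret p m b) fun h => hp (h ▸ hq),
              subhistory_append]
            exact h3 q hq
  obtain ⟨r, h1, -, h3⟩ := key (List.finRange n) (List.nodup_finRange n)
  exact ⟨r, h1, fun p => by rw [h3 p (List.mem_finRange p), subhistory_seqHistory]⟩

end Agree

/-! ### Linearizations of the histories of the atomic object -/

section AtomicLinearizable

variable {n : ℕ} {M A B : Type u}

/-- A cut after the new last action has no calls behind it, so it cannot witness a precedence. Every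
other cut is already a cut of `h`. -/
theorem HB.of_concat {h : List (ObjAction n M A B)} {x : ObjAction n M A B}
    {o₁ o₂ : Fin n × ℕ} (hb : HB (h ++ [x]) o₁ o₂) (ho : o₂.2 < numCalls h o₂.1) :
    HB h o₁ o₂ := by
  obtain ⟨u, v, huv, h1, h2, h3⟩ := hb
  rcases List.eq_nil_or_concat v with rfl | ⟨v, y, rfl⟩
  · rw [List.append_nil] at huv
    rw [← huv] at h2
    omega
  · rw [List.concat_eq_append, ← List.append_assoc] at huv
    exact ⟨u, v, (List.append_inj' huv rfl).1, h1, h2, ho⟩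

theorem HB.append {h : List (ObjAction n M A B)} {o₁ o₂ : Fin n × ℕ} (hb : HB h o₁ o₂)
    (t : List (ObjAction n M A B)) : HB (h ++ t) o₁ o₂ := by
  obtain ⟨u, v, rfl, h1, h2, h3⟩ := hb
  exact ⟨u, v ++ t, by simp, h1, h2, h3.trans_le (numCalls_mono ⟨t, rfl⟩ _)⟩

/-- The operations are listed in the order of their effects. New calls and returns create no order
constraint among listed operations, and an effect appends its operation behind everything that has
returned. -/
theorem SeqLTS.atomic_path_agree (T : SeqLTS M A B)
    {e : List (Label n M A B (T.atomic n).Internal)} {C : (T.atomic n).State}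
    (h : (T.atomic n).Path (T.atomic n).init e C) :
    ∃ l : List (Fin n × Op M A B), T.Run T.init (l.map Prod.snd) C.state ∧
      Agree (history e) l C.status ∧
      ∀ o₁ o₂ : Fin n × ℕ, o₂.2 < numCalls (seqHistory l) o₂.1 → HB (history e) o₁ o₂ →
        HB (seqHistory l) o₁ o₂ := by
  refine LTS.Path.snoc_induction (L := T.atomic n) (motive := fun e C =>
    ∃ l : List (Fin n × Op M A B),
    T.Run T.init (l.map Prod.snd) C.state ∧ Agree (history e) l C.status ∧
      ∀ o₁ o₂ : Fin n × ℕ, o₂.2 < numCalls (seqHistory l) o₂.1 → HB (history e) o₁ o₂ →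
        HB (seqHistory l) o₁ o₂) ?_ ?_ h
  · refine ⟨[], .nil _, Agree.nil, fun o₁ o₂ h _ => ?_⟩
    simp [numCalls] at h
  · intro e C x C' _ ih hx
    obtain ⟨l, hrun, hag, hord⟩ := ih
    rw [history_append]
    cases hx with
    | call q st p m a hp =>
      refine ⟨l, hrun, hag.call hp m a, fun o₁ o₂ ho hb => hord o₁ o₂ ho (hb.of_concat ?_)⟩
      rw [numCalls_seqHistory] at ho
      exact ho.trans_le (hag.length_le_numCalls _)
    | ret q st p m b hp =>
      refine ⟨l, hrun, hag.ret hp, fun o₁ o₂ ho hb => hord o₁ o₂ ho (hb.of_concat ?_)⟩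
      rw [numCalls_seqHistory] at ho
      exact ho.trans_le (hag.length_le_numCalls _)
    | effect q q' st p m a b hp hs =>
      rw [history_internal_cons, history_nil,
        List.append_nil]
      refine ⟨l ++ [(p, ⟨m, a, b⟩)], ?_, ?_, fun o₁ o₂ ho hb => ?_⟩
      · rw [List.map_append]
        exact hrun.append (SeqLTS.run_singleton.2 hs)
      · exact hag.effect hp b
      · by_cases ho' : o₂.2 < numCalls (seqHistory l) o₂.1
        · rw [seqHistory_append]
          exact (hord o₁ o₂ ho' hb).append _
        · obtain ⟨u, v, huv, h1, h2, h3⟩ := hb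
          -- Here `o₂` is the new operation. The cut is placed directly before it; `o₁` has returned
          -- in the history, so it already occurs in `l`.
          refine ⟨seqHistory l, _, seqHistory_append _ _, ?_, not_lt.1 ho', ho⟩
          rw [numRets_seqHistory]
          exact h1.trans_le ((numRets_mono ⟨v, huv.symm⟩ _).trans (hag.numRets_le_length _))

theorem ConcurrentObject.linearizable_of_sim_atomic {O : ConcurrentObject n M A B}
    {T : SeqLTS M A B} (h : O.sem.Sim (T.atomic n)) : O.Linearizable T.traces := by
  intro e he
  obtain ⟨e', ⟨C, hC⟩, hh⟩ := h.exists_trace he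
  obtain ⟨l, hrun, hag, hord⟩ := T.atomic_path_agree hC
  rw [hh]
  exact ⟨seqHistory l, ⟨l, ⟨_, hrun⟩, rfl⟩, hag.exists_completion, hord⟩

end AtomicLinearizable

/-- A form of `ConcurrentObject.sem` that is unfolded freely. -/
abbrev ConcurrentObject.lts {n : ℕ} {M A B : Type u} (O : ConcurrentObject n M A B) :
    LTS n M A B where
  State := O.Config
  Internal := O.Cmd
  init := ⟨O.init, fun _ => none⟩
  trans := O.Trans

/-! ### Strongly linearizable objects are simulated by the atomic object -/

section StrongLinearizability

variable {n : ℕ} {M A B : Type u}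

theorem seqHistory_ne_concat (l l' : List (Fin n × Op M A B)) (x : ObjAction n M A B) :
    seqHistory l ≠ seqHistory l' ++ [x] := by
  intro h
  have := congrArg List.length h
  simp at this
  omega

/-- The length of `h` is `2 * l.length`, one more, or one less, according as the status is idle,
called or done. The remaining data are read off the last action or the last operation. -/
theorem OpStatus.Agrees.unique {p : Fin n} {h : List (ObjAction n M A B)}
    {l : List (Fin n × Op M A B)} {s s' : OpStatus M A B} (H : s.Agrees p h l)
    (H' : s'.Agrees p h l) : s = s' := by
  cases s with
  | idle =>
    cases s' with
    | idle => rfl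
    | called m a => exact absurd (H.symm.trans H') (seqHistory_ne_concat _ _ _)
    | done m b =>
      obtain ⟨a, l', -, H'⟩ := H'
      exact absurd (H.symm.trans H') (seqHistory_ne_concat _ _ _)
  | called m a =>
    cases s' with
    | idle => exact absurd (H'.symm.trans H) (seqHistory_ne_concat _ _ _)
    | called m' a' =>
      have := List.append_cancel_left (H.symm.trans H')
      simp at this
      simp [this]
    | done m' b =>
      obtain ⟨a, l', h1, H'⟩ := H'
      have := congrArg List.length (H.symm.trans H')
      simp [h1] at this
  | done m b =>
    obtain ⟨a, l', h1, H⟩ := H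
    cases s' with
    | idle => exact absurd (H'.symm.trans H) (seqHistory_ne_concat _ _ _)
    | called m' a' =>
      have := congrArg List.length (H.symm.trans H')
      simp [h1] at this
    | done m' b' =>
      obtain ⟨a', l'', h2, H'⟩ := H'
      have := (List.append_inj' (h1.symm.trans h2) rfl).2
      simp at this
      simp [this]

theorem Agree.unique {h : List (ObjAction n M A B)} {l : List (Fin n × Op M A B)}
    {st st' : Fin n → OpStatus M A B} (H : Agree h l st) (H' : Agree h l st') : st = st' :=
  funext fun p => (H p).unique (H' p)

/-- A parity argument: the other two statuses force an odd number of actions. -/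
theorem Agree.eq_idle {h : List (ObjAction n M A B)} {l k : List (Fin n × Op M A B)}
    {st : Fin n → OpStatus M A B} (H : Agree h l st) {p : Fin n}
    (hk : subhistory h p = seqHistory k) : st p = .idle := by
  have Hp := H p
  rw [hk] at Hp
  cases hs : st p with
  | idle => rfl
  | called m a =>
    rw [hs] at Hp
    exact absurd Hp (seqHistory_ne_concat _ _ _)
  | done m b =>
    rw [hs] at Hp
    obtain ⟨a, l', -, Hp⟩ := Hp
    exact absurd Hp (seqHistory_ne_concat _ _ _)

/-- The next operation in a linearization is that of a process with a pending call. -/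
theorem Agree.eq_called {h : List (ObjAction n M A B)} {l l₂ : List (Fin n × Op M A B)}
    {st st' : Fin n → OpStatus M A B} {p : Fin n} {o : Op M A B} (H : Agree h l st)
    (H' : Agree h (l ++ (p, o) :: l₂) st') : st p = .called o.method o.arg := by
  have Hp := H p
  have Hp' := H' p
  rw [opsOf_append, opsOf_cons_self] at Hp'
  -- At most `2 * (opsOf l p).length + 1` actions of `p` are possible, with equality only for the
  -- status `called`. The second agreement, whose list has a further operation of `p`, forces
  -- equality.
  have hlen : (subhistory h p).length ≤ 2 * (opsOf l p).length + 1 ∧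
      ((subhistory h p).length = 2 * (opsOf l p).length + 1 → ∃ m a, st p = .called m a) := by
    cases hs : st p with
    | idle =>
      rw [hs] at Hp
      rw [show subhistory h p = _ from Hp]
      simp
    | called m a =>
      rw [hs] at Hp
      rw [show subhistory h p = _ from Hp]
      simp
    | done m b =>
      rw [hs] at Hp
      obtain ⟨a, l', h1, h2⟩ := Hp
      rw [h1, h2]
      simp
  cases hs' : st' p with
  | idle =>
    rw [hs'] at Hp'
    rw [show subhistory h p = _ from Hp'] at hlen
    simp at hlen
  | called m a =>
    rw [hs'] at Hp'
    rw [show subhistory h p = _ from Hp'] at hlen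
    simp at hlen
  | done m b =>
    rw [hs'] at Hp'
    obtain ⟨a, l', h1, h2⟩ := Hp'
    have hl' : (opsOf l p).length + (opsOf l₂ p).length = l'.length := by
      have := congrArg List.length h1
      simp at this
      omega
    have h2len : (subhistory h p).length = 2 * l'.length + 1 := by rw [h2]; simp
    obtain ⟨m', a', hs⟩ := hlen.2 (by omega)
    have h0 : opsOf l₂ p = [] := List.eq_nil_of_length_eq_zero (by omega)
    rw [h0] at h1
    obtain ⟨h3, h4⟩ := List.append_inj' h1 rfl
    rw [hs] at Hp
    have h5 := (show subhistory h p = _ from Hp).symm.trans h2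
    rw [h3] at h5
    have h6 := List.append_cancel_left h5
    simp only [List.cons.injEq, Prod.mk.injEq, true_and, and_true, ObjAction.call.injEq] at h4 h6
    rw [hs, h4, h6.1, h6.2]

/-- Pending operations take effect in the order given by a linearization. -/
theorem SeqLTS.exists_atomic_path (T : SeqLTS M A B) {h : List (ObjAction n M A B)}
    {st' : Fin n → OpStatus M A B} {q' : T.State} (l₂ : List (Fin n × Op M A B)) :
    ∀ (l : List (Fin n × Op M A B)) (st : Fin n → OpStatus M A B) (q : T.State),
      Agree h l st → Agree h (l ++ l₂) st' → T.Run q (l₂.map Prod.snd) q' →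
      ∃ e, (T.atomic n).Path ⟨q, st⟩ e ⟨q', st'⟩ ∧ history e = [] := by
  induction l₂ with
  | nil =>
    intro l st q H H' hrun
    rw [List.append_nil] at H'
    obtain rfl := H.unique H'
    cases hrun
    exact ⟨[], .nil _, rfl⟩
  | cons x l₂ ih =>
    intro l st q H H' hrun
    obtain ⟨p, m, a, b⟩ := x
    have hp := H.eq_called H'
    cases hrun with
    | cons hs hrun =>
      obtain ⟨e, he, hh⟩ := ih _ _ _ (H.effect hp b) (by simpa using H') hrun
      exact ⟨_ :: e, .cons (.effect _ _ _ _ _ _ _ hp hs) he, hh⟩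

/-- Undoes a return: its operation must already be in `l`. In the simulation this allows the new
effects to be executed before the return is. -/
theorem Agree.of_ret {h : List (ObjAction n M A B)} {l k : List (Fin n × Op M A B)}
    {st : Fin n → OpStatus M A B} {p : Fin n} {m : M} {a : A} {b : B}
    (hk : subhistory h p = seqHistory k ++ [ObjAction.call p m a])
    (H : Agree (h ++ [ObjAction.ret p m b]) l st) :
    st p = .idle ∧ Agree h l (Function.update st p (.done m b)) := by
  have h1 : subhistory (h ++ [ObjAction.ret p m b]) p = seqHistory (k ++ [(p, ⟨m, a, b⟩)]) := by
    rw [subhistory_concat_self (ObjAction.proc_ret p m b), hk]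
    simp
  have hp := H.eq_idle h1
  refine ⟨hp, H.update p _ ?_ (fun q hq => (subhistory_concat_ne (ObjAction.proc_ret p m b)
    hq).symm) fun _ _ => rfl⟩
  have := H p
  rw [hp, h1] at this
  exact ⟨a, k, (seqHistory_injective this).symm, hk⟩

/-- A process subhistory is sequential up to one final pending call. Added returns can answer only
this call, so the linearization contains the completed operations and possibly the pending one with
some result. The order condition is irrelevant here. -/
theorem exists_agree_of_isLinearization {Spec : Set (List (Op M A B))}
    {h : List (ObjAction n M A B)} {l : List (Fin n × Op M A B)}
    (hw : ∀ p, ∃ k, subhistory h p = seqHistory k ∨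
      ∃ m a, subhistory h p = seqHistory k ++ [ObjAction.call p m a])
    (hl : IsLinearization Spec h (seqHistory l)) : ∃ st, Agree h l st := by
  obtain ⟨-, ⟨r, hr, heq⟩, -⟩ := hl
  suffices ∀ p, ∃ s : OpStatus M A B, s.Agrees p (subhistory h p) (opsOf l p) by
    choose st hst using this
    exact ⟨st, hst⟩
  intro p
  have hp := heq p
  have hrp := forall_isRet_subhistory hr p
  rw [subhistory_complete, subhistory_append, subhistory_seqHistory] at hp
  obtain ⟨k, hk | ⟨m, a, hk⟩⟩ := hw p
  · rw [hk, complete_seqHistory_append, complete_of_forall_isRet hrp] at hp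
    obtain ⟨l₂, h1, h2⟩ := seqHistory_append_eq hp
    rw [eq_nil_of_isRet_of_eq_seqHistory hrp h2, List.append_nil] at h1
    exact ⟨.idle, by rw [hk, h1]; rfl⟩
  · rw [hk, List.append_assoc, complete_seqHistory_append, List.singleton_append, complete,
      complete_of_forall_isRet hrp] at hp
    split_ifs at hp with hb
    · obtain ⟨l₂, h1, h2⟩ := seqHistory_append_eq hp
      cases l₂ with
      | nil => simp at h2
      | cons y l₂ =>
        obtain ⟨p', m', a', b'⟩ := y
        simp only [seqHistory_cons, List.cons.injEq, ObjAction.call.injEq] at h2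
        obtain ⟨⟨rfl, rfl, rfl⟩, h2⟩ := h2
        rw [h2] at hrp
        have : l₂ = [] := eq_nil_of_isRet_of_eq_seqHistory
          (fun x hx => hrp x (List.mem_cons_of_mem _ hx)) rfl
        subst this
        exact ⟨.done m b', a, k, h1, hk⟩
    · obtain ⟨l₂, h1, h2⟩ := seqHistory_append_eq hp
      rw [eq_nil_of_isRet_of_eq_seqHistory hrp h2, List.append_nil] at h1
      exact ⟨.called m a, by rw [hk, h1]; rfl⟩

namespace ConcurrentObject

theorem subhistory_of_path (O : ConcurrentObject n M A B)
    {e : List (Label n M A B O.lts.Internal)} {C : O.lts.State}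
    (h : O.lts.Path O.lts.init e C) (p : Fin n) :
    (C.procs p = none → ∃ k, subhistory (history e) p = seqHistory k) ∧
    ∀ m ℓ, C.procs p = some (m, ℓ) → ∃ k a,
      subhistory (history e) p = seqHistory k ++ [ObjAction.call p m a] := by
  refine LTS.Path.snoc_induction (L := O.lts) (motive := fun e C =>
    (C.procs p = none → ∃ k, subhistory (history e) p = seqHistory k) ∧
    ∀ m ℓ, C.procs p = some (m, ℓ) → ∃ k a,
      subhistory (history e) p = seqHistory k ++ [ObjAction.call p m a]) ?_ ?_ h
  · exact ⟨fun _ => ⟨[], rfl⟩, fun m ℓ h => nomatch h⟩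
  · intro e C x C' _ ih hx
    rw [history_append]
    cases hx with
    | call q m a hq =>
      rw [history_vis_cons, history_nil]
      by_cases hpq : p = q
      · subst hpq
        refine ⟨fun h => by simp at h, fun m' ℓ h => ?_⟩
        simp only [Function.update_self, Option.some.injEq, Prod.mk.injEq] at h
        obtain ⟨rfl, -⟩ := h
        obtain ⟨k, hk⟩ := ih.1 hq
        exact ⟨k, a, by rw [subhistory_concat_self (ObjAction.proc_call p m a), hk]⟩
      · rw [subhistory_concat_ne (ObjAction.proc_call q m a) hpq]
        simpa only [Function.update_of_ne hpq] using ih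
    | internal q m ℓ ℓ' c μ' hq hr hs =>
      rw [history_internal_cons, history_nil, List.append_nil]
      by_cases hpq : p = q
      · subst hpq
        refine ⟨fun h => by simp at h, fun m' ℓ₁ h => ?_⟩
        simp only [Function.update_self, Option.some.injEq, Prod.mk.injEq] at h
        obtain ⟨rfl, -⟩ := h
        exact ih.2 _ _ hq
      · simpa only [Function.update_of_ne hpq] using ih
    | ret q m ℓ b hq hr =>
      rw [history_vis_cons, history_nil]
      by_cases hpq : p = q
      · subst hpq
        refine ⟨fun _ => ?_, fun m' ℓ h => by simp at h⟩
        obtain ⟨k, a, hk⟩ := ih.2 _ _ hq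
        refine ⟨k ++ [(p, ⟨m, a, b⟩)], ?_⟩
        rw [subhistory_concat_self (ObjAction.proc_ret p m b), hk]
        simp
      · rw [subhistory_concat_ne (ObjAction.proc_ret q m b) hpq]
        simpa only [Function.update_of_ne hpq] using ih

theorem mem_prefixClosure_traces (O : ConcurrentObject n M A B)
    {e : List (Label n M A B O.lts.Internal)} {C : O.lts.State}
    (h : O.lts.Path O.lts.init e C) : e ∈ prefixClosure O.lts.traces :=
  ⟨e, ⟨C, h⟩, List.prefix_refl e⟩

theorem StronglyLinearizable.linearizable {O : ConcurrentObject n M A B}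
    {Spec : Set (List (Op M A B))} (h : O.StronglyLinearizable Spec) : O.Linearizable Spec := by
  obtain ⟨f, hf, -⟩ : StronglyLinearizableSet O.lts.traces Spec := h
  rintro e ⟨C, hC⟩
  exact ⟨f e, hf e (O.mem_prefixClosure_traces hC)⟩

/-- The relation remembers a path to the configuration, because the linearization is chosen per
trace and not per configuration. The atomic object is kept in the state and statuses that this
linearization prescribes. -/
theorem StronglyLinearizable.sim_atomic {O : ConcurrentObject n M A B} {T : SeqLTS M A B}
    (hT : T.Deterministic) (h : O.StronglyLinearizable T.traces) :
    O.sem.Sim (T.atomic n) := by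
  change O.lts.Sim (T.atomic n)
  obtain ⟨f, hf, hmono⟩ : StronglyLinearizableSet O.lts.traces T.traces := h
  have key : ∀ e C, O.lts.Path O.lts.init e C → ∃ (l : List (Fin n × Op M A B)) (q : T.State)
      (st : Fin n → OpStatus M A B), f e = seqHistory l ∧ T.Run T.init (l.map Prod.snd) q ∧
        Agree (history e) l st := by
    intro e C hp
    have hlin := hf e (O.mem_prefixClosure_traces hp)
    obtain ⟨l, ⟨q, hq⟩, hl⟩ := hlin.1
    rw [hl] at hlin
    suffices hw : ∀ p, ∃ k, subhistory (history e) p = seqHistory k ∨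
        ∃ m a, subhistory (history e) p = seqHistory k ++ [ObjAction.call p m a] by
      obtain ⟨st, hst⟩ := exists_agree_of_isLinearization hw hlin
      exact ⟨l, q, st, hl, hq, hst⟩
    intro p
    cases hc : C.procs p with
    | none =>
      obtain ⟨k, hk⟩ := (O.subhistory_of_path hp p).1 hc
      exact ⟨k, .inl hk⟩
    | some y =>
      obtain ⟨k, a, hk⟩ := (O.subhistory_of_path hp p).2 _ _ hc
      exact ⟨k, .inr ⟨_, a, hk⟩⟩
  refine ⟨fun C D => ∃ (e : _) (l : List (Fin n × Op M A B)), O.lts.Path O.lts.init e C ∧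
    f e = seqHistory l ∧ T.Run T.init (l.map Prod.snd) D.state ∧ Agree (history e) l D.status,
    ?_, ?_⟩
  · obtain ⟨l, q, st, hl, hq, hag⟩ := key [] _ (.nil _)
    have hst : st = fun _ => .idle := funext fun p => hag.eq_idle (k := []) rfl
    subst hst
    have : l = [] := by
      refine eq_nil_of_opsOf fun p => ?_
      have := hag p
      exact seqHistory_injective (this.symm.trans rfl : _ = seqHistory [])
    subst this
    exact ⟨[], [], .nil _, hl, .nil _, hag⟩
  · rintro C ⟨q, st⟩ x C' ⟨e, l, hp, hl, hq, hag⟩ hx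
    have hp' := hp.append (.single hx)
    obtain ⟨l', q', st', hl', hq', hag'⟩ := key _ _ hp'
    have hpre := hmono _ (O.mem_prefixClosure_traces hp) _ (O.mem_prefixClosure_traces hp')
      (List.prefix_append _ _)
    rw [hl, hl'] at hpre
    obtain ⟨l₂, rfl⟩ := seqHistory_prefix hpre
    -- Both `q` and the intermediate state are reached by the operations `l`; determinism identifies
    -- them, so the new operations run from `q`.
    have hrun : T.Run q (l₂.map Prod.snd) q' := by
      rw [List.map_append] at hq'
      obtain ⟨q₁, h1, h2⟩ := SeqLTS.run_append hq'
      obtain rfl : q = q₁ := SeqLTS.Run.unique hT hq h1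
      exact h2
    suffices ∃ e₂, (T.atomic n).Path ⟨q, st⟩ e₂ ⟨q', st'⟩ ∧ history [x] = history e₂ by
      obtain ⟨e₂, h1, h2⟩ := this
      exact ⟨e₂, ⟨q', st'⟩, h1, h2, _, _, hp', hl', hq', hag'⟩
    rw [history_append] at hag'
    cases hx with
    | call p m a hc =>
      obtain ⟨k, hk⟩ := (O.subhistory_of_path hp p).1 hc
      have hidle := hag.eq_idle hk
      -- The call comes first, since the called operation may itself be among those that take effect
      -- now.
      obtain ⟨e₂, he, hh⟩ := T.exists_atomic_path l₂ _ _ _ (hag.call hidle m a) hag' hrun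
      refine ⟨_ :: e₂, .cons (.call q st p m a hidle) he, ?_⟩
      rw [history_vis_cons, history_vis_cons, hh]
      rfl
    | internal p m ℓ ℓ' c μ' hc hr hs =>
      rw [history_internal_cons, history_nil, List.append_nil] at hag'
      obtain ⟨e₂, he, hh⟩ := T.exists_atomic_path l₂ _ _ _ hag hag' hrun
      exact ⟨e₂, he, hh.symm⟩
    | ret p m ℓ b hc hr =>
      obtain ⟨k, a, hk⟩ := (O.subhistory_of_path hp p).2 _ _ hc
      obtain ⟨hidle, hag''⟩ := Agree.of_ret hk hag'
      -- The effects come first, since the returning operation may be linearized only at its return.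
      obtain ⟨e₂, he, hh⟩ := T.exists_atomic_path l₂ _ _ _ hag hag'' hrun
      refine ⟨e₂ ++ [Label.vis (ObjAction.ret p m b)], he.append (.single ?_), ?_⟩
      · have := SeqLTS.AtomicTrans.ret (T := T) q' (Function.update st' p (.done m b)) p m b
          (by simp)
        rwa [Function.update_idem, ← hidle, Function.update_eq_self] at this
      · rw [history_append, hh]
        rfl

end ConcurrentObject

end StrongLinearizability

/-! ### Linearizations of sequential histories -/

section SequentialHistories

variable {n : ℕ} {M A B : Type u}

/-- In a sequential history happens-before is total across processes. At the first position where
the lists differ, the processes must differ, and the two operations there would be ordered in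
opposite ways. -/
theorem eq_of_opsOf_eq_of_HB {l l' : List (Fin n × Op M A B)}
    (hops : ∀ p, opsOf l p = opsOf l' p)
    (hord : ∀ o₁ o₂ : Fin n × ℕ, o₂.2 < numCalls (seqHistory l') o₂.1 →
      HB (seqHistory l) o₁ o₂ → HB (seqHistory l') o₁ o₂) : l = l' := by
  suffices ∀ t c t', l = c ++ t → l' = c ++ t' → t = t' from this l [] l' rfl rfl
  intro t
  induction t with
  | nil =>
    intro c t' h h'
    refine (eq_nil_of_opsOf fun p => ?_).symm
    simpa [h, h'] using hops p
  | cons x t ih =>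
    intro c t' h h'
    cases t' with
    | nil =>
      have := hops x.1
      rw [h, h', opsOf_append, opsOf_append, show x = (x.1, x.2) from rfl,
        opsOf_cons_self] at this
      simp at this
    | cons y t' =>
      obtain ⟨p, o⟩ := x
      obtain ⟨q, o'⟩ := y
      by_cases hpq : p = q
      · subst hpq
        have := hops p
        rw [h, h', opsOf_append, opsOf_append, opsOf_cons_self, opsOf_cons_self] at this
        have ho : o = o' := by simpa using (List.cons.inj (List.append_cancel_left this)).1
        subst ho
        rw [ih (c ++ [(p, o)]) t' (by simp [h]) (by simp [h'])]
      · exfalso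
        have hq : (opsOf l q).length = (opsOf l' q).length := by rw [hops q]
        have hlt : (opsOf c q).length < (opsOf l' q).length := by
          rw [h', opsOf_append, opsOf_cons_self]
          simp
        -- The operation of `q` that follows `c` in `l'` must occur in `l` as well, and there only
        -- after the operation `o` of `p`.
        have hb : HB (seqHistory l) (p, (opsOf c p).length) (q, (opsOf c q).length) := by
          refine ⟨seqHistory (c ++ [(p, o)]), seqHistory t, ?_, ?_, ?_, ?_⟩
          · rw [← seqHistory_append, h]
            simp
          · rw [numRets_seqHistory, opsOf_append, opsOf_cons_self]
            simp
          · rw [numCalls_seqHistory, opsOf_append, opsOf_cons_ne hpq]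
            simp
          · rw [numCalls_seqHistory, hq]
            exact hlt
        obtain ⟨u, v, huv, h1, h2, -⟩ := hord _ _ (by rw [numCalls_seqHistory]; exact hlt) hb
        have hu : u <+: seqHistory l' := ⟨v, huv.symm⟩
        have hc : seqHistory (c ++ [(q, o')]) <+: seqHistory l' :=
          ⟨seqHistory t', by rw [← seqHistory_append, h']; simp⟩
        -- A cut within `c ++ [(q, o')]` comes too early for the return of `p`; a longer one comes
        -- after the call of `q`.
        rcases List.prefix_or_prefix_of_prefix hu hc with h3 | h3
        · have := h1.trans_le (numRets_mono h3 p)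
          rw [numRets_seqHistory, opsOf_append, opsOf_cons_ne (Ne.symm hpq)] at this
          simp at this
        · have := (numCalls_mono h3 q).trans h2
          rw [numCalls_seqHistory, opsOf_append, opsOf_cons_self] at this
          simp at this

/-- A complete sequential history has no linearization but itself. -/
theorem map_mem_of_isLinearization_seqHistory {Spec : Set (List (Op M A B))}
    {l : List (Fin n × Op M A B)} {s : List (ObjAction n M A B)}
    (h : IsLinearization Spec (seqHistory l) s) : l.map Prod.snd ∈ Spec := by
  obtain ⟨l', hl', rfl⟩ := h.1
  have hsub := subhistory_seqHistory l
  obtain ⟨st, hst⟩ := exists_agree_of_isLinearization (fun p => ⟨_, .inl (hsub p)⟩) h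
  suffices l = l' by rwa [this]
  refine eq_of_opsOf_eq_of_HB (fun p => ?_) h.2.2
  have := hst p
  rw [hst.eq_idle (hsub p), hsub p] at this
  exact seqHistory_injective this

end SequentialHistories

/-! ### Progress conditions -/

section Progress

variable {n : ℕ} {M A B I : Type u}

theorem ProgT.progS {w : ℕ → Label n M A B I} (h : ProgT w) : ProgS w := by
  rintro N ⟨p, k, hk, hc, hr⟩
  obtain ⟨j, hj, hret⟩ := h p k hc
  exact ⟨p, j, not_lt.1 fun hjN => hr j hj hjN hret, hret⟩

theorem Progress.Holds.of_wf {w : ℕ → Label n M A B I} (h : Progress.WF.Holds w)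
    (P : Progress) : P.Holds w := by
  cases P with
  | WF => exact h
  | LF => exact fun hs => (h hs).progS
  | OF => exact fun hs => (h hs.1).progS

theorem Progress.Holds.to_of {w : ℕ → Label n M A B I} {P : Progress} (h : P.Holds w) :
    Progress.OF.Holds w := by
  cases P with
  | WF => exact fun hs => (h hs.1).progS
  | LF => exact fun hs => h hs.1
  | OF => exact h

end Progress

/-! ### Obstruction-free linearizable objects simulate the atomic object -/

namespace ConcurrentObject

variable {n : ℕ} {M A B : Type u}

/-- A step of process `p`, on its local state and the memory. -/
def Solo (O : ConcurrentObject n M A B) (p : Fin n) (x y : O.Loc × O.Mem) : Prop :=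
  O.ret x.1 = none ∧ ∃ c, O.step p x.1 x.2 c y.1 y.2

/-- A step involves only the memory and the local state of its own process. Thus a solo run can be
transplanted between configurations with equal memory, whatever the other processes are doing. -/
theorem exists_path_of_solo (O : ConcurrentObject n M A B) {p : Fin n} {x y : O.Loc × O.Mem}
    (h : Relation.ReflTransGen (O.Solo p) x y) {procs : Fin n → Option (M × O.Loc)} {m : M}
    (hp : procs p = some (m, x.1)) :
    ∃ e, O.lts.Path ⟨x.2, procs⟩ e ⟨y.2, Function.update procs p (some (m, y.1))⟩ ∧
      history e = [] := by
  induction h with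
  | refl =>
    refine ⟨[], ?_, rfl⟩
    rw [← hp, Function.update_eq_self]
    exact .nil _
  | @tail y z _ hyz ih =>
    obtain ⟨e, he, hh⟩ := ih
    obtain ⟨hr, c, hs⟩ := hyz
    have := Trans.internal (O := O) ⟨y.2, Function.update procs p (some (m, y.1))⟩ p m y.1 z.1 c
      z.2 (by simp) hr hs
    rw [Function.update_idem] at this
    refine ⟨e ++ [Label.internal p c], he.append (.single this), ?_⟩
    rw [history_append, hh]
    rfl

/-- When an obstruction-free object is idle, an operation that is executed alone terminates. -/
theorem exists_solo_ret {O : ConcurrentObject n M A B} (hO : O.Satisfies .OF)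
    {e : List (Label n M A B O.Cmd)} {μ : O.Mem}
    (he : O.lts.Path O.lts.init e ⟨μ, fun _ => none⟩) (p : Fin n) (m : M) (a : A) :
    ∃ y b, Relation.ReflTransGen (O.Solo p) (O.start p m a, μ) y ∧ O.ret y.1 = some b := by
  by_contra hcon
  push Not at hcon
  have hnone : ∀ y, Relation.ReflTransGen (O.Solo p) (O.start p m a, μ) y → O.ret y.1 = none := by
    intro y hy
    cases hr : O.ret y.1 with
    | none => rfl
    | some b => exact absurd hr (hcon y b hy)
  have hnext : ∀ y : {y // Relation.ReflTransGen (O.Solo p) (O.start p m a, μ) y},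
      ∃ (c : O.Cmd) (z : {y // Relation.ReflTransGen (O.Solo p) (O.start p m a, μ) y}),
        O.step p y.1.1 y.1.2 c z.1.1 z.1.2 := by
    rintro ⟨y, hy⟩
    obtain ⟨c, ℓ', μ', hs⟩ := O.enabled p y.1 y.2 (hnone y hy)
    exact ⟨c, ⟨(ℓ', μ'), hy.tail ⟨hnone y hy, c, hs⟩⟩, hs⟩
  -- If no solo run reached a return, enabledness would let one continue forever.
  choose cmd nxt hstep using hnext
  let s : ℕ → {y // Relation.ReflTransGen (O.Solo p) (O.start p m a, μ) y} :=
    fun k => nxt^[k] ⟨_, .refl⟩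
  have hs : ∀ k, s (k + 1) = nxt (s k) := fun k => Function.iterate_succ_apply' _ _ _
  let cs : ℕ → O.Config := fun k => Nat.casesOn k ⟨μ, fun _ => none⟩ fun k =>
    ⟨(s k).1.2, Function.update (fun _ => none) p (some (m, (s k).1.1))⟩
  let w : ℕ → Label n M A B O.Cmd := fun k =>
    Nat.casesOn k (Label.vis (ObjAction.call p m a)) fun k => Label.internal p (cmd (s k))
  have hcs : ∀ k, O.lts.trans (cs k) (w k) (cs (k + 1)) := by
    rintro (_ | k)
    · exact .call _ p m a rfl
    · have := Trans.internal (O := O) (cs (k + 1)) p m (s k).1.1 (s (k + 1)).1.1 (cmd (s k))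
        (s (k + 1)).1.2 (by simp [cs]) (hnone _ (s k).2) (by rw [hs]; exact hstep (s k))
      simpa [cs] using this
  obtain ⟨cs', w', h0, htr, hw⟩ := LTS.exists_infTrace_of_path he cs w rfl hcs
  have hw0 : w' e.length = Label.vis (ObjAction.call p m a) := hw 0
  have hw1 : ∀ j, e.length < j → ∃ c, w' j = Label.internal p c := by
    intro j hj
    obtain ⟨k, rfl⟩ := Nat.exists_eq_add_of_lt hj
    exact ⟨cmd (s k), hw (k + 1)⟩
  have hno : ∀ q j, e.length < j → ¬ (w' j).IsRetOf q := by
    rintro q j hj ⟨m', b, hb⟩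
    obtain ⟨c, hc⟩ := hw1 j hj
    rw [hc] at hb
    cases hb
  have hproc : ∀ j, e.length < j → (w' j).proc = p := by
    intro j hj
    obtain ⟨c, hc⟩ := hw1 j hj
    rw [hc]
    rfl
  -- The call of `p` stays unanswered and all later actions are by `p`, so the trace is both
  -- scheduled and isolated.
  have hprog : ProgS w' := by
    refine hO w' ⟨cs', h0, htr⟩ ⟨fun _ => ⟨p, e.length, ⟨⟨m, a, hw0⟩, hno p⟩, fun N =>
      ⟨N + (e.length + 1), Nat.le_add_right _ _, hproc _ (by omega)⟩⟩, p, e.length + 1, hproc⟩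
  obtain ⟨q, j, hj, hret⟩ := hprog (e.length + 1)
    ⟨p, e.length, Nat.lt_succ_self _, ⟨m, a, hw0⟩, fun j hj _ => hno p j hj⟩
  exact hno q j hj hret

/-- The state of process `p` in an execution in which each operation is executed alone: a method
has not yet taken a step, or it is about to return. -/
def Ready (O : ConcurrentObject n M A B) (p : Fin n) :
    OpStatus M A B → Option (M × O.Loc) → Prop
  | .idle, x => x = none
  | .called m a, x => x = some (m, O.start p m a)
  | .done m b, x => ∃ ℓ, x = some (m, ℓ) ∧ O.ret ℓ = some b

theorem ready_update {O : ConcurrentObject n M A B} {st : Fin n → OpStatus M A B}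
    {procs : Fin n → Option (M × O.Loc)} (h : ∀ p, O.Ready p (st p) (procs p)) {p : Fin n}
    {v : OpStatus M A B} {y : Option (M × O.Loc)} (hp : O.Ready p v y) (q : Fin n) :
    O.Ready q (Function.update st p v q) (Function.update procs p y q) := by
  by_cases hq : q = p
  · subst hq
    simpa using hp
  · simpa only [Function.update_of_ne hq] using h q

/-- Besides the actual configuration, the relation keeps a sequential execution that ends with the
same memory and all processes idle. Progress and linearizability are applied only to the latter. -/
theorem atomic_sim {O : ConcurrentObject n M A B} {T : SeqLTS M A B} (hT : T.Deterministic)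
    (hlin : O.Linearizable T.traces) (hO : O.Satisfies .OF) : (T.atomic n).Sim O.sem := by
  change (T.atomic n).Sim O.lts
  replace hlin : ∀ e ∈ O.lts.traces, ∃ s, IsLinearization T.traces (history e) s := hlin
  refine ⟨fun D C => ∃ (e : _) (l : List (Fin n × Op M A B)),
    O.lts.Path O.lts.init e ⟨C.mem, fun _ => none⟩ ∧ history e = seqHistory l ∧
      T.Run T.init (l.map Prod.snd) D.state ∧ ∀ p, O.Ready p (D.status p) (C.procs p),
    ⟨[], [], .nil _, rfl, .nil _, fun _ => rfl⟩, ?_⟩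
  rintro D C x D' ⟨e, l, he, hh, hrun, hready⟩ hx
  obtain ⟨μ, procs⟩ := C
  cases hx with
  | call q st p m a hp =>
    have hc : O.Ready p (st p) (procs p) := hready p
    rw [hp] at hc
    exact ⟨[Label.vis (ObjAction.call p m a)], _, .single (.call _ p m a hc), rfl, e, l, he, hh,
      hrun, ready_update hready rfl⟩
  | ret q st p m b hp =>
    have hc : O.Ready p (st p) (procs p) := hready p
    rw [hp] at hc
    obtain ⟨ℓ, hc, hr⟩ := hc
    exact ⟨[Label.vis (ObjAction.ret p m b)], _, .single (.ret _ p m ℓ b hc hr), rfl, e, l, he, hh,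
      hrun, ready_update hready rfl⟩
  | effect q q' st p m a b hp hs =>
    have hc : O.Ready p (st p) (procs p) := hready p
    rw [hp] at hc
    -- One solo run is used twice: it extends the sequential execution by a whole operation, and it
    -- moves `p` in the actual configuration to the point of returning.
    obtain ⟨⟨ℓ, μ'⟩, b', hsolo, hr⟩ := exists_solo_ret hO he p m a
    obtain ⟨e₁, hp₁, hh₁⟩ := O.exists_path_of_solo hsolo
      (procs := Function.update (fun _ => none) p (some (m, O.start p m a)))
      (Function.update_self ..)
    obtain ⟨e₂, hp₂, hh₂⟩ := O.exists_path_of_solo hsolo hc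
    have hseq : O.lts.Path O.lts.init (e ++ (Label.vis (ObjAction.call p m a) :: (e₁ ++
        [Label.vis (ObjAction.ret p m b')]))) ⟨μ', fun _ => none⟩ := by
      have hret := Trans.ret (O := O) ⟨μ', Function.update (fun _ => none) p (some (m, ℓ))⟩ p m ℓ
        b' (by simp) hr
      rw [Function.update_idem] at hp₁
      rw [Function.update_idem, Function.update_eq_self] at hret
      exact he.append (.cons (.call _ p m a rfl) (hp₁.append (.single hret)))
    have hhist : history (e ++ (Label.vis (ObjAction.call p m a) :: (e₁ ++
        [Label.vis (ObjAction.ret p m b')]))) = seqHistory (l ++ [(p, ⟨m, a, b'⟩)]) := by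
      rw [history_append, history_vis_cons, history_append, hh, hh₁, seqHistory_append]
      rfl
    -- The extended sequential history is its own linearization, so `T` admits the result `b'`;
    -- determinism then gives `b' = b`.
    obtain ⟨s, hs'⟩ := hlin _ ⟨_, hseq⟩
    rw [hhist] at hs'
    obtain ⟨q₂, hq₂⟩ := map_mem_of_isLinearization_seqHistory hs'
    have hrun' := hq₂
    rw [List.map_append] at hrun'
    obtain ⟨q₁, h1, h2⟩ := SeqLTS.run_append hrun'
    obtain rfl : q = q₁ := hrun.unique hT h1
    obtain ⟨rfl, rfl⟩ := hT _ _ _ _ _ _ _ hs (SeqLTS.run_singleton.1 h2)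
    exact ⟨e₂, _, hp₂, hh₂.symm, _, _, hseq, hhist, hq₂, ready_update hready ⟨ℓ, rfl, hr⟩⟩

end ConcurrentObject

/-! ### Invariants of the universal construction -/

namespace Universal

variable {n : ℕ} {M A B : Type u} {T : SeqLTS M A B}

@[simp] theorem setNode_heap (μ : Mem n M A) (x : ℕ) (v : Node M A) (y : ℕ) :
    (μ.setNode x v).heap y = if y = x then v else μ.heap y :=
  Function.update_apply ..

@[simp] theorem setNode_head (μ : Mem n M A) (x : ℕ) (v : Node M A) :
    (μ.setNode x v).head = μ.head := rfl

@[simp] theorem setHead_heap (μ : Mem n M A) (p : Fin n) (x : ℕ) :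
    (μ.setHead p x).heap = μ.heap := rfl

@[simp] theorem setHead_head (μ : Mem n M A) (p : Fin n) (x : ℕ) (q : Fin n) :
    (μ.setHead p x).head q = if q = p then x else μ.head q :=
  Function.update_apply ..

@[simp] theorem announceNew_heap (μ : Mem n M A) (p : Fin n) (m : M) (a : A) (y : ℕ) :
    (μ.announceNew p m a).heap y =
      if y = μ.fresh then ⟨some (m, a), none, 0, none⟩ else μ.heap y :=
  Function.update_apply ..

@[simp] theorem announceNew_fresh (μ : Mem n M A) (p : Fin n) (m : M) (a : A) :
    (μ.announceNew p m a).fresh = μ.fresh + 1 := rfl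

@[simp] theorem announceNew_announce (μ : Mem n M A) (p : Fin n) (m : M) (a : A) (q : Fin n) :
    (μ.announceNew p m a).announce q = if q = p then μ.fresh else μ.announce q :=
  Function.update_apply ..

@[simp] theorem announceNew_head (μ : Mem n M A) (p : Fin n) (m : M) (a : A) :
    (μ.announceNew p m a).head = μ.head := rfl

/-- The own node of an operation, after its allocation. -/
def Loc.node {Q : Type u} : Loc n M A B Q → Option ℕ
  | .announce _ _ => none
  | .scanHead me _ _ _ => some me
  | .scanSeq me _ _ _ _ => some me
  | .writeMax me _ => some me
  | .test me => some me
  | .readHead me => some me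
  | .readSeq me _ => some me
  | .readHelp me _ _ => some me
  | .testHelp me _ _ _ => some me
  | .decide me _ _ _ => some me
  | .writeNext me _ _ _ => some me
  | .writeSeq me _ _ => some me
  | .writeHead me _ => some me
  | .replayFirst me => some me
  | .replay me _ _ => some me
  | .respond me _ => some me
  | .done _ => none

/-- The invariant of the shared memory: `xs` is the list of the threaded nodes, and `qs i` is
the state of the sequential object after the first `i` operations in the list. -/
structure MemInv (T : SeqLTS M A B) (μ : Mem n M A) (xs : List ℕ) (qs : ℕ → T.State) : Prop where
  getElem?_zero : xs[0]? = some tail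
  nodup : xs.Nodup
  lt_fresh : ∀ x ∈ xs, x < μ.fresh
  decideNext_eq : ∀ i x, xs[i]? = some x → (μ.heap x).decideNext = xs[i + 1]?
  seq_of_not_mem : ∀ x, x ∉ xs → (μ.heap x).seq = 0
  decideNext_of_not_mem : ∀ x, x ∉ xs → (μ.heap x).decideNext = none
  seq_eq : ∀ i x, xs[i]? = some x → (μ.heap x).seq ≠ 0 → (μ.heap x).seq = i + 1
  -- Only the last threaded node may still lack its number, because successors are decided only at
  -- numbered nodes.
  seq_ne_zero : ∀ i x, xs[i]? = some x → i + 1 < xs.length → (μ.heap x).seq ≠ 0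
  seq_tail : (μ.heap tail).seq ≠ 0
  next_eq : ∀ i x y, xs[i]? = some x → xs[i + 1]? = some y → (μ.heap y).seq ≠ 0 →
    (μ.heap x).next = some y
  decideNext_of_next : ∀ x y, (μ.heap x).next = some y → (μ.heap x).decideNext = some y
  seq_head : ∀ p, (μ.heap (μ.head p)).seq ≠ 0
  announce_lt : ∀ p, μ.announce p < μ.fresh
  announce_inj : ∀ p q, μ.announce p = μ.announce q → p = q ∨ μ.announce p = tail
  qs_zero : qs 0 = T.init
  step : ∀ i x, xs[i + 1]? = some x → ∃ m a b, (μ.heap x).invoc = some (m, a) ∧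
    T.step (qs i) ⟨m, a, b⟩ (qs (i + 1))

/-- The invariant of the local states of process `p`. -/
def LocInv (T : SeqLTS M A B) (μ : Mem n M A) (xs : List ℕ) (qs : ℕ → T.State) (p : Fin n) :
    Loc n M A B T.State → Prop
  | .announce _ _ => True
  | .scanHead _ _ best s => (μ.heap best).seq = s ∧ s ≠ 0
  | .scanSeq _ _ cand best s => (μ.heap cand).seq ≠ 0 ∧ (μ.heap best).seq = s ∧ s ≠ 0
  | .writeMax _ best => (μ.heap best).seq ≠ 0
  | .test _ => True
  -- The condition carried through the loop ensures that a node proposed to an undecided consensus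
  -- object has not been threaded. Otherwise a node could enter the list twice.
  | .readHead me => (μ.heap (μ.head p)).decideNext = none → me ∉ xs
  | .readSeq me before => before = μ.head p ∧
      ((μ.heap (μ.head p)).decideNext = none → me ∉ xs)
  | .readHelp me before s => before = μ.head p ∧ s = (μ.heap (μ.head p)).seq ∧
      ((μ.heap (μ.head p)).decideNext = none → me ∉ xs)
  | .testHelp me before s help => before = μ.head p ∧ s = (μ.heap (μ.head p)).seq ∧
      help < μ.fresh ∧ ((μ.heap (μ.head p)).decideNext = none → me ∉ xs)
  | .decide _ before s prefer => before = μ.head p ∧ s = (μ.heap (μ.head p)).seq ∧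
      prefer < μ.fresh ∧ ((μ.heap (μ.head p)).decideNext = none → prefer ∉ xs)
  | .writeNext _ before s y => before = μ.head p ∧ s = (μ.heap (μ.head p)).seq ∧
      (μ.heap (μ.head p)).decideNext = some y
  | .writeSeq _ s y => s = (μ.heap (μ.head p)).seq ∧
      (μ.heap (μ.head p)).decideNext = some y ∧ (μ.heap (μ.head p)).next = some y
  | .writeHead _ y => (μ.heap y).seq = (μ.heap (μ.head p)).seq + 1
  | .replayFirst me => (μ.heap me).seq ≠ 0
  -- The current node has index `i + 1` and number `i + 2`; the last inequality says that the replay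
  -- has not passed the own node.
  | .replay me q cur => (μ.heap me).seq ≠ 0 ∧ ∃ i x, cur = some x ∧ xs[i + 1]? = some x ∧
      q = qs i ∧ i + 2 ≤ (μ.heap me).seq
  | .respond me q => ∃ i, xs[i + 1]? = some me ∧ q = qs i
  | .done _ => True

/-- The invariant of the own node `me` of an operation of process `p`, whose status in the
atomic object is `s`. -/
def NodeInv (T : SeqLTS M A B) (μ : Mem n M A) (xs : List ℕ) (qs : ℕ → T.State) (p : Fin n)
    (m : M) (me : ℕ) (s : OpStatus M A B) : Prop :=
  μ.announce p = me ∧ me ≠ tail ∧ ∃ a, (μ.heap me).invoc = some (m, a) ∧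
    ((me ∉ xs ∧ s = .called m a) ∨
      ∃ i b, xs[i + 1]? = some me ∧ T.step (qs i) ⟨m, a, b⟩ (qs (i + 1)) ∧ s = .done m b)

/-- The invariant of the configurations, where `st` is the corresponding status of the processes
in the atomic object. -/
structure Inv (T : SeqLTS M A B) (μ : Mem n M A)
    (procs : Fin n → Option (M × Loc n M A B T.State)) (xs : List ℕ) (qs : ℕ → T.State)
    (st : Fin n → OpStatus M A B) : Prop where
  mem : MemInv T μ xs qs
  loc : ∀ p m ℓ, procs p = some (m, ℓ) → LocInv T μ xs qs p ℓ
  idle : ∀ p, procs p = none → st p = .idle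
  node : ∀ p m ℓ me, procs p = some (m, ℓ) → ℓ.node = some me →
    NodeInv T μ xs qs p m me (st p)
  start : ∀ p m m' a, procs p = some (m, .announce m' a) → m' = m ∧ st p = .called m a
  done : ∀ p m b, procs p = some (m, .done b) → st p = .done m b
  -- This guarantees that a node being threaded belongs to a pending operation, which can therefore
  -- take effect.
  owner : ∀ x, x < μ.fresh → x ∉ xs → ∃ p m ℓ, procs p = some (m, ℓ) ∧ ℓ.node = some x

/-- How the memory and the list may evolve. -/
structure Evolves (T : SeqLTS M A B) (μ : Mem n M A) (xs : List ℕ) (qs : ℕ → T.State)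
    (μ' : Mem n M A) (xs' : List ℕ) (qs' : ℕ → T.State) : Prop where
  fresh_le : μ.fresh ≤ μ'.fresh
  invoc : ∀ x, x < μ.fresh → (μ'.heap x).invoc = (μ.heap x).invoc
  seq : ∀ x, (μ.heap x).seq ≠ 0 → (μ'.heap x).seq = (μ.heap x).seq
  decideNext : ∀ x y, (μ.heap x).decideNext = some y → (μ'.heap x).decideNext = some y
  next : ∀ x y, (μ.heap x).next = some y → (μ'.heap x).next = some y
  isPrefix : xs <+: xs'
  qs : ∀ i, i < xs.length → qs' i = qs i

/-! ### Stability of the invariants under changes of the memory. -/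

section MemInv

variable {μ μ' : Mem n M A} {xs xs' : List ℕ} {qs qs' : ℕ → T.State}

theorem MemInv.length_pos (H : MemInv T μ xs qs) : 0 < xs.length := by
  obtain ⟨h, -⟩ := List.getElem?_eq_some_iff.1 H.getElem?_zero
  exact h

theorem lt_length_of_getElem? {α : Type*} {xs : List α} {i : ℕ} {x : α} (h : xs[i]? = some x) :
    i < xs.length :=
  (List.getElem?_eq_some_iff.1 h).1

theorem MemInv.index_unique (H : MemInv T μ xs qs) {i j x : ℕ} (hi : xs[i]? = some x)
    (hj : xs[j]? = some x) : i = j :=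
  (List.getElem?_inj (lt_length_of_getElem? hi) H.nodup).1 (hi.trans hj.symm)

theorem MemInv.mem_of_seq (H : MemInv T μ xs qs) {x : ℕ} (hx : (μ.heap x).seq ≠ 0) : x ∈ xs :=
  not_not.1 fun h => hx (H.seq_of_not_mem x h)

theorem MemInv.exists_index (H : MemInv T μ xs qs) {x : ℕ} (hx : (μ.heap x).seq ≠ 0) :
    ∃ i, xs[i]? = some x ∧ (μ.heap x).seq = i + 1 := by
  obtain ⟨i, hi⟩ := List.mem_iff_getElem?.1 (H.mem_of_seq hx)
  exact ⟨i, hi, H.seq_eq i x hi hx⟩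

theorem MemInv.lt_fresh_of_seq (H : MemInv T μ xs qs) {x : ℕ} (hx : (μ.heap x).seq ≠ 0) :
    x < μ.fresh :=
  H.lt_fresh x (H.mem_of_seq hx)

theorem MemInv.seq_ne_zero_of_le (H : MemInv T μ xs qs) {i j x y : ℕ} (hi : xs[i]? = some x)
    (hj : xs[j]? = some y) (hij : i ≤ j) (hy : (μ.heap y).seq ≠ 0) : (μ.heap x).seq ≠ 0 := by
  have := lt_length_of_getElem? hj
  rcases hij.eq_or_lt with rfl | h
  · rw [hi, Option.some.injEq] at hj
    rwa [hj]
  · exact H.seq_ne_zero i x hi (by omega)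

theorem Evolves.refl : Evolves T μ xs qs μ xs qs :=
  ⟨le_rfl, fun _ _ => rfl, fun _ _ => rfl, fun _ _ h => h, fun _ _ h => h,
    List.prefix_refl _, fun _ _ => rfl⟩

theorem Evolves.getElem? (h : Evolves T μ xs qs μ' xs' qs') {i x : ℕ} (hi : xs[i]? = some x) :
    xs'[i]? = some x := by
  obtain ⟨t, rfl⟩ := h.isPrefix
  rw [List.getElem?_append_left (lt_length_of_getElem? hi), hi]

/-- If the node `x` has no successor, then no node has been threaded. -/
theorem Evolves.not_mem (h : Evolves T μ xs qs μ' xs' qs') (H : MemInv T μ xs qs)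
    (H' : MemInv T μ' xs' qs') {x y : ℕ} (hx : (μ.heap x).seq ≠ 0)
    (hy : (μ.heap x).decideNext = none → y ∉ xs) :
    (μ'.heap x).decideNext = none → y ∉ xs' := by
  intro hn
  have hn0 : (μ.heap x).decideNext = none := by
    cases hd : (μ.heap x).decideNext with
    | none => rfl
    | some z =>
      rw [h.decideNext x z hd] at hn
      cases hn
  obtain ⟨i, hi, -⟩ := H.exists_index hx
  -- An undecided `x` is the last node of `xs'` too, so the list has not grown.
  rw [H'.decideNext_eq i x (h.getElem? hi), List.getElem?_eq_none_iff] at hn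
  have h1 := lt_length_of_getElem? hi
  have h2 : xs = xs' := h.isPrefix.eq_of_length_le (by omega)
  rw [← h2]
  exact hy hn0

/-- Non-interference: apart from `head[p]`, which only `p` writes, local assertions use facts that
are never revoked, such as decided successors, assigned numbers and earlier states of the sequential
object. -/
theorem LocInv.evolve (h : Evolves T μ xs qs μ' xs' qs') (H : MemInv T μ xs qs)
    (H' : MemInv T μ' xs' qs') {p : Fin n} (hhead : μ'.head p = μ.head p)
    {ℓ : Loc n M A B T.State} (hℓ : LocInv T μ xs qs p ℓ) : LocInv T μ' xs' qs' p ℓ := by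
  have hseq : (μ'.heap (μ.head p)).seq = (μ.heap (μ.head p)).seq := h.seq _ (H.seq_head p)
  have hnm : ∀ y, ((μ.heap (μ.head p)).decideNext = none → y ∉ xs) →
      (μ'.heap (μ.head p)).decideNext = none → y ∉ xs' :=
    fun y hy => h.not_mem H H' (H.seq_head p) hy
  have hne : ∀ x, (μ.heap x).seq ≠ 0 → (μ'.heap x).seq ≠ 0 := fun x hx => by rwa [h.seq x hx]
  cases ℓ with
  | announce => trivial
  | scanHead me k best s =>
    obtain ⟨h1, h2⟩ := hℓ
    exact ⟨by rw [h.seq best (by omega), h1], h2⟩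
  | scanSeq me k cand best s =>
    obtain ⟨h0, h1, h2⟩ := hℓ
    exact ⟨hne _ h0, by rw [h.seq best (by omega), h1], h2⟩
  | writeMax => exact hne _ hℓ
  | test => trivial
  | readHead =>
    simp only [LocInv, hhead] at hℓ ⊢
    exact hnm _ hℓ
  | readSeq =>
    simp only [LocInv, hhead] at hℓ ⊢
    exact ⟨hℓ.1, hnm _ hℓ.2⟩
  | readHelp =>
    simp only [LocInv, hhead, hseq] at hℓ ⊢
    exact ⟨hℓ.1, hℓ.2.1, hnm _ hℓ.2.2⟩
  | testHelp =>
    simp only [LocInv, hhead, hseq] at hℓ ⊢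
    exact ⟨hℓ.1, hℓ.2.1, hℓ.2.2.1.trans_le h.fresh_le, hnm _ hℓ.2.2.2⟩
  | decide =>
    simp only [LocInv, hhead, hseq] at hℓ ⊢
    exact ⟨hℓ.1, hℓ.2.1, hℓ.2.2.1.trans_le h.fresh_le, hnm _ hℓ.2.2.2⟩
  | writeNext =>
    simp only [LocInv, hhead, hseq] at hℓ ⊢
    exact ⟨hℓ.1, hℓ.2.1, h.decideNext _ _ hℓ.2.2⟩
  | writeSeq =>
    simp only [LocInv, hhead, hseq] at hℓ ⊢
    exact ⟨hℓ.1, h.decideNext _ _ hℓ.2.1, h.next _ _ hℓ.2.2⟩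
  | writeHead me y =>
    simp only [LocInv, hhead, hseq] at hℓ ⊢
    rw [h.seq y (by omega), hℓ]
  | replayFirst => exact hne _ hℓ
  | replay me q cur =>
    obtain ⟨h0, i, x, h1, h2, h3, h4⟩ := hℓ
    refine ⟨hne _ h0, i, x, h1, h.getElem? h2, ?_, by rwa [h.seq _ h0]⟩
    rw [h3, h.qs i (Nat.lt_of_succ_lt (lt_length_of_getElem? h2))]
  | respond me q =>
    obtain ⟨i, h1, h2⟩ := hℓ
    refine ⟨i, h.getElem? h1, ?_⟩
    rw [h2, h.qs i (Nat.lt_of_succ_lt (lt_length_of_getElem? h1))]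
  | done => trivial

/-! ### The memory operations preserve the invariant of the memory -/

theorem MemInv.setHead (H : MemInv T μ xs qs) (p : Fin n) {x : ℕ} (hx : (μ.heap x).seq ≠ 0) :
    MemInv T (μ.setHead p x) xs qs :=
  { H with
    seq_head := fun q => by
      rw [setHead_head, setHead_heap]
      split_ifs
      · exact hx
      · exact H.seq_head q }

theorem Evolves.setHead (p : Fin n) (x : ℕ) : Evolves T μ xs qs (μ.setHead p x) xs qs :=
  ⟨le_rfl, fun _ _ => rfl, fun _ _ => rfl, fun _ _ h => h, fun _ _ h => h,
    List.prefix_refl _, fun _ _ => rfl⟩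

theorem setNode_heap_congr {α : Type*} (f : Node M A → α) {μ : Mem n M A} {x : ℕ} {v : Node M A}
    (h : f v = f (μ.heap x)) (y : ℕ) : f ((μ.setNode x v).heap y) = f (μ.heap y) := by
  rw [setNode_heap]
  split_ifs with hy
  · rw [hy, h]
  · rfl

/-- The field `next` is a copy of the decided successor, so late or repeated writes by helpers are
harmless. -/
theorem MemInv.setNext (H : MemInv T μ xs qs) {x y : ℕ}
    (hxy : (μ.heap x).decideNext = some y) :
    MemInv T (μ.setNode x { μ.heap x with next := some y }) xs qs := by
  have hs := setNode_heap_congr Node.seq (μ := μ) (x := x)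
    (v := { μ.heap x with next := some y }) rfl
  have hd := setNode_heap_congr Node.decideNext (μ := μ) (x := x)
    (v := { μ.heap x with next := some y }) rfl
  have hi := setNode_heap_congr Node.invoc (μ := μ) (x := x)
    (v := { μ.heap x with next := some y }) rfl
  refine ⟨H.getElem?_zero, H.nodup, H.lt_fresh, ?_, ?_, ?_, ?_, ?_, ?_, ?_, ?_, ?_, H.announce_lt,
    H.announce_inj, H.qs_zero, ?_⟩
  · simpa only [hd] using H.decideNext_eq
  · simpa only [hs] using H.seq_of_not_mem
  · simpa only [hd] using H.decideNext_of_not_mem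
  · simpa only [hs] using H.seq_eq
  · simpa only [hs] using H.seq_ne_zero
  · simpa only [hs] using H.seq_tail
  · intro i z w hz hw hsw
    rw [hs] at hsw
    rw [setNode_heap]
    split_ifs with hzx
    · subst hzx
      rw [← hxy, H.decideNext_eq i z hz, hw]
    · exact H.next_eq i z w hz hw hsw
  · intro z w hz
    rw [hd]
    rw [setNode_heap] at hz
    split_ifs at hz with hzx
    · rw [hzx, hxy]
      exact hz
    · exact H.decideNext_of_next z w hz
  · exact fun p => by rw [hs]; exact H.seq_head p
  · simpa only [hi] using H.step

theorem Evolves.setNext (H : MemInv T μ xs qs) {x y : ℕ}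
    (hxy : (μ.heap x).decideNext = some y) :
    Evolves T μ xs qs (μ.setNode x { μ.heap x with next := some y }) xs qs := by
  have hs := setNode_heap_congr Node.seq (μ := μ) (x := x)
    (v := { μ.heap x with next := some y }) rfl
  have hd := setNode_heap_congr Node.decideNext (μ := μ) (x := x)
    (v := { μ.heap x with next := some y }) rfl
  have hi := setNode_heap_congr Node.invoc (μ := μ) (x := x)
    (v := { μ.heap x with next := some y }) rfl
  refine ⟨le_rfl, fun z _ => hi z, fun z _ => hs z, fun z w hz => by rw [hd, hz], ?_,
    List.prefix_refl _, fun _ _ => rfl⟩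
  intro z w hz
  rw [setNode_heap]
  split_ifs with hzx
  · subst hzx
    rw [← hxy, H.decideNext_of_next z w hz]
  · exact hz

/-- Numbers start at `1` and indices at `0`: number `s` means index `s - 1`, and the successor has
index `s`. -/
theorem MemInv.getElem?_succ (H : MemInv T μ xs qs) {x y s : ℕ} (hx : (μ.heap x).seq ≠ 0)
    (hs : s = (μ.heap x).seq) (hxy : (μ.heap x).decideNext = some y) :
    xs[s - 1]? = some x ∧ xs[s]? = some y := by
  obtain ⟨i, hi, hi'⟩ := H.exists_index hx
  rw [hs, hi', Nat.add_sub_cancel, ← hxy, H.decideNext_eq i x hi]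
  exact ⟨hi, rfl⟩

/-- The node `y` has index `s`, so `s + 1` is its only possible number. The link from `x` must be
present before `y` is numbered; this is what makes the replay safe. -/
theorem MemInv.setSeq (H : MemInv T μ xs qs) {x y s : ℕ} (hx : (μ.heap x).seq ≠ 0)
    (hs : s = (μ.heap x).seq) (hxy : (μ.heap x).decideNext = some y)
    (hnext : (μ.heap x).next = some y) :
    MemInv T (μ.setNode y { μ.heap y with seq := s + 1 }) xs qs := by
  have hn := setNode_heap_congr Node.next (μ := μ) (x := y)
    (v := { μ.heap y with seq := s + 1 }) rfl
  have hd := setNode_heap_congr Node.decideNext (μ := μ) (x := y)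
    (v := { μ.heap y with seq := s + 1 }) rfl
  have hi := setNode_heap_congr Node.invoc (μ := μ) (x := y)
    (v := { μ.heap y with seq := s + 1 }) rfl
  obtain ⟨h1, h2⟩ := H.getElem?_succ hx hs hxy
  have hne : ∀ z, (μ.heap z).seq ≠ 0 →
      ((μ.setNode y { μ.heap y with seq := s + 1 }).heap z).seq ≠ 0 := by
    intro z hz
    rw [setNode_heap]
    split_ifs
    · exact Nat.succ_ne_zero s
    · exact hz
  refine ⟨H.getElem?_zero, H.nodup, H.lt_fresh, ?_, ?_, ?_, ?_, ?_, hne _ H.seq_tail, ?_, ?_,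
    fun p => hne _ (H.seq_head p), H.announce_lt, H.announce_inj, H.qs_zero, ?_⟩
  · simpa only [hd] using H.decideNext_eq
  · intro z hz
    rw [setNode_heap, if_neg (ne_of_mem_of_not_mem (List.mem_of_getElem? h2) hz).symm]
    exact H.seq_of_not_mem z hz
  · simpa only [hd] using H.decideNext_of_not_mem
  · intro i z hz
    rw [setNode_heap]
    split_ifs with hzy
    · subst hzy
      rw [H.index_unique hz h2]
      exact fun _ => rfl
    · exact H.seq_eq i z hz
  · exact fun i z hz hlt => hne _ (H.seq_ne_zero i z hz hlt)
  · intro i z w hz hw hsw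
    rw [hn]
    by_cases hwy : w = y
    · subst hwy
      have := H.index_unique hw h2
      have : s - 1 = i := by omega
      rw [this, hz, Option.some.injEq] at h1
      rw [h1, hnext]
    · rw [setNode_heap, if_neg hwy] at hsw
      exact H.next_eq i z w hz hw hsw
  · simpa only [hd, hn] using H.decideNext_of_next
  · simpa only [hi] using H.step

theorem Evolves.setSeq (H : MemInv T μ xs qs) {x y s : ℕ} (hx : (μ.heap x).seq ≠ 0)
    (hs : s = (μ.heap x).seq) (hxy : (μ.heap x).decideNext = some y) :
    Evolves T μ xs qs (μ.setNode y { μ.heap y with seq := s + 1 }) xs qs := by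
  have hn := setNode_heap_congr Node.next (μ := μ) (x := y)
    (v := { μ.heap y with seq := s + 1 }) rfl
  have hd := setNode_heap_congr Node.decideNext (μ := μ) (x := y)
    (v := { μ.heap y with seq := s + 1 }) rfl
  have hi := setNode_heap_congr Node.invoc (μ := μ) (x := y)
    (v := { μ.heap y with seq := s + 1 }) rfl
  refine ⟨le_rfl, fun z _ => hi z, ?_, fun z w hz => by rw [hd, hz],
    fun z w hz => by rw [hn, hz], List.prefix_refl _, fun _ _ => rfl⟩
  intro z hz
  rw [setNode_heap]
  split_ifs with hzy
  · subst hzy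
    exact (H.seq_eq _ _ (H.getElem?_succ hx hs hxy).2 hz).symm
  · rfl

theorem MemInv.announceNew (H : MemInv T μ xs qs) (p : Fin n) (m : M) (a : A) :
    MemInv T (μ.announceNew p m a) xs qs := by
  have hfresh : ∀ x ∈ xs, x ≠ μ.fresh := fun x hx => (H.lt_fresh x hx).ne
  have hmem : ∀ x ∈ xs, (μ.announceNew p m a).heap x = μ.heap x := by
    intro x hx
    rw [announceNew_heap, if_neg (hfresh x hx)]
  have hmem' : ∀ {i x : ℕ}, xs[i]? = some x →
      (μ.announceNew p m a).heap x = μ.heap x :=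
    fun h => hmem _ (List.mem_of_getElem? h)
  have hpos := H.lt_fresh _ (List.mem_of_getElem? H.getElem?_zero)
  refine ⟨H.getElem?_zero, H.nodup, fun x hx => (H.lt_fresh x hx).trans (Nat.lt_succ_self _),
    fun i x hx => ?_, fun x hx => ?_, fun x hx => ?_, fun i x hx => ?_, fun i x hx => ?_, ?_,
    fun i x y hx hy => ?_, fun x y => ?_, fun q => ?_, fun q => ?_, fun q r => ?_, H.qs_zero,
    fun i x hx => ?_⟩
  · rw [hmem' hx]
    exact H.decideNext_eq i x hx
  · rw [announceNew_heap]
    split_ifs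
    · rfl
    · exact H.seq_of_not_mem x hx
  · rw [announceNew_heap]
    split_ifs
    · rfl
    · exact H.decideNext_of_not_mem x hx
  · rw [hmem' hx]
    exact H.seq_eq i x hx
  · rw [hmem' hx]
    exact H.seq_ne_zero i x hx
  · rw [hmem' H.getElem?_zero]
    exact H.seq_tail
  · rw [hmem' hx, hmem' hy]
    exact H.next_eq i x y hx hy
  · rw [announceNew_heap]
    split_ifs
    · exact fun h => nomatch h
    · exact H.decideNext_of_next x y
  · rw [announceNew_head, hmem _ (H.mem_of_seq (H.seq_head q))]
    exact H.seq_head q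
  · rw [announceNew_announce, announceNew_fresh]
    have := H.announce_lt q
    split_ifs <;> omega
  · rw [announceNew_announce, announceNew_announce]
    have h1 := H.announce_lt q
    have h2 := H.announce_lt r
    split_ifs with hq hr hr
    · exact fun _ => .inl (hq.trans hr.symm)
    · intro h
      omega
    · intro h
      omega
    · exact H.announce_inj q r
  · rw [hmem' hx]
    exact H.step i x hx

theorem Evolves.announceNew (H : MemInv T μ xs qs) (p : Fin n) (m : M) (a : A) :
    Evolves T μ xs qs (μ.announceNew p m a) xs qs := by
  have hfresh : μ.fresh ∉ xs := fun h => (H.lt_fresh _ h).false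
  have hd := H.decideNext_of_not_mem _ hfresh
  refine ⟨Nat.le_succ _, fun x hx => ?_, fun x hx => ?_, fun x y hx => ?_, fun x y hx => ?_,
    List.prefix_refl _, fun _ _ => rfl⟩
  · rw [announceNew_heap, if_neg hx.ne]
  · rw [announceNew_heap, if_neg (H.lt_fresh_of_seq hx).ne]
  · rw [announceNew_heap, if_neg, hx]
    rintro rfl
    rw [hd] at hx
    cases hx
  · rw [announceNew_heap, if_neg, hx]
    rintro rfl
    have := H.decideNext_of_next _ y hx
    rw [hd] at this
    cases this

/-- The successor of the last node is decided. -/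
theorem MemInv.decide (H : MemInv T μ xs qs) {x y s : ℕ} (hx : (μ.heap x).seq ≠ 0)
    (hs : s = (μ.heap x).seq) (hlen : s = xs.length) (hy : y < μ.fresh) (hyx : y ∉ xs) {m : M}
    {a : A} {b : B} {q : T.State} (hi : (μ.heap y).invoc = some (m, a))
    (hstep : T.step (qs (s - 1)) ⟨m, a, b⟩ q) :
    MemInv T (μ.setNode x { μ.heap x with decideNext := some y }) (xs ++ [y])
      (Function.update qs s q) := by
  have hsq := setNode_heap_congr Node.seq (μ := μ) (x := x)
    (v := { μ.heap x with decideNext := some y }) rfl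
  have hn := setNode_heap_congr Node.next (μ := μ) (x := x)
    (v := { μ.heap x with decideNext := some y }) rfl
  have hin := setNode_heap_congr Node.invoc (μ := μ) (x := x)
    (v := { μ.heap x with decideNext := some y }) rfl
  have hpos := H.length_pos
  obtain ⟨i₀, hi₀, hi₀'⟩ := H.exists_index hx
  have hcases : ∀ {i z : ℕ}, (xs ++ [y])[i]? = some z → (i < s ∧ xs[i]? = some z) ∨
      (i = s ∧ z = y) := by
    intro i z hz
    rcases lt_or_ge i xs.length with h | h
    · rw [List.getElem?_append_left h] at hz
      exact .inl ⟨by omega, hz⟩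
    · rw [List.getElem?_append_right h, List.getElem?_singleton] at hz
      split_ifs at hz with h'
      · cases hz
        exact .inr ⟨by omega, rfl⟩
  have hyne : y ≠ x := fun h => hyx (h ▸ H.mem_of_seq hx)
  refine ⟨?_, ?_, ?_, ?_, ?_, ?_, ?_, ?_, ?_, ?_, ?_, ?_, H.announce_lt, H.announce_inj, ?_, ?_⟩
  · rw [List.getElem?_append_left hpos]
    exact H.getElem?_zero
  · rw [← List.concat_eq_append]
    exact H.nodup.concat hyx
  · intro z hz
    rcases List.mem_append.1 hz with hz | hz
    · exact H.lt_fresh z hz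
    · rw [List.mem_singleton.1 hz]
      exact hy
  · intro i z hz
    rcases hcases hz with ⟨hlt, hz⟩ | ⟨rfl, rfl⟩
    · rw [setNode_heap]
      split_ifs with hzx
      · subst hzx
        have := H.index_unique hz hi₀
        rw [List.getElem?_append_right (by omega), show i + 1 - xs.length = 0 by omega]
        rfl
      · rw [H.decideNext_eq i z hz]
        have : i ≠ i₀ := by
          rintro rfl
          rw [hz, Option.some.injEq] at hi₀
          exact hzx hi₀
        rw [List.getElem?_append_left (by omega)]
    · rw [setNode_heap, if_neg hyne, H.decideNext_of_not_mem _ hyx,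
        List.getElem?_eq_none (by simp; omega)]
  · intro z hz
    rw [hsq]
    exact H.seq_of_not_mem z fun h => hz (List.mem_append_left _ h)
  · intro z hz
    have h1 : z ∉ xs := fun h => hz (List.mem_append_left _ h)
    rw [setNode_heap, if_neg (ne_of_mem_of_not_mem (H.mem_of_seq hx) h1).symm]
    exact H.decideNext_of_not_mem z h1
  · intro i z hz
    rw [hsq]
    rcases hcases hz with ⟨hlt, hz⟩ | ⟨rfl, rfl⟩
    · exact H.seq_eq i z hz
    · exact fun h => absurd (H.seq_of_not_mem _ hyx) h
  · intro i z hz hlt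
    rw [hsq]
    rw [List.length_append, List.length_singleton] at hlt
    rcases hcases hz with ⟨hlt', hz⟩ | ⟨rfl, rfl⟩
    -- Every old node is at or before `x`, which is numbered; only the new node may be without a
    -- number.
    · exact H.seq_ne_zero_of_le hz hi₀ (by omega) hx
    · omega
  · rw [hsq]
    exact H.seq_tail
  · intro i z w hz hw hsw
    rw [hsq] at hsw
    rw [hn]
    rcases hcases hw with ⟨hlt', hw⟩ | ⟨h, rfl⟩
    · rcases hcases hz with ⟨hlt, hz⟩ | ⟨h, rfl⟩
      · exact H.next_eq i z w hz hw hsw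
      · omega
    · exact absurd (H.seq_of_not_mem _ hyx) hsw
  · intro z w hz
    rw [hn] at hz
    have := H.decideNext_of_next z w hz
    rw [setNode_heap]
    split_ifs with hzx
    · subst hzx
      rw [H.decideNext_eq i₀ z hi₀, List.getElem?_eq_none (by omega)] at this
      cases this
    · exact this
  · exact fun p => by rw [hsq]; exact H.seq_head p
  · rw [Function.update_of_ne (by omega)]
    exact H.qs_zero
  · intro i z hz
    rw [hin]
    rcases hcases hz with ⟨hlt, hz⟩ | ⟨rfl, rfl⟩
    · rw [Function.update_of_ne (by omega), Function.update_of_ne (by omega)]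
      exact H.step i z hz
    · rw [Function.update_self, Function.update_of_ne (by omega)]
      exact ⟨m, a, b, hi, hstep⟩

theorem Evolves.decide {x y s : ℕ} (hdec : (μ.heap x).decideNext = none)
    (hlen : s = xs.length) (q : T.State) :
    Evolves T μ xs qs (μ.setNode x { μ.heap x with decideNext := some y }) (xs ++ [y])
      (Function.update qs s q) := by
  have hsq := setNode_heap_congr Node.seq (μ := μ) (x := x)
    (v := { μ.heap x with decideNext := some y }) rfl
  have hn := setNode_heap_congr Node.next (μ := μ) (x := x)
    (v := { μ.heap x with decideNext := some y }) rfl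
  have hin := setNode_heap_congr Node.invoc (μ := μ) (x := x)
    (v := { μ.heap x with decideNext := some y }) rfl
  refine ⟨le_rfl, fun z _ => hin z, fun z _ => hsq z, ?_, fun z w hz => by rw [hn, hz],
    List.prefix_append _ _, fun i hi => Function.update_of_ne (by omega) _ _⟩
  intro z w hz
  rw [setNode_heap, if_neg, hz]
  rintro rfl
  rw [hdec] at hz
  cases hz

end MemInv

end Universal

/-! ### The universal construction is simulated by the atomic object -/

namespace Universal

variable {n : ℕ} {M A B : Type u} {T : SeqLTS M A B} {μ μ' : Mem n M A}
  {procs : Fin n → Option (M × Loc n M A B T.State)} {xs xs' : List ℕ} {qs qs' : ℕ → T.State}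
  {st : Fin n → OpStatus M A B}

theorem update_eq_some {p q : Fin n} {m m' : M} {ℓ ℓ' : Loc n M A B T.State}
    (h : Function.update procs p (some (m, ℓ)) q = some (m', ℓ')) :
    (q = p ∧ m' = m ∧ ℓ' = ℓ) ∨ (q ≠ p ∧ procs q = some (m', ℓ')) := by
  by_cases hq : q = p
  · subst hq
    rw [Function.update_self] at h
    cases h
    exact .inl ⟨rfl, rfl, rfl⟩
  · rw [Function.update_of_ne hq] at h
    exact .inr ⟨hq, h⟩

theorem update_none_eq_some {p q : Fin n} {y : M × Loc n M A B T.State}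
    (h : Function.update procs p none q = some y) : q ≠ p ∧ procs q = some y := by
  by_cases hq : q = p
  · subst hq
    simp at h
  · rw [Function.update_of_ne hq] at h
    exact ⟨hq, h⟩

theorem NodeInv.evolve {p : Fin n} {m : M} {me : ℕ} {s : OpStatus M A B}
    (h : NodeInv T μ xs qs p m me s) (H : MemInv T μ xs qs) (he : Evolves T μ xs qs μ' xs qs')
    (ha : μ'.announce p = μ.announce p) : NodeInv T μ' xs qs' p m me s := by
  obtain ⟨h1, h2, a, h3, h4⟩ := h
  refine ⟨ha.trans h1, h2, a, ?_, ?_⟩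
  · rw [he.invoc me (h1 ▸ H.announce_lt p), h3]
  · refine h4.imp_right ?_
    rintro ⟨i, b, h5, h6, h7⟩
    have := lt_length_of_getElem? h5
    refine ⟨i, b, h5, ?_, h7⟩
    rwa [he.qs i (by omega), he.qs (i + 1) (by omega)]

theorem Inv.initial (T : SeqLTS M A B) :
    Inv T (initMem n M A) (fun _ => none) [tail] (fun _ => T.init) fun _ => .idle := by
  have h1 : ∀ {i x : ℕ}, [tail][i]? = some x → i = 0 ∧ x = tail := by
    intro i x h
    rw [List.getElem?_singleton] at h
    split_ifs at h with hi
    cases h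
    exact ⟨hi, rfl⟩
  refine ⟨⟨rfl, List.nodup_singleton _, ?_, ?_, ?_, ?_, ?_, ?_, ?_, ?_, ?_, ?_, ?_, ?_, rfl, ?_⟩,
    ?_, ?_, ?_, ?_, ?_, ?_⟩
  · intro x hx
    rw [List.mem_singleton.1 hx]
    exact Nat.lt_succ_self _
  · intro i x h
    obtain ⟨rfl, rfl⟩ := h1 h
    rfl
  · intro x hx
    exact if_neg fun h => hx (List.mem_singleton.2 h)
  · exact fun _ _ => rfl
  · intro i x h
    obtain ⟨rfl, rfl⟩ := h1 h
    exact fun _ => rfl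
  · intro i x h hlt
    simp at hlt
  · exact Nat.one_ne_zero
  · intro i x y _ h
    exact absurd (h1 h).1 (Nat.succ_ne_zero _)
  · exact fun x y h => nomatch h
  · exact fun _ => Nat.one_ne_zero
  · exact fun _ => Nat.lt_succ_self _
  · exact fun _ _ _ => .inr rfl
  · intro i x h
    exact absurd (h1 h).1 (Nat.succ_ne_zero _)
  · exact fun _ _ _ h => nomatch h
  · exact fun _ _ => rfl
  · exact fun _ _ _ _ h => nomatch h
  · exact fun _ _ _ _ h => nomatch h
  · exact fun _ _ _ h => nomatch h
  · intro x hx hx'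
    exact absurd (List.mem_singleton.2 (Nat.lt_one_iff.1 hx)) hx'

theorem Inv.call (H : Inv T μ procs xs qs st) {p : Fin n} (hp : procs p = none) (m : M) (a : A) :
    Inv T μ (Function.update procs p (some (m, .announce m a))) xs qs
      (Function.update st p (.called m a)) := by
  refine ⟨H.mem, ?_, ?_, ?_, ?_, ?_, ?_⟩
  · intro q m' ℓ hq
    rcases update_eq_some hq with ⟨rfl, rfl, rfl⟩ | ⟨-, hq⟩
    · trivial
    · exact H.loc q m' ℓ hq
  · intro q hq
    by_cases hqp : q = p
    · subst hqp
      simp at hq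
    · rw [Function.update_of_ne hqp] at hq ⊢
      exact H.idle q hq
  · intro q m' ℓ me hq hn
    rcases update_eq_some hq with ⟨rfl, rfl, rfl⟩ | ⟨hqp, hq⟩
    · cases hn
    · rw [Function.update_of_ne hqp]
      exact H.node q m' ℓ me hq hn
  · intro q m' m'' a' hq
    rcases update_eq_some hq with ⟨rfl, rfl, h⟩ | ⟨hqp, hq⟩
    · cases h
      exact ⟨rfl, Function.update_self ..⟩
    · rw [Function.update_of_ne hqp]
      exact H.start q m' m'' a' hq
  · intro q m' b hq
    rcases update_eq_some hq with ⟨rfl, rfl, h⟩ | ⟨hqp, hq⟩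
    · cases h
    · rw [Function.update_of_ne hqp]
      exact H.done q m' b hq
  · intro x hx hx'
    obtain ⟨q, m', ℓ, hq, hn⟩ := H.owner x hx hx'
    refine ⟨q, m', ℓ, ?_, hn⟩
    rw [Function.update_of_ne, hq]
    rintro rfl
    rw [hp] at hq
    cases hq

theorem Inv.ret (H : Inv T μ procs xs qs st) {p : Fin n} {m : M} {b : B}
    (hp : procs p = some (m, .done b)) :
    Inv T μ (Function.update procs p none) xs qs (Function.update st p .idle) := by
  refine ⟨H.mem, fun q m' ℓ hq => H.loc q m' ℓ (update_none_eq_some hq).2, ?_, ?_, ?_, ?_, ?_⟩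
  · intro q hq
    by_cases hqp : q = p
    · subst hqp
      simp
    · rw [Function.update_of_ne hqp] at hq ⊢
      exact H.idle q hq
  · intro q m' ℓ me hq hn
    rw [Function.update_of_ne (update_none_eq_some hq).1]
    exact H.node q m' ℓ me (update_none_eq_some hq).2 hn
  · intro q m' m'' a' hq
    rw [Function.update_of_ne (update_none_eq_some hq).1]
    exact H.start q m' m'' a' (update_none_eq_some hq).2
  · intro q m' b' hq
    rw [Function.update_of_ne (update_none_eq_some hq).1]
    exact H.done q m' b' (update_none_eq_some hq).2
  · intro x hx hx'
    obtain ⟨q, m', ℓ, hq, hn⟩ := H.owner x hx hx'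
    refine ⟨q, m', ℓ, ?_, hn⟩
    rw [Function.update_of_ne, hq]
    rintro rfl
    rw [hp] at hq
    cases hq
    cases hn

/-- Steps that do not change the list of the threaded nodes, and do not allocate. -/
theorem Inv.quiet (H : Inv T μ procs xs qs st) {p : Fin n} {m : M} {ℓ ℓ' : Loc n M A B T.State}
    {me : ℕ} (hp : procs p = some (m, ℓ)) (hℓ : ℓ.node = some me) (hℓ' : ℓ'.node = some me)
    (hmem : MemInv T μ' xs qs) (hev : Evolves T μ xs qs μ' xs qs)
    (hfresh : μ'.fresh = μ.fresh) (hann : μ'.announce = μ.announce)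
    (hhead : ∀ q, q ≠ p → μ'.head q = μ.head q) (hloc : LocInv T μ' xs qs p ℓ') :
    Inv T μ' (Function.update procs p (some (m, ℓ'))) xs qs st := by
  refine ⟨hmem, ?_, ?_, ?_, ?_, ?_, ?_⟩
  · intro q m' ℓ₁ hq
    rcases update_eq_some hq with ⟨rfl, rfl, rfl⟩ | ⟨hqp, hq⟩
    · exact hloc
    · exact (H.loc q m' ℓ₁ hq).evolve hev H.mem hmem (hhead q hqp)
  · intro q hq
    by_cases hqp : q = p
    · subst hqp
      simp at hq
    · rw [Function.update_of_ne hqp] at hq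
      exact H.idle q hq
  · intro q m' ℓ₁ me' hq hn
    rcases update_eq_some hq with ⟨rfl, rfl, rfl⟩ | ⟨hqp, hq⟩
    · rw [hℓ', Option.some.injEq] at hn
      subst hn
      exact (H.node q _ ℓ me hp hℓ).evolve H.mem hev (by rw [hann])
    · exact (H.node q m' ℓ₁ me' hq hn).evolve H.mem hev (by rw [hann])
  · intro q m' m'' a' hq
    rcases update_eq_some hq with ⟨rfl, rfl, h⟩ | ⟨hqp, hq⟩
    · subst h
      cases hℓ'
    · exact H.start q m' m'' a' hq
  · intro q m' b hq
    rcases update_eq_some hq with ⟨rfl, rfl, h⟩ | ⟨hqp, hq⟩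
    · subst h
      cases hℓ'
    · exact H.done q m' b hq
  · intro x hx hx'
    rw [hfresh] at hx
    obtain ⟨q, m', ℓ₁, hq, hn⟩ := H.owner x hx hx'
    by_cases hqp : q = p
    · subst hqp
      rw [hp] at hq
      cases hq
      rw [hℓ] at hn
      exact ⟨q, m, ℓ', Function.update_self .., hℓ'.trans hn⟩
    · exact ⟨q, m', ℓ₁, by rw [Function.update_of_ne hqp, hq], hn⟩

/-- Steps that do not change the memory. -/
theorem Inv.silent (H : Inv T μ procs xs qs st) {p : Fin n} {m : M} {ℓ ℓ' : Loc n M A B T.State}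
    {me : ℕ} (hp : procs p = some (m, ℓ)) (hℓ : ℓ.node = some me) (hℓ' : ℓ'.node = some me)
    (hloc : LocInv T μ xs qs p ℓ') :
    Inv T μ (Function.update procs p (some (m, ℓ'))) xs qs st :=
  H.quiet hp hℓ hℓ' H.mem .refl rfl rfl (fun _ _ => rfl) hloc

theorem Inv.announce (H : Inv T μ procs xs qs st) {p : Fin n} {m m' : M} {a : A}
    (hp : procs p = some (m', .announce m a)) :
    Inv T (μ.announceNew p m a)
      (Function.update procs p (some (m', .scanHead μ.fresh ⟨0, p.pos⟩ tail 1))) xs qs st := by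
  obtain ⟨rfl, hst⟩ := H.start p m' m a hp
  have hmem := H.mem.announceNew p m a
  have hev := Evolves.announceNew H.mem p m a
  refine ⟨hmem, ?_, ?_, ?_, ?_, ?_, ?_⟩
  · intro q m' ℓ hq
    rcases update_eq_some hq with ⟨rfl, rfl, rfl⟩ | ⟨hqp, hq⟩
    · exact ⟨hmem.seq_eq 0 _ hmem.getElem?_zero hmem.seq_tail, Nat.one_ne_zero⟩
    · exact (H.loc q m' ℓ hq).evolve hev H.mem hmem rfl
  · intro q hq
    by_cases hqp : q = p
    · subst hqp
      simp at hq
    · rw [Function.update_of_ne hqp] at hq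
      exact H.idle q hq
  · intro q m' ℓ me hq hn
    rcases update_eq_some hq with ⟨rfl, rfl, rfl⟩ | ⟨hqp, hq⟩
    · cases hn
      refine ⟨by simp, ?_, a, by simp, .inl ⟨fun h => (H.mem.lt_fresh _ h).false, hst⟩⟩
      have := H.mem.lt_fresh _ (List.mem_of_getElem? H.mem.getElem?_zero)
      omega
    · exact (H.node q m' ℓ me hq hn).evolve H.mem hev (by simp [hqp])
  · intro q m' m'' a' hq
    rcases update_eq_some hq with ⟨rfl, rfl, h⟩ | ⟨hqp, hq⟩
    · cases h
    · exact H.start q m' m'' a' hq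
  · intro q m' b hq
    rcases update_eq_some hq with ⟨rfl, rfl, h⟩ | ⟨hqp, hq⟩
    · cases h
    · exact H.done q m' b hq
  · intro x hx hx'
    rcases Nat.lt_succ_iff_lt_or_eq.1 hx with hx | rfl
    · obtain ⟨q, m', ℓ, hq, hn⟩ := H.owner x hx hx'
      refine ⟨q, m', ℓ, ?_, hn⟩
      rw [Function.update_of_ne, hq]
      rintro rfl
      rw [hp] at hq
      cases hq
      cases hn
    · exact ⟨p, m, _, Function.update_self .., rfl⟩

/-- The replay has arrived at the state in which the operation was threaded, so by determinism the
computed result is the one recorded in the status at that time. -/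
theorem Inv.respond (H : Inv T μ procs xs qs st) (hT : T.Deterministic) {p : Fin n} {m m' : M}
    {me : ℕ} {q q' : T.State} {a : A} {b : B} (hp : procs p = some (m', .respond me q))
    (hi : (μ.heap me).invoc = some (m, a)) (hs : T.step q ⟨m, a, b⟩ q') :
    Inv T μ (Function.update procs p (some (m', .done b))) xs qs st := by
  obtain ⟨i, hme, rfl⟩ := H.loc p _ _ hp
  refine ⟨H.mem, ?_, ?_, ?_, ?_, ?_, ?_⟩
  · intro r m₁ ℓ hr
    rcases update_eq_some hr with ⟨rfl, rfl, rfl⟩ | ⟨hrp, hr⟩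
    · trivial
    · exact H.loc r m₁ ℓ hr
  · intro r hr
    by_cases hrp : r = p
    · subst hrp
      simp at hr
    · rw [Function.update_of_ne hrp] at hr
      exact H.idle r hr
  · intro r m₁ ℓ me' hr hn
    rcases update_eq_some hr with ⟨rfl, rfl, rfl⟩ | ⟨hrp, hr⟩
    · cases hn
    · exact H.node r m₁ ℓ me' hr hn
  · intro r m₁ m₂ a' hr
    rcases update_eq_some hr with ⟨rfl, rfl, h⟩ | ⟨hrp, hr⟩
    · cases h
    · exact H.start r m₁ m₂ a' hr
  · intro r m₁ b' hr
    rcases update_eq_some hr with ⟨rfl, rfl, h⟩ | ⟨hrp, hr⟩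
    · cases h
      obtain ⟨-, -, a', h1, ⟨h2, -⟩ | ⟨j, b₁, h2, h3, h4⟩⟩ := H.node r _ _ me hp rfl
      · exact absurd (List.mem_of_getElem? hme) h2
      · rw [hi] at h1
        cases h1
        have := H.mem.index_unique h2 hme
        obtain rfl : j = i := by omega
        rw [h4, (hT _ _ _ _ _ _ _ hs h3).1]
    · exact H.done r m₁ b' hr
  · intro x hx hx'
    obtain ⟨r, m₁, ℓ, hr, hn⟩ := H.owner x hx hx'
    refine ⟨r, m₁, ℓ, ?_, hn⟩
    rw [Function.update_of_ne, hr]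
    rintro rfl
    rw [hp] at hr
    cases hr
    cases hn
    exact hx' (List.mem_of_getElem? hme)

/-- A node is threaded, and the operation of its owner takes effect. -/
theorem Inv.decide (H : Inv T μ procs xs qs st) (hT : T.NonBlocking) {p : Fin n} {m : M}
    {me before s prefer : ℕ} (hp : procs p = some (m, .decide me before s prefer))
    (hdec : (μ.heap before).decideNext = none) :
    s = xs.length ∧ ∃ (q' : T.State) (r : Fin n) (m' : M) (a : A) (b : B),
      st r = .called m' a ∧ T.step (qs (xs.length - 1)) ⟨m', a, b⟩ q' ∧
      Inv T (μ.setNode before { μ.heap before with decideNext := some prefer })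
        (Function.update procs p (some (m, .writeNext me before s prefer))) (xs ++ [prefer])
        (Function.update qs xs.length q') (Function.update st r (.done m' b)) ∧
      Evolves T μ xs qs (μ.setNode before { μ.heap before with decideNext := some prefer })
        (xs ++ [prefer]) (Function.update qs xs.length q') := by
  obtain ⟨rfl, hs, hfresh, hprefer⟩ := H.loc p _ _ hp
  have hnm := hprefer hdec
  -- The operation that takes effect is that of the owner `r` of the proposed node, not necessarily
  -- that of the acting process.
  obtain ⟨r, m', ℓr, hr, hrn⟩ := H.owner prefer hfresh hnm
  obtain ⟨hra, hrt, a, hri, ⟨-, hrs⟩ | ⟨i, b, hi, -⟩⟩ := H.node r m' ℓr prefer hr hrn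
  swap
  · exact absurd (List.mem_of_getElem? hi) hnm
  obtain ⟨b, q', hstep⟩ := hT (qs (xs.length - 1)) m' a
  have hseq := H.mem.seq_head p
  -- An undecided `head[p]` is the last node of the list, so its number is the length of the list.
  have hlen : s = xs.length := by
    obtain ⟨i, hi, hi'⟩ := H.mem.exists_index hseq
    rw [H.mem.decideNext_eq i _ hi, List.getElem?_eq_none_iff] at hdec
    have := lt_length_of_getElem? hi
    omega
  subst hlen
  have hmem := H.mem.decide hseq hs rfl hfresh hnm hri hstep
  have hev : Evolves T μ xs qs _ _ _ := Evolves.decide (y := prefer) hdec rfl q'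
  have hpos := H.mem.length_pos
  have hin := setNode_heap_congr Node.invoc (μ := μ) (x := μ.head p)
    (v := { μ.heap (μ.head p) with decideNext := some prefer }) rfl
  refine ⟨rfl, q', r, m', a, b, hrs, hstep, ⟨hmem, ?_, ?_, ?_, ?_, ?_, ?_⟩, hev⟩
  · intro q m₁ ℓ hq
    rcases update_eq_some hq with ⟨rfl, rfl, rfl⟩ | ⟨hqp, hq⟩
    · exact ⟨rfl, by simpa using hs, by simp⟩
    · exact (H.loc q m₁ ℓ hq).evolve hev H.mem hmem rfl
  · intro q hq
    by_cases hqp : q = p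
    · subst hqp
      simp at hq
    · rw [Function.update_of_ne hqp] at hq
      rw [Function.update_of_ne]
      · exact H.idle q hq
      · rintro rfl
        rw [hq] at hr
        cases hr
  · have key : ∀ q m₁ ℓ me₁, procs q = some (m₁, ℓ) → ℓ.node = some me₁ →
        NodeInv T (μ.setNode (μ.head p) { μ.heap (μ.head p) with decideNext := some prefer })
          (xs ++ [prefer]) (Function.update qs xs.length q') q m₁ me₁
          (Function.update st r (.done m' b) q) := by
      intro q m₁ ℓ me₁ hq hn
      obtain ⟨h1, h2, a₁, h3, h4⟩ := H.node q m₁ ℓ me₁ hq hn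
      refine ⟨h1, h2, a₁, (hin _).trans h3, ?_⟩
      by_cases hqr : q = r
      · subst hqr
        rw [hr] at hq
        cases hq
        obtain rfl : prefer = me₁ := hra.symm.trans h1
        rw [hri] at h3
        cases h3
        refine .inr ⟨xs.length - 1, b, ?_, ?_, Function.update_self ..⟩
        · rw [Nat.sub_add_cancel hpos]
          simp
        · rw [Nat.sub_add_cancel hpos, Function.update_self, Function.update_of_ne (by omega)]
          exact hstep
      · rw [Function.update_of_ne hqr]
        rcases h4 with ⟨h4, h5⟩ | ⟨i, b', h4, h5, h6⟩
        · refine .inl ⟨fun h => ?_, h5⟩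
          rcases List.mem_append.1 h with h | h
          · exact h4 h
          · rw [List.mem_singleton] at h
            -- Announced nodes of different processes differ, except for the sentinel; so no
            -- operation other than that of `r` is affected.
            rcases H.mem.announce_inj q r (by rw [h1, h, hra]) with h' | h'
            · exact hqr h'
            · exact h2 (h1 ▸ h')
        · have := lt_length_of_getElem? h4
          refine .inr ⟨i, b', hev.getElem? h4, ?_, h6⟩
          rwa [Function.update_of_ne (by omega), Function.update_of_ne (by omega)]
    intro q m₁ ℓ me₁ hq hn
    rcases update_eq_some hq with ⟨rfl, rfl, rfl⟩ | ⟨hqp, hq⟩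
    · exact key q _ _ me₁ hp hn
    · exact key q _ _ me₁ hq hn
  · intro q m₁ m₂ a' hq
    rcases update_eq_some hq with ⟨rfl, rfl, h⟩ | ⟨hqp, hq⟩
    · cases h
    · rw [Function.update_of_ne]
      · exact H.start q m₁ m₂ a' hq
      · rintro rfl
        rw [hr] at hq
        cases hq
        cases hrn
  · intro q m₁ b' hq
    rcases update_eq_some hq with ⟨rfl, rfl, h⟩ | ⟨hqp, hq⟩
    · cases h
    · rw [Function.update_of_ne]
      · exact H.done q m₁ b' hq
      · rintro rfl
        rw [hr] at hq
        cases hq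
        cases hrn
  · intro x hx hx'
    obtain ⟨q, m₁, ℓ, hq, hn⟩ := H.owner x hx fun h => hx' (List.mem_append_left _ h)
    by_cases hqp : q = p
    · subst hqp
      rw [hp] at hq
      cases hq
      exact ⟨q, m, _, Function.update_self .., hn⟩
    · exact ⟨q, m₁, ℓ, by rw [Function.update_of_ne hqp, hq], hn⟩

end Universal

/-! ### Steps of the construction and their effect on the list. -/

namespace Universal

variable {n : ℕ} {M A B : Type u} {T : SeqLTS M A B} {μ μ' : Mem n M A}
  {procs : Fin n → Option (M × Loc n M A B T.State)} {xs xs' : List ℕ} {qs qs' : ℕ → T.State}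
  {st : Fin n → OpStatus M A B}

theorem node_scanNext {Q : Type u} (me : ℕ) (k : Fin n) (best s : ℕ) :
    (scanNext me k best s : Loc n M A B Q).node = some me := by
  unfold scanNext
  split_ifs <;> rfl

theorem LocInv.scanNext {p : Fin n} {best s : ℕ} (h : (μ.heap best).seq = s) (hs : s ≠ 0)
    (me : ℕ) (k : Fin n) : LocInv T μ xs qs p (scanNext me k best s) := by
  unfold Universal.scanNext
  split_ifs
  · exact ⟨h, hs⟩
  · change (μ.heap best).seq ≠ 0
    rwa [h]

/-- If `x` is numbered and last, the whole list is numbered. Hence a test `seq = 0` certifies that a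
node is unthreaded as long as the own head remains undecided. -/
theorem MemInv.not_mem_of_seq_eq_zero (H : MemInv T μ xs qs) {x y : ℕ}
    (hx : (μ.heap x).seq ≠ 0) (hy : (μ.heap y).seq = 0) :
    (μ.heap x).decideNext = none → y ∉ xs := by
  intro hd hm
  obtain ⟨i, hi, -⟩ := H.exists_index hx
  obtain ⟨j, hj⟩ := List.mem_iff_getElem?.1 hm
  rw [H.decideNext_eq i x hi, List.getElem?_eq_none_iff] at hd
  have := lt_length_of_getElem? hj
  exact H.seq_ne_zero_of_le hj hi (by omega) hx hy

/-- The effect of a step from the local state `ℓ` on the list of the threaded nodes, on the states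
of the sequential object and on the status of the processes. -/
def ListStep (T : SeqLTS M A B) (ℓ : Loc n M A B T.State) (xs : List ℕ) (qs : ℕ → T.State)
    (st : Fin n → OpStatus M A B) (xs' : List ℕ) (qs' : ℕ → T.State)
    (st' : Fin n → OpStatus M A B) : Prop :=
  (xs' = xs ∧ qs' = qs ∧ st' = st) ∨
    ∃ me before s prefer q' r m a b, ℓ = .decide me before s prefer ∧
      s = xs.length ∧ st r = .called m a ∧ T.step (qs (xs.length - 1)) ⟨m, a, b⟩ q' ∧
      xs' = xs ++ [prefer] ∧ qs' = Function.update qs xs.length q' ∧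
      st' = Function.update st r (.done m b)

/-- Each step of the universal construction either leaves the list of the threaded nodes
unchanged or makes one operation take effect. -/
theorem Inv.step (H : Inv T μ procs xs qs st) (hdet : T.Deterministic) (hnb : T.NonBlocking)
    {p : Fin n} {m : M} {ℓ ℓ' : Loc n M A B T.State} (hp : procs p = some (m, ℓ))
    (hs : Step T p ℓ μ ℓ' μ') :
    ∃ xs' qs' st', Inv T μ' (Function.update procs p (some (m, ℓ'))) xs' qs' st' ∧
      Evolves T μ xs qs μ' xs' qs' ∧ ListStep T ℓ xs qs st xs' qs' st' := by
  have hloc := H.loc p m ℓ hp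
  have hhd := H.mem.seq_head p
  have of_same : Inv T μ' (Function.update procs p (some (m, ℓ'))) xs qs st →
      Evolves T μ xs qs μ' xs qs →
      ∃ xs' qs' st', Inv T μ' (Function.update procs p (some (m, ℓ'))) xs' qs' st' ∧
        Evolves T μ xs qs μ' xs' qs' ∧ ListStep T ℓ xs qs st xs' qs' st' :=
    fun h h' => ⟨xs, qs, st, h, h', .inl ⟨rfl, rfl, rfl⟩⟩
  have of_silent : ∀ me, μ' = μ → ℓ.node = some me → ℓ'.node = some me →
      LocInv T μ xs qs p ℓ' →
      ∃ xs' qs' st', Inv T μ' (Function.update procs p (some (m, ℓ'))) xs' qs' st' ∧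
        Evolves T μ xs qs μ' xs' qs' ∧ ListStep T ℓ xs qs st xs' qs' st' := by
    rintro me rfl h1 h2 h3
    exact of_same (H.silent hp h1 h2 h3) .refl
  cases hs with
  | announce _ m a => exact of_same (H.announce hp) (Evolves.announceNew H.mem p m a)
  | scanHead _ me k best bestSeq =>
    exact of_silent me rfl rfl rfl ⟨H.mem.seq_head k, hloc.1, hloc.2⟩
  | scanSeq_better _ me k cand best bestSeq h =>
    exact of_silent me rfl rfl (node_scanNext ..) (LocInv.scanNext rfl (by omega) me k)
  | scanSeq_worse _ me k cand best bestSeq h =>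
    exact of_silent me rfl rfl (node_scanNext ..) (LocInv.scanNext hloc.2.1 hloc.2.2 me k)
  | writeMax _ me best =>
    exact of_same (H.quiet hp rfl (me := me) rfl (H.mem.setHead p hloc) (Evolves.setHead p best)
      rfl rfl (fun q hq => by simp [hq]) trivial) (Evolves.setHead p best)
  | test_enter _ me h =>
    exact of_silent me rfl rfl rfl (H.mem.not_mem_of_seq_eq_zero hhd h)
  | test_exit _ me h => exact of_silent me rfl rfl rfl h
  | readHead _ me => exact of_silent me rfl rfl rfl ⟨rfl, hloc⟩
  | readSeq _ me before =>
    obtain ⟨rfl, h⟩ := hloc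
    exact of_silent me rfl rfl rfl ⟨rfl, rfl, h⟩
  | readHelp _ me before s =>
    obtain ⟨rfl, h1, h2⟩ := hloc
    exact of_silent me rfl rfl rfl ⟨rfl, h1, H.mem.announce_lt _, h2⟩
  | testHelp_help _ me before s help h =>
    obtain ⟨rfl, h1, h2, h3⟩ := hloc
    exact of_silent me rfl rfl rfl ⟨rfl, h1, h2, H.mem.not_mem_of_seq_eq_zero hhd h⟩
  | testHelp_self _ me before s help h =>
    obtain ⟨rfl, h1, h2, h3⟩ := hloc
    refine of_silent me rfl rfl rfl ⟨rfl, h1, ?_, h3⟩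
    obtain ⟨h4, -⟩ := H.node p m _ me hp rfl
    exact h4 ▸ H.mem.announce_lt p
  | decide_first _ me before s prefer h =>
    obtain ⟨h1, q', r, m', a, b, h2, h3, h4, h5⟩ := H.decide hnb hp h
    exact ⟨_, _, _, h4, h5, .inr ⟨me, before, s, prefer, q', r, m', a, b, rfl, h1, h2, h3, rfl,
      rfl, rfl⟩⟩
  | decide_later _ me before s prefer y h =>
    obtain ⟨rfl, h1, h2, h3⟩ := hloc
    exact of_silent me rfl rfl rfl ⟨rfl, h1, h⟩
  | writeNext _ me before s y =>
    obtain ⟨rfl, h1, h2⟩ := hloc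
    have hev := Evolves.setNext (qs := qs) H.mem h2
    refine of_same (H.quiet hp rfl (me := me) rfl (H.mem.setNext h2) hev rfl rfl
      (fun q hq => rfl) ⟨?_, ?_, ?_⟩) hev
    · simpa using h1
    · simpa using h2
    · simp
  | writeSeq _ me s y =>
    obtain ⟨h1, h2, h3⟩ := hloc
    have hev := Evolves.setSeq (qs := qs) H.mem hhd h1 h2
    refine of_same (H.quiet hp rfl (me := me) rfl (H.mem.setSeq hhd h1 h2 h3) hev rfl rfl
      (fun q hq => rfl) ?_) hev
    have := hev.seq _ hhd
    rw [← h1] at this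
    simp only [LocInv, setNode_head]
    rw [this, setNode_heap, if_pos rfl]
  | writeHead _ me y =>
    have hy : (μ.heap y).seq ≠ 0 := by
      have : (μ.heap y).seq = _ := hloc
      omega
    exact of_same (H.quiet hp rfl (me := me) rfl (H.mem.setHead p hy) (Evolves.setHead p y)
      rfl rfl (fun q hq => by simp [hq]) trivial) (Evolves.setHead p y)
  | replayFirst _ me =>
    obtain ⟨i, hi, hi'⟩ := H.mem.exists_index hloc
    obtain ⟨-, ht, -⟩ := H.node p m _ me hp rfl
    -- The own node is not the sentinel, so the list has an element at index `1`; it is numbered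
    -- since the own node is, and hence `tail.next` is set.
    have hi0 : i ≠ 0 := by
      rintro rfl
      rw [H.mem.getElem?_zero, Option.some.injEq] at hi
      exact ht hi.symm
    have hlt := lt_length_of_getElem? hi
    have h1 : xs[0 + 1]? = some xs[1] := List.getElem?_eq_getElem (by omega)
    refine of_silent me rfl rfl rfl ⟨hloc, 0, xs[1], ?_, h1, H.mem.qs_zero.symm, by omega⟩
    exact H.mem.next_eq 0 _ _ H.mem.getElem?_zero h1
      (H.mem.seq_ne_zero_of_le h1 hi (by omega) hloc)
  | replay_apply _ me current q q' m₁ a b hne hin hst =>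
    obtain ⟨h0, i, x, hx, hi, rfl, hle⟩ := hloc
    cases hx
    obtain ⟨j, hj, hj'⟩ := H.mem.exists_index h0
    -- The own node lies strictly beyond the current one, so the link to follow exists.
    have hij : j ≠ i + 1 := by
      rintro rfl
      rw [hi, Option.some.injEq] at hj
      exact hne hj
    have hlt := lt_length_of_getElem? hj
    have h1 : xs[i + 1 + 1]? = some xs[i + 1 + 1] := List.getElem?_eq_getElem (by omega)
    refine of_silent me rfl rfl rfl ⟨h0, i + 1, xs[i + 1 + 1], ?_, h1, ?_, by omega⟩
    · exact H.mem.next_eq _ _ _ hi h1 (H.mem.seq_ne_zero_of_le h1 hj (by omega) h0)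
    · obtain ⟨m₂, a₂, b₂, h2, h3⟩ := H.mem.step i _ hi
      rw [hin] at h2
      cases h2
      exact (hdet _ _ _ _ _ _ _ hst h3).2
  | replay_exit _ me q =>
    obtain ⟨h0, i, x, hx, hi, rfl, hle⟩ := hloc
    cases hx
    exact of_same (H.quiet hp rfl (me := me) rfl (H.mem.setHead p h0) (Evolves.setHead p me)
      rfl rfl (fun q hq => by simp [hq]) ⟨i, hi, rfl⟩) (Evolves.setHead p me)
  | respond _ me q q' m₁ a b hin hst => exact of_same (H.respond hdet hp hin hst) .refl
  | fault_null _ me q =>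
    obtain ⟨-, i, x, hx, -⟩ := hloc
    cases hx
  | fault_replay _ me current q hne hin =>
    obtain ⟨-, i, x, hx, hi, -⟩ := hloc
    cases hx
    obtain ⟨m₂, a₂, b₂, h2, -⟩ := H.mem.step i _ hi
    rw [hin] at h2
    cases h2
  | fault_respond _ me q hin =>
    obtain ⟨-, -, a, h1, -⟩ := H.node p m _ me hp rfl
    rw [hin] at h1
    cases h1

/-- The only internal steps matched by an effect are first decisions of a consensus object. The
sentinel carries no operation, so the atomic state is that after `xs.length - 1` operations. -/
theorem universalObject_sim_atomic (hdet : T.Deterministic) (hnb : T.NonBlocking) :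
    (universalObject n T hnb).sem.Sim (T.atomic n) := by
  refine ⟨fun C D => ∃ xs qs, Inv T C.mem C.procs xs qs D.status ∧
    D.state = qs (xs.length - 1), ⟨_, _, Inv.initial T, rfl⟩, ?_⟩
  rintro C ⟨q, st⟩ x C' ⟨xs, qs, H, hq⟩ hx
  cases hx with
  | call p m a hp =>
    have hst : st p = .idle := H.idle p hp
    exact ⟨[Label.vis (ObjAction.call p m a)], ⟨q, _⟩, .single (.call q st p m a hst), rfl,
      xs, qs, H.call hp m a, hq⟩
  | ret p m ℓ b hp hr =>
    have hℓ : ℓ = .done b := by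
      cases ℓ <;> cases hr
      rfl
    subst hℓ
    have hst : st p = .done m b := H.done p m b hp
    exact ⟨[Label.vis (ObjAction.ret p m b)], ⟨q, _⟩, .single (.ret q st p m b hst), rfl,
      xs, qs, H.ret hp, hq⟩
  | internal p m ℓ ℓ' c μ' hp hr hs =>
    obtain ⟨xs', qs', st', H', -, ⟨rfl, rfl, rfl⟩ | ⟨me, before, s, prefer, q', r, m', a, b, -, -,
      h1, h2, rfl, rfl, rfl⟩⟩ := H.step hdet hnb hp hs
    · exact ⟨[], ⟨q, st'⟩, .nil _, rfl, _, _, H', hq⟩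
    · change q = _ at hq
      subst hq
      refine ⟨[Label.internal r PUnit.unit], ⟨q', _⟩, .single (.effect _ q' st r m' a b h1 h2),
        rfl, _, _, H', ?_⟩
      rw [List.length_append, List.length_singleton, Nat.add_sub_cancel, Function.update_self]

end Universal

/-! ### The universal construction is wait-free -/

namespace Universal

variable {n : ℕ} {M A B : Type u} {T : SeqLTS M A B} {μ μ' : Mem n M A}
  {procs : Fin n → Option (M × Loc n M A B T.State)} {xs xs' : List ℕ} {qs qs' : ℕ → T.State}
  {st st' : Fin n → OpStatus M A B}

theorem Step.head_eq {p : Fin n} {ℓ ℓ' : Loc n M A B T.State} (hs : Step T p ℓ μ ℓ' μ')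
    {q : Fin n} (hq : q ≠ p) : μ'.head q = μ.head q := by
  cases hs <;> simp [hq]

theorem Step.announce_eq {p : Fin n} {ℓ ℓ' : Loc n M A B T.State} (hs : Step T p ℓ μ ℓ' μ')
    {q : Fin n} (hq : q ≠ p ∨ ℓ.node ≠ none) : μ'.announce q = μ.announce q := by
  cases hs <;> first | rfl | skip
  rcases hq with hq | hq
  · simp [hq]
  · exact absurd rfl hq

theorem Step.node_eq {p : Fin n} {ℓ ℓ' : Loc n M A B T.State} (hs : Step T p ℓ μ ℓ' μ')
    {me : ℕ} (hℓ : ℓ.node = some me) : ℓ'.node = some me ∨ ∃ b, ℓ' = .done b := by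
  cases hs with
  | announce => cases hℓ
  | respond => exact .inr ⟨_, rfl⟩
  | scanSeq_better => exact .inl ((node_scanNext ..).trans hℓ)
  | scanSeq_worse => exact .inl ((node_scanNext ..).trans hℓ)
  | _ => exact .inl hℓ

/-- If the local state is about to propose a successor of the node with sequence number `K`, then
it proposes `me`. -/
def Loc.Proposes {Q : Type u} (me K : ℕ) : Loc n M A B Q → Prop
  | .testHelp _ _ s help => s = K → help = me
  | .decide _ _ s prefer => s = K → prefer = me
  | _ => True

/-- The node `me` of process `p` will be the successor of the node with sequence number `K`,
unless it is threaded earlier. -/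
structure HelpInv (T : SeqLTS M A B) (μ : Mem n M A)
    (procs : Fin n → Option (M × Loc n M A B T.State)) (xs : List ℕ) (p : Fin n) (me K : ℕ) :
    Prop where
  announce_eq : μ.announce p = me
  threaded : K < xs.length → ∃ i, i ≤ K ∧ xs[i]? = some me
  proposes : (μ.heap me).seq = 0 → ∀ r m ℓ, procs r = some (m, ℓ) → ℓ.Proposes me K

theorem proposes_scanNext {Q : Type u} (me K x : ℕ) (k : Fin n) (best s : ℕ) :
    (scanNext x k best s : Loc n M A B Q).Proposes me K := by
  unfold scanNext
  split_ifs <;> trivial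

/-- The congruence for `K` directs every process that has read the number `K` to `announce[p]`.
Until `me` is numbered it passes the test there, and so it is the only candidate for index `K`. -/
theorem HelpInv.step {p r : Fin n} {me K : ℕ} {m : M} {ℓ ℓ' : Loc n M A B T.State}
    (h : HelpInv T μ procs xs p me K) (H : MemInv T μ xs qs) (hK : (K + 1) % n = p.val)
    (hr : procs r = some (m, ℓ)) (hs : Step T r ℓ μ ℓ' μ') (hp : p ≠ r ∨ ℓ.node ≠ none)
    (hev : Evolves T μ xs qs μ' xs' qs') (hl : ListStep T ℓ xs qs st xs' qs' st') :
    HelpInv T μ' (Function.update procs r (some (m, ℓ'))) xs' p me K := by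
  refine ⟨(hs.announce_eq hp).trans h.announce_eq, ?_, ?_⟩
  · rcases hl with ⟨rfl, -, -⟩ | ⟨me', before, s, prefer, q', r', m', a, b, rfl, hlen, -, -, rfl,
      -, -⟩
    · exact h.threaded
    · intro hlt
      rw [List.length_append, List.length_singleton] at hlt
      by_cases hlt' : K < xs.length
      · obtain ⟨i, hi, hi'⟩ := h.threaded hlt'
        exact ⟨i, hi, hev.getElem? hi'⟩
      · have hKx : K = xs.length := by omega
        -- The list grows exactly at index `K`. Either `me` is the node proposed, or `me` has a
        -- number and is already in the list.
        by_cases h0 : (μ.heap me).seq = 0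
        · have : prefer = me := h.proposes h0 r m _ hr (hlen.trans hKx.symm)
          exact ⟨K, le_rfl, by rw [this, hKx]; simp⟩
        · obtain ⟨i, hi, -⟩ := H.exists_index h0
          have := lt_length_of_getElem? hi
          exact ⟨i, by omega, hev.getElem? hi⟩
  · intro h0
    have h0' : (μ.heap me).seq = 0 := by
      by_contra hne
      exact hne ((hev.seq me hne).symm.trans h0)
    intro r' m' ℓ₁ hr'
    rcases update_eq_some hr' with ⟨rfl, rfl, rfl⟩ | ⟨-, hr'⟩
    · have hprop := h.proposes h0' _ _ _ hr
      cases hs with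
      | readHelp _ me' before s =>
        rintro rfl
        have : helpIndex r' (s + 1) = p := Fin.ext hK
        rw [this, h.announce_eq]
      | testHelp_help => exact hprop
      | testHelp_self _ me' before s help hne =>
        intro hsK
        rw [hprop hsK] at hne
        exact absurd h0' hne
      | scanSeq_better => exact proposes_scanNext ..
      | scanSeq_worse => exact proposes_scanNext ..
      | _ => trivial
    · exact h.proposes h0' r' m' ℓ₁ hr'

/-- A number above `K` belongs to a node at index `K` or later. Then `me` is threaded no later than
that node and would be numbered too. This bounds the iterations of the main loop. -/
theorem HelpInv.seq_le {p : Fin n} {me K x : ℕ} (h : HelpInv T μ procs xs p me K)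
    (H : MemInv T μ xs qs) (h0 : (μ.heap me).seq = 0) : (μ.heap x).seq ≤ K := by
  by_cases hx : (μ.heap x).seq = 0
  · omega
  obtain ⟨i, hi, hi'⟩ := H.exists_index hx
  by_contra hlt
  have := lt_length_of_getElem? hi
  obtain ⟨j, hj, hj'⟩ := h.threaded (by omega)
  exact H.seq_ne_zero_of_le hj' hi (by omega) hx h0

theorem HelpInv.seq_me_le {p : Fin n} {me K : ℕ} (h : HelpInv T μ procs xs p me K)
    (H : MemInv T μ xs qs) : (μ.heap me).seq ≤ K + 1 := by
  by_cases hx : (μ.heap me).seq = 0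
  · omega
  obtain ⟨i, hi, hi'⟩ := H.exists_index hx
  by_contra hlt
  have := lt_length_of_getElem? hi
  obtain ⟨j, hj, hj'⟩ := h.threaded (by omega)
  have := H.index_unique hi hj'
  omega

/-- The body of the main loop. -/
def Loc.InLoop {Q : Type u} : Loc n M A B Q → Prop
  | .readHead _ => True
  | .readSeq _ _ => True
  | .readHelp _ _ _ => True
  | .testHelp _ _ _ _ => True
  | .decide _ _ _ _ => True
  | .writeNext _ _ _ _ => True
  | .writeSeq _ _ _ => True
  | .writeHead _ _ => True
  | _ => False

/-- A bound for the number of steps until process `p` returns. -/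
def remaining {Q : Type u} (μ : Mem n M A) (p : Fin n) (K : ℕ) : Loc n M A B Q → ℕ
  -- The state `announce` is excluded in `RemainingLe`, so its value is immaterial. The summand `K +
  -- 5` covers the exit from the loop and the replay. An iteration has nine steps, is charged ten,
  -- starts with the number of `head[p]` at most `K` and raises it by one. Each scanned entry costs
  -- two steps.
  | .announce _ _ => 0
  | .scanHead _ k _ _ => (K + 5) + 10 * (K + 3) + 2 * (n - k) + 1
  | .scanSeq _ k _ _ _ => (K + 5) + 10 * (K + 3) + 2 * (n - k)
  | .writeMax _ _ => (K + 5) + 10 * (K + 3)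
  | .test _ => (K + 5) + 10 * (K + 2 - (μ.heap (μ.head p)).seq)
  | .readHead _ => (K + 5) + 10 * (K + 1 - (μ.heap (μ.head p)).seq) + 9
  | .readSeq _ _ => (K + 5) + 10 * (K + 1 - (μ.heap (μ.head p)).seq) + 8
  | .readHelp _ _ _ => (K + 5) + 10 * (K + 1 - (μ.heap (μ.head p)).seq) + 7
  | .testHelp _ _ _ _ => (K + 5) + 10 * (K + 1 - (μ.heap (μ.head p)).seq) + 6
  | .decide _ _ _ _ => (K + 5) + 10 * (K + 1 - (μ.heap (μ.head p)).seq) + 5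
  | .writeNext _ _ _ _ => (K + 5) + 10 * (K + 1 - (μ.heap (μ.head p)).seq) + 4
  | .writeSeq _ _ _ => (K + 5) + 10 * (K + 1 - (μ.heap (μ.head p)).seq) + 3
  | .writeHead _ _ => (K + 5) + 10 * (K + 1 - (μ.heap (μ.head p)).seq) + 2
  | .replayFirst _ => K + 4
  | .replay me _ (some x) => (μ.heap me).seq - (μ.heap x).seq + 2
  | .replay _ _ none => 0
  | .respond _ _ => 1
  | .done _ => 0

theorem MemInv.seq_of_replay (H : MemInv T μ xs qs) {me i x : ℕ} (h0 : (μ.heap me).seq ≠ 0)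
    (hi : xs[i + 1]? = some x) (hle : i + 2 ≤ (μ.heap me).seq) : (μ.heap x).seq = i + 2 := by
  obtain ⟨j, hj, hj'⟩ := H.exists_index h0
  exact H.seq_eq _ _ hi (H.seq_ne_zero_of_le hi hj (by omega) h0)

/-- The bound depends only on `head[p]` and on numbers already assigned, which other processes
cannot change. -/
theorem remaining_evolve (H : MemInv T μ xs qs) (hev : Evolves T μ xs qs μ' xs' qs')
    {p : Fin n} (hhead : μ'.head p = μ.head p) (K : ℕ) {ℓ : Loc n M A B T.State}
    (hℓ : LocInv T μ xs qs p ℓ) : remaining μ' p K ℓ = remaining μ p K ℓ := by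
  have hseq := hev.seq _ (H.seq_head p)
  cases ℓ with
  | replay me q cur =>
    obtain ⟨h0, i, x, rfl, h2, -, h4⟩ := hℓ
    have hx := H.seq_of_replay h0 h2 h4
    simp only [remaining]
    rw [hev.seq me h0, hev.seq x (by omega)]
  | _ => simp only [remaining, hhead, hseq]

theorem remaining_scanNext {Q : Type u} (μ : Mem n M A) (p : Fin n) (K me : ℕ) (k : Fin n)
    (best s : ℕ) : remaining μ p K (scanNext me k best s : Loc n M A B Q) <
      (K + 5) + 10 * (K + 3) + 2 * (n - k) := by
  unfold scanNext
  have := k.isLt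
  split_ifs <;> simp only [remaining] <;> omega

theorem not_inLoop_scanNext {Q : Type u} (me : ℕ) (k : Fin n) (best s : ℕ) :
    ¬ (scanNext me k best s : Loc n M A B Q).InLoop := by
  unfold scanNext
  split_ifs <;> exact id

/-- Each step of process `p` makes progress. -/
theorem remaining_step {p : Fin n} {me K : ℕ} {ℓ ℓ' : Loc n M A B T.State}
    (h : HelpInv T μ procs xs p me K) (H : MemInv T μ xs qs) (H' : MemInv T μ' xs' qs')
    (hℓ : LocInv T μ xs qs p ℓ) (hℓ' : LocInv T μ' xs' qs' p ℓ') (hnode : ℓ.node = some me)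
    (hloop : ℓ.InLoop → (μ.heap (μ.head p)).seq ≤ K) (hev : Evolves T μ xs qs μ' xs' qs')
    (hs : Step T p ℓ μ ℓ' μ') :
    (ℓ'.InLoop → (μ'.heap (μ'.head p)).seq ≤ K) ∧ remaining μ' p K ℓ' < remaining μ p K ℓ := by
  have hseq := hev.seq _ (H.seq_head p)
  cases hs with
  | announce => cases hnode
  | scanHead => exact ⟨False.elim, by simp only [remaining]; omega⟩
  | scanSeq_better =>
    exact ⟨fun hl => (not_inLoop_scanNext _ _ _ _ hl).elim, remaining_scanNext ..⟩
  | scanSeq_worse =>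
    exact ⟨fun hl => (not_inLoop_scanNext _ _ _ _ hl).elim, remaining_scanNext ..⟩
  | writeMax _ _ best => exact ⟨False.elim, by simp only [remaining]; omega⟩
  | test_enter _ _ h0 =>
    cases hnode
    have := h.seq_le (x := μ.head p) H h0
    exact ⟨fun _ => this, by simp only [remaining]; omega⟩
  | test_exit => exact ⟨False.elim, by simp only [remaining]; omega⟩
  | readHead => exact ⟨fun _ => hloop trivial, by simp only [remaining]; omega⟩
  | readSeq => exact ⟨fun _ => hloop trivial, by simp only [remaining]; omega⟩
  | readHelp => exact ⟨fun _ => hloop trivial, by simp only [remaining]; omega⟩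
  | testHelp_help => exact ⟨fun _ => hloop trivial, by simp only [remaining]; omega⟩
  | testHelp_self => exact ⟨fun _ => hloop trivial, by simp only [remaining]; omega⟩
  | decide_first =>
    simp only [remaining, setNode_head, hseq]
    exact ⟨fun _ => hloop trivial, by omega⟩
  | decide_later => exact ⟨fun _ => hloop trivial, by simp only [remaining]; omega⟩
  | writeNext =>
    simp only [remaining, setNode_head, hseq]
    exact ⟨fun _ => hloop trivial, by omega⟩
  | writeSeq =>
    simp only [remaining, setNode_head, hseq]
    exact ⟨fun _ => hloop trivial, by omega⟩
  | writeHead _ _ y =>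
    have hle := hloop trivial
    have hy : (μ.heap y).seq = (μ.heap (μ.head p)).seq + 1 := hℓ
    refine ⟨False.elim, ?_⟩
    simp only [remaining, setHead_head, setHead_heap, if_true, hy]
    omega
  | replayFirst =>
    cases hnode
    obtain ⟨-, i, x, hx, -⟩ := hℓ'
    have := h.seq_me_le H
    refine ⟨False.elim, ?_⟩
    rw [hx]
    simp only [remaining]
    omega
  | replay_apply _ _ current q q' m a b hne =>
    cases hnode
    obtain ⟨h0, i, x, hx, hi, -, hle⟩ := hℓ
    cases hx
    obtain ⟨-, j, y, hy, hj, -, hle'⟩ := hℓ'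
    have h1 := H.seq_of_replay h0 hi hle
    have h2 := H'.seq_of_replay h0 hj hle'
    -- Following `next` advances the index, and hence the number, by exactly one.
    have h3 := H.seq_eq _ _ (H.getElem?_succ (by omega) rfl (H.decideNext_of_next _ _ hy)).2
      (by omega)
    refine ⟨False.elim, ?_⟩
    rw [hy]
    simp only [remaining]
    omega
  | replay_exit => exact ⟨False.elim, by simp only [remaining]; omega⟩
  | respond => exact ⟨False.elim, by simp only [remaining]; omega⟩
  | fault_null =>
    obtain ⟨-, i, x, hx, -⟩ := hℓ
    cases hx
  | fault_replay _ _ current q hne hin =>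
    obtain ⟨-, i, x, hx, hi, -⟩ := hℓ
    cases hx
    obtain ⟨m₂, a₂, b₂, h2, -⟩ := H.step i _ hi
    rw [hin] at h2
    cases h2
  | fault_respond _ _ q hin =>
    obtain ⟨i, hi, -⟩ := hℓ
    obtain ⟨m₂, a₂, b₂, h2, -⟩ := H.step i _ hi
    rw [hin] at h2
    cases h2

/-- Process `p` executes an operation with node `me`, and takes at most `v` further steps until it
returns. -/
def RemainingLe (T : SeqLTS M A B) (p : Fin n) (me K v : ℕ) (μ : Mem n M A)
    (procs : Fin n → Option (M × Loc n M A B T.State)) : Prop :=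
  ∃ xs qs st m ℓ, Inv T μ procs xs qs st ∧ HelpInv T μ procs xs p me K ∧
    procs p = some (m, ℓ) ∧ (ℓ.node = some me ∨ ∃ b, ℓ = .done b) ∧
    (ℓ.InLoop → (μ.heap (μ.head p)).seq ≤ K) ∧ remaining μ p K ℓ ≤ v

/-- The bound never grows, and it drops whenever `p` itself acts; infinitely many actions of `p`
without a return are therefore impossible. -/
theorem RemainingLe.step {p : Fin n} {me K v : ℕ} (hdet : T.Deterministic)
    (hnb : T.NonBlocking) (hK : (K + 1) % n = p.val)
    {C C' : (universalObject n T hnb).Config}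
    {x : Label n M A B (universalObject n T hnb).Cmd}
    (h : RemainingLe T p me K v C.mem C.procs) (hx : (universalObject n T hnb).Trans C x C')
    (hret : ¬ x.IsRetOf p) :
    ∃ v', RemainingLe T p me K v' C'.mem C'.procs ∧ v' ≤ v ∧ (x.proc = p → v' < v) := by
  obtain ⟨xs, qs, st, m, ℓ, H, hh, hp, hn, hl, hv⟩ := h
  cases hx with
  | call q m' a hq =>
    have hqp : p ≠ q := by
      rintro rfl
      rw [hp] at hq
      cases hq
    refine ⟨v, ⟨xs, qs, _, m, ℓ, H.call hq m' a, ⟨hh.announce_eq, hh.threaded, ?_⟩, ?_, hn, hl,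
      hv⟩, le_rfl, fun h => absurd h.symm hqp⟩
    · intro h0 r m₁ ℓ₁ hr
      rcases update_eq_some hr with ⟨rfl, rfl, rfl⟩ | ⟨-, hr⟩
      · trivial
      · exact hh.proposes h0 r m₁ ℓ₁ hr
    · exact (Function.update_of_ne hqp _ _).trans hp
  | ret q m' ℓ' b hq hr =>
    have hqp : p ≠ q := by
      rintro rfl
      exact hret ⟨m', b, rfl⟩
    have hℓ' : ℓ' = .done b := by
      cases ℓ' <;> cases hr
      rfl
    subst hℓ'
    refine ⟨v, ⟨xs, qs, _, m, ℓ, H.ret hq, ⟨hh.announce_eq, hh.threaded, ?_⟩, ?_, hn, hl,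
      hv⟩, le_rfl, fun h => absurd h.symm hqp⟩
    · intro h0 r m₁ ℓ₁ hr
      exact hh.proposes h0 r m₁ ℓ₁ (update_none_eq_some hr).2
    · exact (Function.update_of_ne hqp _ _).trans hp
  | internal q m' ℓ₁ ℓ₁' c μ' hq hr hs =>
    change Step T q ℓ₁ C.mem ℓ₁' μ' at hs
    obtain ⟨xs', qs', st', H', hev, hlist⟩ := H.step hdet hnb hq hs
    by_cases hqp : p = q
    · subst hqp
      rw [hp] at hq
      cases hq
      rcases hn with hn | ⟨b, rfl⟩
      · have hnn : ℓ.node ≠ none := by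
          rw [hn]
          exact Option.some_ne_none me
        obtain ⟨h1, h2⟩ := remaining_step hh H.mem H'.mem (H.loc p m ℓ hp)
          (H'.loc p m ℓ₁' (Function.update_self ..)) hn hl hev hs
        exact ⟨_, ⟨xs', qs', st', m, ℓ₁', H', hh.step H.mem hK hp hs (.inr hnn) hev hlist,
          Function.update_self .., hs.node_eq hn, h1, le_rfl⟩, h2.le.trans hv,
          fun _ => h2.trans_le hv⟩
      · cases hr
    · refine ⟨v, ⟨xs', qs', st', m, ℓ, H', hh.step H.mem hK hq hs (.inl hqp) hev hlist,
        (Function.update_of_ne hqp _ _).trans hp, hn, fun h => ?_, ?_⟩, le_rfl,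
        fun h => absurd h.symm hqp⟩
      · change (μ'.heap (μ'.head p)).seq ≤ K
        rw [hs.head_eq hqp, hev.seq _ (H.mem.seq_head p)]
        exact hl h
      · exact (remaining_evolve H.mem hev (hs.head_eq hqp) K (H.loc p m ℓ hp)).trans_le hv

theorem MemInv.seq_le_length (H : MemInv T μ xs qs) (x : ℕ) : (μ.heap x).seq ≤ xs.length := by
  by_cases hx : (μ.heap x).seq = 0
  · omega
  · obtain ⟨i, hi, hi'⟩ := H.exists_index hx
    have := lt_length_of_getElem? hi
    omega

theorem Inv.exists_remainingLe (H : Inv T μ procs xs qs st) {p : Fin n} {m m' : M} {a : A}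
    (hp : procs p = some (m', .announce m a)) :
    ∃ me K v, (K + 1) % n = p.val ∧ RemainingLe T p me K v (μ.announceNew p m a)
      (Function.update procs p (some (m', .scanHead μ.fresh ⟨0, p.pos⟩ tail 1))) := by
  have H' := H.announce hp
  have hn := p.pos
  obtain ⟨K, hK, hlt⟩ : ∃ K, (K + 1) % n = p.val ∧ xs.length < K := by
    -- A value with the right residue that exceeds every number in use. No process has yet read the
    -- number `K`, so `HelpInv` holds vacuously at the announcement.
    refine ⟨n * (xs.length + 2) + p - 1, ?_, ?_⟩
    · have : 1 ≤ n * (xs.length + 2) := Nat.mul_pos hn (Nat.succ_pos _)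
      rw [show n * (xs.length + 2) + p - 1 + 1 = n * (xs.length + 2) + p by omega,
        Nat.mul_add_mod, Nat.mod_eq_of_lt p.isLt]
    · have := Nat.le_mul_of_pos_left (xs.length + 2) hn
      omega
  refine ⟨μ.fresh, K, _, hK, xs, qs, st, m', _, H', ⟨by simp, fun h => by omega, ?_⟩,
    Function.update_self .., .inl rfl, False.elim, le_rfl⟩
  intro _ r m₁ ℓ hr
  have hloc := H'.loc r m₁ ℓ hr
  have hle := H'.mem.seq_le_length ((μ.announceNew p m a).head r)
  cases ℓ with
  | testHelp =>
    obtain ⟨-, h1, -⟩ := hloc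
    intro hs
    omega
  | decide =>
    obtain ⟨-, h1, -⟩ := hloc
    intro hs
    omega
  | _ => trivial

end Universal

namespace ConcurrentObject

variable {n : ℕ} {M A B : Type u} {O : ConcurrentObject n M A B}

theorem Trans.procs_eq {C C' : O.Config} {x : Label n M A B O.Cmd} (h : O.Trans C x C')
    {p : Fin n} (hp : x.proc ≠ p) : C'.procs p = C.procs p := by
  cases h <;> exact Function.update_of_ne (Ne.symm hp) _ _

theorem Trans.step {C C' : O.Config} {x : Label n M A B O.Cmd} (h : O.Trans C x C')
    {m : M} {ℓ : O.Loc} (hp : C.procs x.proc = some (m, ℓ)) (hr : ¬ x.IsRetOf x.proc) :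
    ∃ c ℓ' μ', O.step x.proc ℓ C.mem c ℓ' μ' ∧
      C' = ⟨μ', Function.update C.procs x.proc (some (m, ℓ'))⟩ := by
  cases h with
  | call p m' a hq => exact nomatch hq.symm.trans hp
  | ret p m' ℓ' b hq hr' => exact absurd ⟨m', b, rfl⟩ hr
  | internal p m' ℓ₁ ℓ' c μ' hq hr' hs =>
    cases hq.symm.trans hp
    exact ⟨c, ℓ', μ', hs, rfl⟩

end ConcurrentObject

/-! ### Wait-freedom on infinite traces. -/

namespace Universal

variable {n : ℕ} {M A B : Type u} {T : SeqLTS M A B}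

theorem exists_inv (hdet : T.Deterministic) (hnb : T.NonBlocking)
    {c : ℕ → (universalObject n T hnb).Config}
    {w : ℕ → Label n M A B (universalObject n T hnb).Cmd}
    (h0 : c 0 = (universalObject n T hnb).lts.init)
    (hc : ∀ k, (universalObject n T hnb).Trans (c k) (w k) (c (k + 1))) (k : ℕ) :
    ∃ xs qs st, Inv T (c k).mem (c k).procs xs qs st := by
  induction k with
  | zero =>
    rw [h0]
    exact ⟨_, _, _, Inv.initial T⟩
  | succ k ih =>
    obtain ⟨xs, qs, st, H⟩ := ih
    have hx := hc k
    generalize c (k + 1) = C' at hx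
    generalize w k = x at hx
    cases hx with
    | call p m a hp => exact ⟨_, _, _, H.call hp m a⟩
    | ret p m ℓ b hp hr =>
      have hℓ : ℓ = .done b := by
        cases ℓ <;> cases hr
        rfl
      subst hℓ
      exact ⟨_, _, _, H.ret hp⟩
    | internal p m ℓ ℓ' c μ' hp hr hs =>
      obtain ⟨xs', qs', st', H', -⟩ := H.step hdet hnb hp hs
      exact ⟨_, _, _, H'⟩

theorem universalObject_waitFree (hdet : T.Deterministic) (hnb : T.NonBlocking) :
    (universalObject n T hnb).Satisfies .WF := by
  rintro w ⟨c, h0, hc⟩ hsched p₀ k₀ hcall₀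
  by_contra hcon
  -- The process `p₀` itself may never be scheduled again; the contradiction comes from an
  -- unanswered call whose process acts infinitely often.
  obtain ⟨p, k, ⟨⟨m, a, hcall⟩, hret⟩, hio⟩ :=
    hsched ⟨p₀, k₀, hcall₀, fun j hj h => hcon ⟨j, hj, h⟩⟩
  replace hc : ∀ k, (universalObject n T hnb).Trans (c k) (w k) (c (k + 1)) := hc
  have hstart : (c (k + 1)).procs p = some (m, .announce m a) := by
    have hx := hc k
    rw [hcall] at hx
    generalize c (k + 1) = C' at hx
    cases hx with
    | call _ _ _ hp => exact Function.update_self ..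
  have hwait : ∀ d, (∀ i, i < d → (w (k + 1 + i)).proc ≠ p) →
      (c (k + 1 + d)).procs p = some (m, .announce m a) := by
    intro d
    induction d with
    | zero => exact fun _ => hstart
    | succ d ih =>
      intro hd
      exact ((hc _).procs_eq (hd d (Nat.lt_succ_self d))).trans
        (ih fun i hi => hd i (Nat.lt_succ_of_lt hi))
  have hact : ∀ N, ∃ d, (w (N + d)).proc = p := by
    intro N
    obtain ⟨j, hj, hjp⟩ := hio N
    exact ⟨j - N, by rwa [Nat.add_sub_cancel' hj]⟩
  have descent : ∀ me K, (K + 1) % n = p.val → ∀ v j, k < j →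
      ¬ RemainingLe T p me K v (c j).mem (c j).procs := by
    intro me K hK v
    induction v using Nat.strong_induction_on with
    | _ v ih =>
      intro j hj h
      have hstay : ∀ d, (∀ v' < v, ¬ RemainingLe T p me K v' (c (j + d)).mem (c (j + d)).procs) ∧
          RemainingLe T p me K v (c (j + d)).mem (c (j + d)).procs := by
        intro d
        refine ⟨fun v' hv' => ih v' hv' _ (by omega), ?_⟩
        induction d with
        | zero => exact h
        | succ d ihd =>
          obtain ⟨v', h1, h2, -⟩ := ihd.step hdet hnb hK (hc (j + d)) (hret _ (by omega))
          rcases h2.eq_or_lt with rfl | h2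
          · exact h1
          · exact absurd h1 (ih v' h2 _ (by omega))
      obtain ⟨d, hd⟩ := hact j
      obtain ⟨v', h1, -, h2⟩ := (hstay d).2.step hdet hnb hK (hc (j + d)) (hret _ (by omega))
      exact ih v' (h2 hd) _ (by omega) h1
  -- The bound is available only after the announcement, which is the first action of `p` following
  -- its call.
  have hfirst := hact (k + 1)
  have hloc := hwait (Nat.find hfirst) fun i hi => Nat.find_min hfirst hi
  have hproc := Nat.find_spec hfirst
  generalize hj : k + 1 + Nat.find hfirst = j at hloc hproc
  obtain ⟨xs, qs, st, H⟩ := exists_inv hdet hnb h0 hc j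
  obtain ⟨me, K, v, hK, hrem⟩ := H.exists_remainingLe hloc
  subst hproc
  obtain ⟨cmd, ℓ', μ', hs, hC⟩ := (hc j).step hloc (hret j (by omega))
  change Step T _ _ _ _ _ at hs
  cases hs with
  | announce =>
    refine descent me K hK v (j + 1) (by omega) ?_
    rw [hC]
    exact hrem

end Universal

/-! ### The class of strongly linearizable objects -/

/-- The class consists of the linearizable objects with the progress property that are equivalent to
`O`. A class that shares a member with it is contained in it by mutual simulation, and contains it
by maximality. -/
theorem theorem4 {n : ℕ} {M A B : Type u} (T : SeqLTS M A B)
    (hdet : T.Deterministic) (hnb : T.NonBlocking) (P : Progress)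
    (O : ConcurrentObject n M A B)
    (hO : O.StronglyLinearizable T.traces) (hP : O.Satisfies P) :
    (∃ S : Set (LTS n M A B), IsProgressClass P T.traces S ∧
      O.sem ∈ S ∧ (universalObject n T hnb).sem ∈ S ∧
      (∀ S' : Set (LTS n M A B), IsProgressClass P T.traces S' → O.sem ∈ S' → S' = S) ∧
      (∀ S' : Set (LTS n M A B), IsProgressClass P T.traces S' →
        (universalObject n T hnb).sem ∈ S' → S' = S)) ∧
    (∀ O' : ConcurrentObject n M A B, O'.StronglyLinearizable T.traces → O'.Satisfies P →
      O.sem.Sim O'.sem ∧ O'.sem.Sim O.sem) := by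
  have sim_of_atomic : ∀ O' : ConcurrentObject n M A B, O'.Linearizable T.traces →
      O'.Satisfies P → (T.atomic n).Sim O'.sem :=
    fun O' hl hp => ConcurrentObject.atomic_sim hdet hl fun w hw => (hp w hw).to_of
  have hUsim := Universal.universalObject_sim_atomic (n := n) hdet hnb
  have hUlin := ConcurrentObject.linearizable_of_sim_atomic hUsim
  have hUprog : (universalObject n T hnb).Satisfies P :=
    fun w hw => (Universal.universalObject_waitFree hdet hnb w hw).of_wf P
  have hOsim := hO.sim_atomic hdet
  have hOlin := hO.linearizable
  have hOU := hOsim.trans (sim_of_atomic _ hUlin hUprog)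
  have hUO := hUsim.trans (sim_of_atomic _ hOlin hP)
  have hOO := hOsim.trans (sim_of_atomic _ hOlin hP)
  let S : Set (LTS n M A B) := {L | (∃ O' : ConcurrentObject n M A B, L = O'.sem ∧
    O'.Linearizable T.traces ∧ O'.Satisfies P) ∧ L.Sim O.sem ∧ O.sem.Sim L}
  have hOS : O.sem ∈ S := ⟨⟨O, rfl, hOlin, hP⟩, hOO, hOO⟩
  have hUS : (universalObject n T hnb).sem ∈ S := ⟨⟨_, rfl, hUlin, hUprog⟩, hUO, hOU⟩
  have unique : ∀ S' : Set (LTS n M A B), IsProgressClass P T.traces S' →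
      ∀ L ∈ S, L ∈ S' → S' = S := by
    intro S' hS' L hL hL'
    ext L'
    constructor
    · intro h
      obtain ⟨h1, h2⟩ := hS'.sim L' h L hL'
      exact ⟨hS'.isObject L' h, h1.trans hL.2.1, hL.2.2.trans h2⟩
    · rintro ⟨⟨O', rfl, h1, h2⟩, h3, h4⟩
      exact hS'.maximal O' h1 h2 L hL' (h3.trans hL.2.2) (hL.2.1.trans h4)
  refine ⟨⟨S, ⟨fun L hL => hL.1, ?_, ?_⟩, hOS, hUS, fun S' hS' h => unique S' hS' _ hOS h,
    fun S' hS' h => unique S' hS' _ hUS h⟩, ?_⟩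
  · exact fun L₁ h₁ L₂ h₂ => ⟨h₁.2.1.trans h₂.2.2, h₂.2.1.trans h₁.2.2⟩
  · exact fun O' h1 h2 L hL h3 h4 => ⟨⟨O', rfl, h1, h2⟩, h3.trans hL.2.1, hL.2.2.trans h4⟩
  · exact fun O' h1 h2 => ⟨hOsim.trans (sim_of_atomic O' h1.linearizable h2),
      (h1.sim_atomic hdet).trans (sim_of_atomic O hOlin hP)⟩
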